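/- **Setting.** Circuits consist of CNOT gates and arbitrary single-qubit unitaries; the cost is the number of CNOTs. An isometry from $m$ to $n$ qubits is a complex $2^n\times 2^m$ matrix $W$ with $W^\dagger W=I$. A circuit on $n$ data qubits, $a$ clean ancillas and $b$ dirty ancillas implements a $2^n\times 2^m$ matrix $V$ if it maps $|0\rangle_{n-m}|x\rangle_m\otimes|0\rangle_a\otimes|\varphi\rangle_b$ to $V|x\rangle\otimes|0\rangle_a\otimes|\varphi\rangle_b$ for every $x$ and every state $|\varphi\rangle$ of the dirty ancillas. Let $\operatorname{nnz}$ denote the number of non-zero entries. *Householder reflections.* For unit vectors $v,w$ let $\theta=\pi-\arg\langle v|w\rangle$ (and $\theta=0$ if $\langle v|w\rangle=0$), $u=(v-e^{\mathrm i\theta}w)/\|v-e^{\mathrm i\theta}w\|$, $H_u=I-2|u\rangle\langle u|$ and $H_{v,w}=H_u$; thus $H_{v,w}v=e^{\mathrm i\theta}w$. *Costs.* For given numbers $a,b$ of clean and dirty ancillas, let $\mathcal N_{\mathrm{iso}}(W)$ be the least number of CNOTs of a circuit that implements $W$. Let $\mathcal N_H^{\Delta\Pi}(n,s)$ be the number of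 CNOTs required to implement $H_v$ up to a diagonal and a permutation gate, for any state $v$ on $n$ qubits with at most $2^s$ non-zero entries, i.e. the supremum over all such $v$ of the minimal cost of implementing $\Delta\Pi H_v$ for some diagonal unitary $\Delta$ and some permutation matrix $\Pi$. Let $\mathcal N_{\Pi I\Delta}(n,m)$ be the supremum of the minimal costs of the isometries $\Pi_n I_{n,m}\Delta_m$, where $\Pi_n$ is a permutation matrix, $I_{n,m}$ consists of the first $2^m$ columns of the identity and $\Delta_m$ is a diagonal unitary. (Costs are $\infty$ where no circuit exists.) *Decomposition.* An elimination strategy $(\rho,\sigma)$ for an isometry $W$ from $m$ to $n$ qubits is a permutation $\rho$ of the $2^n$ rows and a permutation $\sigma$ of the $2^m$ columns. Given any diagonal unitaries $\Delta^i$ and permutation matrices $\Pi^i$ of size $2^n$, put $W_0=W$ and, for $i=0,\dots,2^m-1$, $$|w_i\rangle=W_i|\sigma(i)\rangle,\qquad W_{i+1}=\Delta^i\,\Pi^i\,H_{w_i,\tilde\rho(i)}\,W_i,\qquad \tilde\rho(i)=(\Pi^{i-1}\cdots\Pi^0)(\rho(i)),$$ and $\operatorname{elim}(W,\rho,\sigma)=\sum_{i=0}^{2^m-1}(\operatorname{nnz}(w_i)-1)$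 (the choice $\Delta^i=\Pi^i=I$ is allowed). **Lemma.** Let $W$ be an isometry from $m$ to $n$ qubits, let $(\rho,\sigma)$ be an elimination strategy, and let $w_i$ and $\operatorname{elim}(W,\rho,\sigma)$ be as above for any choice of the $\Delta^i,\Pi^i$. 1. For all numbers $a$ of clean and $b$ of dirty ancillas, the same throughout, $$\mathcal N_{\mathrm{iso}}(W)\le\sum_{i=0}^{2^m-1}\mathcal N_H^{\Delta\Pi}(n,s(i))+\mathcal N_{\Pi I\Delta}(n,m),\qquad s(i)=\lceil\log_2(1+\operatorname{nnz}(w_i))\rceil .$$ 2. If $n\ge 2$, then $W$ can be implemented with $\lceil\frac{n-3}{2}\rceil$ clean ancillas and at most $$(7n-3)\operatorname{elim}(W,\rho,\sigma)+(21n+24m-38)\,2^m\quad\text{CNOTs}.$$ 3. If $n\ge 1$, then $W$ can be implemented with one dirty ancilla and at most $$(17n-5)\operatorname{elim}(W,\rho,\sigma)+(51n+34m-44)\,2^m\quad\text{CNOTs}.$$ -/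

import Mathlib

open scoped Matrix

noncomputable section

namespace QCircuit

/-! ### Circuits of CNOT and single-qubit gates -/

/-- Elementary gates on a set `Q` of qubits: arbitrary single-qubit unitaries and CNOTs. -/
inductive Gate (Q : Type) : Type where
  | single (q : Q) (U : Matrix.unitaryGroup Bool ℂ) : Gate Q
  | cnot (control target : Q) (h : control ≠ target) : Gate Q

/-- The unitary of a gate in the computational basis, which is indexed by bit strings `Q → Bool`
(column = input string, row = output string). -/
def Gate.toMatrix {Q : Type} [Fintype Q] [DecidableEq Q] :
    Gate Q → Matrix (Q → Bool) (Q → Bool) ℂ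
  | .single q U => Matrix.of fun y x =>
      if ∀ r, r ≠ q → y r = x r then (U : Matrix Bool Bool ℂ) (y q) (x q) else 0
  | .cnot c t _ => Matrix.of fun y x =>
      if y = Function.update x t (xor (x t) (x c)) then 1 else 0

/-- Number of CNOTs of a gate. -/
def Gate.cnots {Q : Type} : Gate Q → ℕ
  | .single _ _ => 0
  | .cnot _ _ _ => 1

/-- The unitary of a circuit; the head of the list is the gate that is applied first. -/
def circuitMatrix {Q : Type} [Fintype Q] [DecidableEq Q] :
    List (Gate Q) → Matrix (Q → Bool) (Q → Bool) ℂ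
  | [] => 1
  | g :: C => circuitMatrix C * g.toMatrix

/-- Number of CNOTs of a circuit. -/
def cnotCount {Q : Type} (C : List (Gate Q)) : ℕ := (C.map Gate.cnots).sum

/-- Circuits on `n` data qubits, `a` clean ancillas and `b` dirty ancillas. -/
abbrev Circuit (n a b : ℕ) : Type := List (Gate (Fin n ⊕ Fin a ⊕ Fin b))

/-- The `n` least significant binary digits of `k`; qubit `0` is the least significant one. -/
def bits (n k : ℕ) : Fin n → Bool := fun q => k.testBit q

/-- Computational basis state of the data qubits, the clean and the dirty ancillas. -/
def regState {n a b : ℕ} (y : Fin n → Bool) (e : Fin a → Bool) (f : Fin b → Bool) :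
    Fin n ⊕ Fin a ⊕ Fin b → Bool :=
  Sum.elim y (Sum.elim e f)

/-- `C` implements the map `V` from `m` to `n` qubits: the input is on the `m` least significant
data qubits, the other data qubits start in `|0⟩`; the clean ancillas start in `|0⟩` and return to
`|0⟩`; the dirty ancillas start in an arbitrary state and are restored. That is,
`C (|x⟩ ⊗ |0⟩ ⊗ |f'⟩) = V |x⟩ ⊗ |0⟩ ⊗ |f'⟩` for all basis states `x`, `f'`. -/
def Implements {m n a b : ℕ} (C : Circuit n a b)
    (V : Matrix (Fin (2 ^ n)) (Fin (2 ^ m)) ℂ) : Prop :=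
  ∀ (y : Fin (2 ^ n)) (x : Fin (2 ^ m)) (e : Fin a → Bool) (f f' : Fin b → Bool),
    circuitMatrix C (regState (bits n y) e f) (regState (bits n x) (fun _ => false) f') =
      if e = (fun _ => false) ∧ f = f' then V y x else 0

/-- The least number of CNOTs of a circuit with `a` clean and `b` dirty ancillas that implements
some member of `T` (it is `⊤` if there is no such circuit). -/
def cnotCost (a b : ℕ) {m n : ℕ} (T : Set (Matrix (Fin (2 ^ n)) (Fin (2 ^ m)) ℂ)) : ℕ∞ :=
  ⨅ (C : Circuit n a b) (_ : ∃ V ∈ T, Implements C V), (cnotCount C : ℕ∞)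

/-! ### Isometries, permutation gates, diagonal gates, Householder reflections -/

/-- `V` is an isometry. -/
def IsIsometry {m n : ℕ} (V : Matrix (Fin (2 ^ n)) (Fin (2 ^ m)) ℂ) : Prop := Vᴴ * V = 1

/-- The permutation gate `|x⟩ ↦ |π x⟩`. -/
def permGate {ι : Type} [DecidableEq ι] (π : Equiv.Perm ι) : Matrix ι ι ℂ :=
  Matrix.of fun y x => if y = π x then 1 else 0

/-- The diagonal gate `|x⟩ ↦ d x |x⟩` with phases `d x`. -/
def diagGate {ι : Type} [DecidableEq ι] (d : ι → Circle) : Matrix ι ι ℂ :=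
  Matrix.diagonal fun x => (d x : ℂ)

/-- The first `2 ^ m` columns of the identity on `n` qubits. -/
def idIso (n m : ℕ) : Matrix (Fin (2 ^ n)) (Fin (2 ^ m)) ℂ :=
  Matrix.of fun y x => if (y : ℕ) = (x : ℕ) then 1 else 0

/-- Number of non-zero entries. -/
def nnz {ι : Type} (v : ι → ℂ) : ℕ := (Function.support v).ncard

/-- The standard Householder reflection `I - 2 |u⟩⟨u|`. -/
def householder {ι : Type} [DecidableEq ι] (u : EuclideanSpace ℂ ι) : Matrix ι ι ℂ :=
  1 - (2 : ℂ) • Matrix.vecMulVec u.ofLp (star u.ofLp)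

/-- The angle `π - arg ⟨v|w⟩`, or `0` if `⟨v|w⟩ = 0`. -/
def householderAngle {ι : Type} [Fintype ι] (v w : EuclideanSpace ℂ ι) : ℝ :=
  open Classical in if inner ℂ v w = 0 then 0 else Real.pi - Complex.arg (inner ℂ v w)

/-- The normalization of `|v⟩ - exp(iθ) |w⟩` with `θ = householderAngle v w`. -/
def householderVector {ι : Type} [Fintype ι] (v w : EuclideanSpace ℂ ι) : EuclideanSpace ℂ ι :=
  let u := v - Complex.exp (householderAngle v w * Complex.I) • w
  ((‖u‖⁻¹ : ℝ) : ℂ) • u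

/-- The standard Householder reflection `H_{v,w}`, which maps `|v⟩` to `exp(iθ) |w⟩`. -/
def householderMap {ι : Type} [Fintype ι] [DecidableEq ι] (v w : EuclideanSpace ℂ ι) :
    Matrix ι ι ℂ :=
  householder (householderVector v w)

/-! ### CNOT counts of the building blocks -/

/-- `N_H^{ΔΠ}(n,s)`: the number of CNOTs required, with `a` clean and `b` dirty ancillas, to
implement `H_v`, up to a diagonal and a permutation gate, for any state `v` on `n` qubits with at
most `2 ^ s` non-zero entries. -/
def householderCost (a b n s : ℕ) : ℕ∞ :=
  ⨆ (v : EuclideanSpace ℂ (Fin (2 ^ n))) (_ : ‖v‖ = 1) (_ : nnz v.ofLp ≤ 2 ^ s),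
    cnotCost a b {M | ∃ (d : Fin (2 ^ n) → Circle) (π : Equiv.Perm (Fin (2 ^ n))),
      M = diagGate d * permGate π * householder v}

/-- `N_{ΠIΔ}(n,m)`: the number of CNOTs required, with `a` clean and `b` dirty ancillas, to
implement any isometry of the form `Π_n I_{n,m} Δ_m`. -/
def permDiagCost (a b n m : ℕ) : ℕ∞ :=
  ⨆ (π : Equiv.Perm (Fin (2 ^ n))) (d : Fin (2 ^ m) → Circle),
    cnotCost a b {permGate π * idIso n m * diagGate d}

/-! ### The sparse Householder decomposition -/

/-- The `j`-th column of a matrix. -/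
def column {m n : ℕ} (V : Matrix (Fin (2 ^ n)) (Fin (2 ^ m)) ℂ) (j : Fin (2 ^ m)) :
    EuclideanSpace ℂ (Fin (2 ^ n)) :=
  WithLp.toLp 2 fun r => V r j

/-- The composition `Π^{i-1} ⋯ Π^1 Π^0`. -/
def cumPerm {ι : Type} (P : ℕ → Equiv.Perm ι) : ℕ → Equiv.Perm ι
  | 0 => 1
  | i + 1 => P i * cumPerm P i

/-- The matrices `W_i` of the decomposition of `W` with elimination strategy `(ρ, σ)`, where the
`i`-th reflection is applied up to the diagonal gate with phases `D i` and the permutation `P i`: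
`W_0 = W` and `W_{i+1} = Δ_i Π^i H_{w_i, ρ'(i)} W_i`, where `w_i` is column `σ(i)` of `W_i` and
`ρ'(i) = (Π^{i-1} ⋯ Π^0)(ρ(i))`. Only the steps `i < 2 ^ m` are ever used, for which
`Fin.ofNat _ i` is just `i`. -/
def reduced {m n : ℕ} (W : Matrix (Fin (2 ^ n)) (Fin (2 ^ m)) ℂ)
    (ρ : Equiv.Perm (Fin (2 ^ n))) (σ : Equiv.Perm (Fin (2 ^ m)))
    (D : ℕ → Fin (2 ^ n) → Circle) (P : ℕ → Equiv.Perm (Fin (2 ^ n))) :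
    ℕ → Matrix (Fin (2 ^ n)) (Fin (2 ^ m)) ℂ
  | 0 => W
  | i + 1 =>
      diagGate (D i) * permGate (P i) *
        householderMap (column (reduced W ρ σ D P i) (σ (Fin.ofNat (2 ^ m) i)))
          (EuclideanSpace.single (cumPerm P i (ρ (Fin.ofNat (2 ^ n) i))) 1) *
        reduced W ρ σ D P i

/-- `nnz(w_i)`, where `w_i` is the column that is reduced in step `i`. -/
def stepNnz {m n : ℕ} (W : Matrix (Fin (2 ^ n)) (Fin (2 ^ m)) ℂ)
    (ρ : Equiv.Perm (Fin (2 ^ n))) (σ : Equiv.Perm (Fin (2 ^ m)))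
    (D : ℕ → Fin (2 ^ n) → Circle) (P : ℕ → Equiv.Perm (Fin (2 ^ n))) (i : ℕ) : ℕ :=
  nnz (column (reduced W ρ σ D P i) (σ (Fin.ofNat (2 ^ m) i))).ofLp

/-- The total number of eliminations `∑ i, (nnz(w_i) - 1)`. -/
def elim {m n : ℕ} (W : Matrix (Fin (2 ^ n)) (Fin (2 ^ m)) ℂ)
    (ρ : Equiv.Perm (Fin (2 ^ n))) (σ : Equiv.Perm (Fin (2 ^ m)))
    (D : ℕ → Fin (2 ^ n) → Circle) (P : ℕ → Equiv.Perm (Fin (2 ^ n))) : ℤ :=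
  ∑ i ∈ Finset.range (2 ^ m), ((stepNnz W ρ σ D P i : ℤ) - 1)

end QCircuit

end

/-! The bound by reflections and the explicit counts share one decomposition. A circuit for a
reflection is only known up to some monomial gate (diagonal times permutation), which need not be
the prescribed `Δ^i Π^i`. The circuit `T` built so far therefore satisfies only `T W = G W_i` with
`G` monomial. This suffices: `H_{Gu} G = G H_u` for unitary `G`, and `G u` has no more non-zero
entries than `u`, so the next reflection is performed about `G u` at the cost that `w_i` predicts.
The Householder vector of step `i` lies in the span of `w_i` and one basis state, hence has at most
`nnz(w_i) + 1` non-zero entries. Finished columns are orthogonal to both of these, so they stay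
basis states up to phases. After `2^m` steps `T W` is an isometry of the form `Π I Δ`, and `W` is
obtained by running `T` backwards after a circuit for `Π I Δ` (`exists_implementable_reducing`,
`implementable_of_steps`).

For the explicit counts, everything is reduced to the cost `τ` of a NOT controlled by all other
qubits, i.e. of exchanging two neighbouring basis states. Let a unit vector have at most `k + 1`
non-zero entries. - Its support is moved into a subcube of dimension `s` with `2^s ≤ 2k`. The first
entry is moved for free by `X` gates, each other one by a fan-out of CNOTs and one exchange: `k (n -
1 + τ)` in all (`exists_perm_lowBlock`). The permutation need not be undone. - A vector on `s`
qubits is rotated to the zero state with `2 (2^s - 2)` CNOTs by multiplexed `z` rotations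
(`exists_disentangle_all`). Conjugating the reflection about the zero state costs `4 (2^s - 2) + τ ≤
8k - 8 + τ`. With `k = nnz(w_i)` the sum over the steps is linear in `elim`, and `Π I Δ` adds at
most `2^m (2n - 1 + τ)`.

Finally `τ` is bounded using relative-phase Toffoli gates, whose unwanted phases cancel between
computing and uncomputing: `6n - 12` with clean ancillas if `n ≥ 3` (`exists_mcx_clean`) and `16 (n
- 1)` with one dirty ancilla (`hasCircuit_mcx_one_dirty`). -/

noncomputable section

set_option linter.unusedSectionVars false
set_option linter.unusedSimpArgs false

namespace QCircuit

/-! ### Monomial and multiplexed matrices on the cube -/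

section Cube

variable {Q : Type} [Fintype Q] [DecidableEq Q]

/-- The monomial matrix `|x⟩ ↦ φ x |S x⟩`. -/
def mono (S : (Q → Bool) → Q → Bool) (φ : (Q → Bool) → ℂ) : Matrix (Q → Bool) (Q → Bool) ℂ :=
  Matrix.of fun y x => if y = S x then φ x else 0

/-- The gate `F x` on qubit `t`, multiplexed over the other qubits of `x`. -/
def mux (t : Q) (F : (Q → Bool) → Matrix Bool Bool ℂ) : Matrix (Q → Bool) (Q → Bool) ℂ :=
  Matrix.of fun y x => if ∀ r, r ≠ t → y r = x r then F x (y t) (x t) else 0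

/-- `F` does not depend on bit `t`. -/
def Indep {α : Type} (t : Q) (F : (Q → Bool) → α) : Prop :=
  ∀ x b, F (Function.update x t b) = F x

lemma mul_mono_apply (A : Matrix (Q → Bool) (Q → Bool) ℂ) (S : (Q → Bool) → Q → Bool)
    (φ : (Q → Bool) → ℂ) (y x : Q → Bool) : (A * mono S φ) y x = A y (S x) * φ x := by
  simp [Matrix.mul_apply, mono]

lemma mono_mul_mono (S S' : (Q → Bool) → Q → Bool) (φ φ' : (Q → Bool) → ℂ) :
    mono S φ * mono S' φ' = mono (S ∘ S') (fun x => φ' x * φ (S' x)) := by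
  ext y x
  rw [mul_mono_apply]
  simp [mono, mul_comm]

lemma mono_id : mono (Q := Q) id 1 = 1 := by
  ext y x
  simp [mono, Matrix.one_apply]

lemma agree_iff (t : Q) (y x : Q → Bool) :
    (∀ r, r ≠ t → y r = x r) ↔ y = Function.update x t (y t) := by
  constructor
  · intro h
    funext r
    by_cases hr : r = t
    · subst hr; simp
    · simp [hr, h r hr]
  · intro h r hr
    rw [h]; simp [hr]

lemma sum_agree (t : Q) (x : Q → Bool) (h : (Q → Bool) → ℂ) :
    (∑ z, if ∀ r, r ≠ t → z r = x r then h z else 0) = ∑ b, h (Function.update x t b) := by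
  rw [← Finset.sum_filter]
  symm
  apply Finset.sum_bij (fun b _ => Function.update x t b)
  · intro b _
    simp only [Finset.mem_filter, Finset.mem_univ, true_and]
    intro r hr
    simp [hr]
  · intro a _ b _ hab
    simpa using congrFun hab t
  · intro z hz
    simp only [Finset.mem_filter, Finset.mem_univ, true_and] at hz
    exact ⟨z t, Finset.mem_univ _, ((agree_iff t z x).1 hz).symm⟩
  · intros; rfl

lemma mul_mux_apply (A : Matrix (Q → Bool) (Q → Bool) ℂ) (t : Q)
    (F : (Q → Bool) → Matrix Bool Bool ℂ) (y x : Q → Bool) :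
    (A * mux t F) y x = ∑ b, A y (Function.update x t b) * F x b (x t) := by
  have := sum_agree t x (fun z => A y z * F x (z t) (x t))
  simp only [Function.update_self] at this
  rw [← this, Matrix.mul_apply]
  refine Finset.sum_congr rfl fun z _ => ?_
  simp only [mux, Matrix.of_apply, mul_ite, mul_zero]

lemma mux_update_apply {t : Q} {F : (Q → Bool) → Matrix Bool Bool ℂ} (hF : Indep t F)
    (y x : Q → Bool) (b : Bool) :
    mux t F y (Function.update x t b) = if ∀ r, r ≠ t → y r = x r then F x (y t) b else 0 := by
  simp only [mux, Matrix.of_apply, Function.update_self, hF x b]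
  congr 1
  apply propext
  refine forall_congr' fun r => forall_congr' fun hr => ?_
  simp [hr]

/-- The right factor changes only bit `t`, so the left factor still sees the same block as long as
its blocks ignore `t`; the blocks then multiply pointwise. -/
lemma mux_mul_mux {t : Q} {F G : (Q → Bool) → Matrix Bool Bool ℂ} (hF : Indep t F) :
    mux t F * mux t G = mux t (fun x => F x * G x) := by
  ext y x
  rw [mul_mux_apply]
  simp only [mux_update_apply hF]
  simp only [mux, Matrix.of_apply, Matrix.mul_apply]
  split_ifs <;> simp

lemma mux_one (t : Q) : mux t (fun _ => 1) = 1 := by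
  ext y x
  simp only [mux, Matrix.of_apply, Matrix.one_apply, agree_iff]
  by_cases h : y = x
  · simp [h]
  · rw [if_neg h]
    split_ifs with h1 h2
    · rw [h2] at h1; simp at h1; exact absurd h1 h
    · rfl
    · rfl

lemma mux_conjTranspose {t : Q} {F : (Q → Bool) → Matrix Bool Bool ℂ} (hF : Indep t F) :
    (mux t F)ᴴ = mux t (fun x => (F x)ᴴ) := by
  ext y x
  simp only [mux, Matrix.of_apply, Matrix.conjTranspose_apply]
  by_cases h : ∀ r, r ≠ t → x r = y r
  · rw [if_pos h, if_pos fun r hr => (h r hr).symm, ← hF y (x t), ← (agree_iff t x y).1 h]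
  · rw [if_neg h, if_neg fun h' => h fun r hr => (h' r hr).symm]
    simp

/-- A monomial matrix that commutes with setting bit `t` can be moved past a multiplexed gate. -/
lemma mux_mul_mono {t : Q} {F : (Q → Bool) → Matrix Bool Bool ℂ}
    {S : (Q → Bool) → Q → Bool} {φ : (Q → Bool) → ℂ} (hφ : Indep t φ)
    (hS : ∀ x b, S (Function.update x t b) = Function.update (S x) t b) :
    mux t F * mono S φ = mono S φ * mux t (fun x => F (S x)) := by
  have ht : ∀ x, S x t = x t := fun x => by
    have := congrFun (hS x (x t)) t
    simpa using this
  ext y x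
  rw [mul_mono_apply, mul_mux_apply]
  simp only [mono, Matrix.of_apply, hS, hφ x]
  simp only [mux, Matrix.of_apply, agree_iff, ht]
  by_cases h : y = Function.update (S x) t (y t)
  · rw [if_pos h, Finset.sum_eq_single (y t)]
    · rw [if_pos h]; ring
    · intro b _ hb
      rw [if_neg, zero_mul]
      intro h'
      apply hb
      rw [h']; simp
    · simp
  · rw [if_neg h, Finset.sum_eq_zero, zero_mul]
    intro b _
    rw [if_neg, zero_mul]
    intro h'
    apply h
    rw [h']; simp

/-- A multiplexed gate with monomial blocks is monomial. -/
lemma mux_eq_mono {t : Q} {F : (Q → Bool) → Matrix Bool Bool ℂ} {p : (Q → Bool) → Bool}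
    (hF : ∀ x b, F x b (x t) ≠ 0 → b = xor (x t) (p x)) :
    mux t F = mono (fun x => Function.update x t (xor (x t) (p x)))
      (fun x => F x (xor (x t) (p x)) (x t)) := by
  ext y x
  simp only [mux, mono, Matrix.of_apply, agree_iff]
  by_cases h : y = Function.update x t (y t)
  · rw [if_pos h]
    by_cases h2 : y t = xor (x t) (p x)
    · rw [← h2, if_pos h]
    · rw [if_neg]
      · by_contra h3
        exact h2 (hF x _ h3)
      · intro h3
        apply h2
        rw [h3]; simp
  · rw [if_neg h, if_neg]
    intro h2
    apply h
    rw [h2]; simp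

/-! ### Circuits without ancillas -/

lemma single_toMatrix (q : Q) (U : Matrix.unitaryGroup Bool ℂ) :
    (Gate.single q U).toMatrix = mux q (fun _ => (U : Matrix Bool Bool ℂ)) := rfl

/-- The action of a CNOT on bit strings. -/
def cx (c t : Q) (x : Q → Bool) : Q → Bool := Function.update x t (xor (x t) (x c))

lemma cnot_toMatrix {c t : Q} (h : c ≠ t) : (Gate.cnot c t h).toMatrix = mono (cx c t) 1 := rfl

/-- The Pauli `X` gate, if `b` is set. -/
def xPow (b : Bool) : Matrix Bool Bool ℂ := Matrix.of fun i j => if i = xor j b then 1 else 0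

lemma xPow_mul (a b : Bool) : xPow a * xPow b = xPow (xor a b) := by
  ext i j
  simp only [xPow, Matrix.mul_apply, Matrix.of_apply, Fintype.sum_bool]
  revert a b i j
  simp

lemma xPow_false : xPow false = 1 := by
  ext i j; revert i j; simp [xPow]

lemma xPow_conjTranspose (a : Bool) : (xPow a)ᴴ = xPow a := by
  ext i j; revert a i j; simp [xPow]

lemma xPow_mem (b : Bool) : xPow b ∈ Matrix.unitaryGroup Bool ℂ := by
  rw [Matrix.mem_unitaryGroup_iff, Matrix.star_eq_conjTranspose, xPow_conjTranspose, xPow_mul]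
  simp [xPow_false]

lemma cx_eq_mux (c t : Q) : mono (cx c t) 1 = mux t (fun x => xPow (x c)) := by
  rw [mux_eq_mono (p := fun x => x c)]
  · ext y x; simp [mono, cx, xPow]; rfl
  · intro x b h
    by_contra h'
    simp [xPow, h'] at h

lemma indep_bit {c t : Q} (h : c ≠ t) : Indep t (fun x : Q → Bool => x c) := by
  intro x b; simp [h]

lemma Indep.comp {α β : Type} {t : Q} {F : (Q → Bool) → α} (h : Indep t F) (g : α → β) :
    Indep t (fun x => g (F x)) := fun x b => congrArg g (h x b)

lemma Indep.comp₂ {α β γ : Type} {t : Q} {F : (Q → Bool) → α} {G : (Q → Bool) → β}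
    (hF : Indep t F) (hG : Indep t G) (g : α → β → γ) :
    Indep t (fun x => g (F x) (G x)) := fun x b => by simp only [hF x b, hG x b]

lemma indep_const {α : Type} (t : Q) (a : α) : Indep t (fun _ : Q → Bool => a) := fun _ _ => rfl

lemma cx_cx {c t : Q} (h : c ≠ t) (x : Q → Bool) : cx c t (cx c t x) = x := by
  funext r
  by_cases hr : r = t
  · subst hr; simp [cx, h]
  · simp [cx, hr]

lemma cx_mul_cx {c t : Q} (h : c ≠ t) : mono (cx c t) 1 * mono (cx c t) 1 = 1 := by
  rw [mono_mul_mono, ← mono_id]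
  congr 1
  · funext x; exact cx_cx h x
  · simp; rfl

lemma mono_conjTranspose {S S' : (Q → Bool) → Q → Bool} (h : Function.LeftInverse S' S)
    (h' : Function.RightInverse S' S) (φ : (Q → Bool) → ℂ) :
    (mono S φ)ᴴ = mono S' (fun x => star (φ (S' x))) := by
  ext y x
  simp only [mono, Matrix.of_apply, Matrix.conjTranspose_apply]
  by_cases hy : y = S' x
  · rw [if_pos hy, hy, if_pos (h' x).symm]
  · rw [if_neg hy, if_neg, star_zero]
    intro h2
    apply hy
    rw [h2, h]

lemma cx_conjTranspose {c t : Q} (h : c ≠ t) : (mono (cx c t) 1)ᴴ = mono (cx c t) 1 := by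
  rw [mono_conjTranspose (cx_cx h) (cx_cx h)]
  congr 1
  funext x
  simp

/-- `U` is the unitary of a circuit with at most `k` CNOTs. -/
def HasCircuit (k : ℕ) (U : Matrix (Q → Bool) (Q → Bool) ℂ) : Prop :=
  ∃ C : List (Gate Q), cnotCount C ≤ k ∧ circuitMatrix C = U

lemma circuitMatrix_append (C C' : List (Gate Q)) :
    circuitMatrix (C ++ C') = circuitMatrix C' * circuitMatrix C := by
  induction C with
  | nil => simp [circuitMatrix]
  | cons g C ih => simp [circuitMatrix, ih, Matrix.mul_assoc]

lemma cnotCount_append (C C' : List (Gate Q)) :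
    cnotCount (C ++ C') = cnotCount C + cnotCount C' := by
  simp [cnotCount]

/-- The inverse gate. -/
def Gate.inv : Gate Q → Gate Q
  | .single q U => .single q U⁻¹
  | .cnot c t h => .cnot c t h

lemma Gate.inv_toMatrix (g : Gate Q) : g.inv.toMatrix = g.toMatrixᴴ := by
  cases g with
  | single q U =>
    rw [Gate.inv, single_toMatrix, single_toMatrix, mux_conjTranspose (indep_const q _)]
    rfl
  | cnot c t h => rw [Gate.inv, cnot_toMatrix, cx_conjTranspose h]

lemma Gate.toMatrix_mem (g : Gate Q) : g.toMatrixᴴ * g.toMatrix = 1 := by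
  cases g with
  | single q U =>
    rw [single_toMatrix, mux_conjTranspose (indep_const q _), mux_mul_mux (indep_const q _)]
    have : (U : Matrix Bool Bool ℂ)ᴴ * (U : Matrix Bool Bool ℂ) = 1 := U.2.1
    simp only [this]
    exact mux_one q
  | cnot c t h => rw [cnot_toMatrix, cx_conjTranspose h, cx_mul_cx h]

/-- The inverse circuit. -/
def invCircuit (C : List (Gate Q)) : List (Gate Q) := (C.map Gate.inv).reverse

lemma cnotCount_invCircuit (C : List (Gate Q)) : cnotCount (invCircuit C) = cnotCount C := by
  simp only [cnotCount, invCircuit, List.map_reverse, List.sum_reverse, List.map_map]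
  congr 1
  apply List.map_congr_left
  intro g _
  cases g <;> rfl

lemma circuitMatrix_invCircuit (C : List (Gate Q)) :
    circuitMatrix (invCircuit C) = (circuitMatrix C)ᴴ := by
  induction C with
  | nil => simp [invCircuit, circuitMatrix]
  | cons g C ih =>
    have : invCircuit (g :: C) = invCircuit C ++ [g.inv] := by simp [invCircuit]
    rw [this, circuitMatrix_append, ih]
    simp [circuitMatrix, Gate.inv_toMatrix, Matrix.conjTranspose_mul]

lemma circuitMatrix_unitary (C : List (Gate Q)) : (circuitMatrix C)ᴴ * circuitMatrix C = 1 := by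
  induction C with
  | nil => simp [circuitMatrix]
  | cons g C ih =>
    rw [circuitMatrix, Matrix.conjTranspose_mul, Matrix.mul_assoc, ← Matrix.mul_assoc _ _ g.toMatrix,
      ih, Matrix.one_mul, g.toMatrix_mem]

namespace HasCircuit

variable {k l : ℕ} {U V : Matrix (Q → Bool) (Q → Bool) ℂ}

lemma weaken (h : HasCircuit k U) (hkl : k ≤ l) : HasCircuit l U := by
  obtain ⟨C, hC, rfl⟩ := h
  exact ⟨C, hC.trans hkl, rfl⟩

lemma one : HasCircuit (Q := Q) 0 1 := ⟨[], le_rfl, rfl⟩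

lemma mul (hU : HasCircuit k U) (hV : HasCircuit l V) : HasCircuit (k + l) (U * V) := by
  obtain ⟨C, hC, rfl⟩ := hU
  obtain ⟨C', hC', rfl⟩ := hV
  exact ⟨C' ++ C, by rw [cnotCount_append]; omega, circuitMatrix_append _ _⟩

lemma conjTranspose (hU : HasCircuit k U) : HasCircuit k Uᴴ := by
  obtain ⟨C, hC, rfl⟩ := hU
  exact ⟨invCircuit C, by rwa [cnotCount_invCircuit], circuitMatrix_invCircuit C⟩

lemma unitary (hU : HasCircuit k U) : Uᴴ * U = 1 := by
  obtain ⟨C, hC, rfl⟩ := hU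
  exact circuitMatrix_unitary C

lemma single (t : Q) {A : Matrix Bool Bool ℂ} (hA : A ∈ Matrix.unitaryGroup Bool ℂ) :
    HasCircuit 0 (mux t (fun _ => A)) :=
  ⟨[.single t ⟨A, hA⟩], by simp [cnotCount, Gate.cnots], by simp [circuitMatrix, single_toMatrix]⟩

lemma cnot {c t : Q} (h : c ≠ t) : HasCircuit 1 (mono (cx c t) 1) :=
  ⟨[.cnot c t h], by simp [cnotCount, Gate.cnots], by simp [circuitMatrix, cnot_toMatrix]⟩

end HasCircuit

end Cube

/-! ### Diagonal gates -/

section Diagonal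

variable {Q : Type} [Fintype Q] [DecidableEq Q]

/-- The diagonal gate with phases `exp (i f x)`. -/
def phaseDiag (f : (Q → Bool) → ℝ) : Matrix (Q → Bool) (Q → Bool) ℂ :=
  mono id (fun x => Complex.exp (f x * Complex.I))

/-- The eigenvalue of Pauli `Z`. -/
def sgn (b : Bool) : ℝ := if b then -1 else 1

lemma sgn_xor (a b : Bool) : sgn (xor a b) = sgn a * sgn b := by
  cases a <;> cases b <;> simp [sgn]

lemma phaseDiag_mul (f g : (Q → Bool) → ℝ) :
    phaseDiag f * phaseDiag g = phaseDiag (fun x => f x + g x) := by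
  rw [phaseDiag, phaseDiag, mono_mul_mono]
  simp only [phaseDiag]
  congr 1
  funext x
  rw [← Complex.exp_add]
  push_cast
  simp only [id]
  ring_nf

lemma phaseDiag_conjTranspose (f : (Q → Bool) → ℝ) :
    (phaseDiag f)ᴴ = phaseDiag (fun x => - f x) := by
  rw [phaseDiag, mono_conjTranspose (S := id) (S' := id) (fun _ => rfl) (fun _ => rfl)]
  simp only [phaseDiag]
  congr 1
  funext x
  simp only [id, Complex.star_def, ← Complex.exp_conj]
  simp

lemma cx_mul_phaseDiag {c t : Q} (h : c ≠ t) (f : (Q → Bool) → ℝ) :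
    mono (cx c t) 1 * phaseDiag f = phaseDiag (fun x => f (cx c t x)) * mono (cx c t) 1 := by
  rw [phaseDiag, phaseDiag, mono_mul_mono, mono_mul_mono]
  congr 1
  funext x
  simp [cx_cx h]

/-- The rotation `diag (exp (i a), exp (-i a))`. -/
def rz (a : ℝ) : Matrix Bool Bool ℂ :=
  Matrix.diagonal fun b => Complex.exp ((sgn b * a : ℝ) * Complex.I)

lemma phaseDiag_eq_mux (t : Q) (g : (Q → Bool) → ℝ) :
    phaseDiag (fun x => sgn (x t) * g x) = mux t (fun x => rz (g x)) := by
  rw [mux_eq_mono (p := fun _ => false)]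
  · simp only [phaseDiag]
    congr 1
    · funext x; simp
    · funext x; simp [rz]
  · intro x b h
    by_contra h'
    apply h
    rw [rz, Matrix.diagonal_apply_ne]
    simpa using h'

lemma exp_mul_I_mul_star (a : ℝ) :
    Complex.exp (a * Complex.I) * star (Complex.exp (a * Complex.I)) = 1 := by
  rw [Complex.star_def, Complex.mul_conj, Complex.normSq_eq_norm_sq,
    Complex.norm_exp_ofReal_mul_I]
  simp

lemma rz_mem (a : ℝ) : rz a ∈ Matrix.unitaryGroup Bool ℂ := by
  rw [Matrix.mem_unitaryGroup_iff, Matrix.star_eq_conjTranspose, rz, Matrix.diagonal_conjTranspose,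
    Matrix.diagonal_mul_diagonal, ← Matrix.diagonal_one]
  congr 1
  funext b
  exact exp_mul_I_mul_star _

lemma dependsOn_empty {α : Type} {g : (Q → Bool) → α} (hg : DependsOn g (∅ : Set Q)) (x y : Q → Bool) :
    g x = g y := hg (by simp)

/-- The number of CNOTs of a rotation about the `z` axis that is multiplexed over `k` qubits. -/
def muxCost (k : ℕ) : ℕ := if k = 0 then 0 else 2 ^ k

/-- Splitting a function of the bits in `insert c s` along bit `c`. -/
lemma exists_split {s : Set Q} {c : Q} {g : (Q → Bool) → ℝ}
    (hg : DependsOn g (insert c s)) (hc : c ∉ s) :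
    ∃ α β : (Q → Bool) → ℝ, DependsOn α s ∧ DependsOn β s ∧
      ∀ x, g x = α x + sgn (x c) * β x := by
  have key : ∀ b, DependsOn (fun x => g (Function.update x c b)) s := by
    intro b x y h
    apply hg
    intro i hi
    rcases hi with rfl | hi
    · simp
    · have : i ≠ c := fun h => hc (h ▸ hi)
      simp [this, h i hi]
  refine ⟨fun x => (g (Function.update x c false) + g (Function.update x c true)) / 2,
    fun x => (g (Function.update x c false) - g (Function.update x c true)) / 2, ?_, ?_, ?_⟩
  · intro x y h
    have h1 := key false h
    have h2 := key true h
    simp only at h1 h2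
    simp only [h1, h2]
  · intro x y h
    have h1 := key false h
    have h2 := key true h
    simp only at h1 h2
    simp only [h1, h2]
  · intro x
    have : g x = g (Function.update x c (x c)) := by simp
    rw [this]
    cases x c <;> simp [sgn] <;> ring

lemma hasCircuit_rz_const (t : Q) {g : (Q → Bool) → ℝ} (hg : DependsOn g (∅ : Set Q)) :
    HasCircuit 0 (phaseDiag fun x => sgn (x t) * g x) := by
  rw [phaseDiag_eq_mux]
  have : (fun x => rz (g x)) = fun _ => rz (g fun _ => false) := by
    funext x
    rw [dependsOn_empty hg x]
  rw [this]
  exact HasCircuit.single t (rz_mem _)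

/-- Including a trailing CNOT in the statement is what saves gates in the recursion. Split the angle
as `α + sgn (x c) β`. The product `(R(α) CX(c')) · CX(c) · (CX(c') R(β))`, whose last factor is the
adjoint of a recursive circuit for `-β`, loses both CNOTs from `c'` because CNOTs with a common
target commute. Moving `R(β)` past `CX(c)` turns `β` into `sgn (x c) β`. Each recursion doubles the
count and adds one, which gives `2^k - 1` for `k` controls. -/
lemma hasCircuit_muxRz_mul_cnot (t : Q) (l : List Q) :
    ∀ (c : Q) (_ : (c :: l).Nodup) (_ : t ∉ c :: l) (g : (Q → Bool) → ℝ)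
      (_ : DependsOn g {q | q ∈ c :: l}),
      HasCircuit (2 ^ (l.length + 1) - 1)
        (phaseDiag (fun x => sgn (x t) * g x) * mono (cx c t) 1) := by
  induction l with
  | nil =>
    intro c _ ht g hg
    have hct : c ≠ t := by rintro rfl; simp at ht
    obtain ⟨α, β, hα, hβ, h⟩ := exists_split (s := ∅) (c := c) (g := g) (by simpa using hg) (by simp)
    have := ((hasCircuit_rz_const t hα).mul (HasCircuit.cnot hct)).mul (hasCircuit_rz_const t hβ)
    rw [show 2 ^ ([] : List Q).length.succ - 1 = 0 + 1 + 0 from rfl]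
    convert this using 1
    rw [Matrix.mul_assoc, cx_mul_phaseDiag hct, ← Matrix.mul_assoc, phaseDiag_mul]
    congr 2
    funext x
    have hβ' : β (cx c t x) = β x := dependsOn_empty hβ _ _
    simp only [h, hβ']
    simp only [cx, Function.update_self, sgn_xor]
    ring
  | cons c' l ih =>
    intro c hnd ht g hg
    have hct : c ≠ t := by rintro rfl; simp at ht
    have hct' : c' ≠ t := by rintro rfl; simp at ht
    have ht' : t ∉ c' :: l := fun h => ht (List.mem_cons_of_mem _ h)
    rw [List.nodup_cons] at hnd
    obtain ⟨α, β, hα, hβ, h⟩ := exists_split (s := {q | q ∈ c' :: l}) (c := c) (g := g)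
      (by convert hg using 1; ext q; simp) hnd.1
    have h1 := ih c' hnd.2 ht' α hα
    have h2 := (ih c' hnd.2 ht' (fun x => - β x)
      (fun x y hxy => congrArg Neg.neg (hβ hxy))).conjTranspose
    have := (h1.mul (HasCircuit.cnot hct)).mul h2
    have hcount : 2 ^ (l.length + 1) - 1 + 1 + (2 ^ (l.length + 1) - 1) =
        2 ^ ((c' :: l).length + 1) - 1 := by
      rw [List.length_cons, pow_succ 2 (l.length + 1)]
      have : 0 < 2 ^ (l.length + 1) := by positivity
      omega
    rw [hcount] at this
    convert this using 1
    rw [Matrix.conjTranspose_mul, phaseDiag_conjTranspose, cx_conjTranspose hct']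
    have hcomm : mono (cx c' t) 1 * (mono (cx c t) 1 * mono (cx c' t) 1) = mono (cx c t) 1 := by
      rw [mono_mul_mono, mono_mul_mono]
      congr 1
      · funext x
        funext r
        by_cases hr : r = t
        · subst hr
          simp only [cx, Function.comp, Function.update_self, Function.update_of_ne hct,
            Function.update_of_ne hct']
          cases x r <;> cases x c <;> cases x c' <;> rfl
        · simp [cx, hr]
      · funext x; simp
    rw [show ∀ a b c d e : Matrix (Q → Bool) (Q → Bool) ℂ, a * b * c * (d * e) = a * (b * (c * d)) * e
      from fun a b c d e => by simp only [Matrix.mul_assoc], hcomm, Matrix.mul_assoc,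
      cx_mul_phaseDiag hct, ← Matrix.mul_assoc, phaseDiag_mul]
    congr 2
    funext x
    have hβ' : β (cx c t x) = β x := hβ fun q hq => by
      have : q ≠ t := fun h => ht' (h ▸ hq)
      simp [cx, this]
    simp only [h, hβ']
    simp only [cx, Function.update_self, sgn_xor]
    ring

/-- Rotations about the `z` axis multiplexed over the qubits in `l`. -/
lemma hasCircuit_muxRz (t : Q) (l : List Q) (hl : l.Nodup) (ht : t ∉ l) (g : (Q → Bool) → ℝ)
    (hg : DependsOn g {q | q ∈ l}) :
    HasCircuit (muxCost l.length) (phaseDiag fun x => sgn (x t) * g x) := by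
  cases l with
  | nil => exact hasCircuit_rz_const t (by simpa using hg)
  | cons c l =>
    have hct : c ≠ t := by rintro rfl; simp at ht
    have := (hasCircuit_muxRz_mul_cnot t l c hl ht g hg).mul (HasCircuit.cnot hct)
    rw [Matrix.mul_assoc, cx_mul_cx hct, Matrix.mul_one] at this
    refine this.weaken ?_
    have : 0 < 2 ^ (l.length + 1) := by positivity
    simp [muxCost]

/-- A scalar unitary on one qubit is an allowed gate and acts as a global phase; this is why some
qubit `q` has to be supplied. -/
lemma hasCircuit_globalPhase (q : Q) {f : (Q → Bool) → ℝ} (hf : DependsOn f (∅ : Set Q)) :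
    HasCircuit 0 (phaseDiag f) := by
  have hA : Complex.exp (f (fun _ => false) * Complex.I) • (1 : Matrix Bool Bool ℂ) ∈
      Matrix.unitaryGroup Bool ℂ := by
    rw [Matrix.mem_unitaryGroup_iff, star_smul, star_one, smul_mul_smul_comm, one_mul,
      exp_mul_I_mul_star, one_smul]
  have := HasCircuit.single q hA
  convert this using 1
  rw [mux_eq_mono (p := fun _ => false)]
  · simp only [phaseDiag]
    congr 1
    · funext x; simp
    · funext x; simp [dependsOn_empty hf x (fun _ => false)]
  · intro x b h
    by_contra h'
    apply h
    rw [Matrix.smul_apply, Matrix.one_apply_ne (by simpa using h'), smul_zero]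

/-- Diagonal gates on the qubits in `l`. -/
lemma hasCircuit_phaseDiag (q : Q) (l : List Q) (hl : l.Nodup) : ∀ (f : (Q → Bool) → ℝ)
    (_ : DependsOn f {q | q ∈ l}), HasCircuit (2 ^ l.length - 2) (phaseDiag f) := by
  induction l with
  | nil => intro f hf; exact (hasCircuit_globalPhase q (by simpa using hf)).weaken (by simp)
  | cons t l ih =>
    intro f hf
    rw [List.nodup_cons] at hl
    obtain ⟨α, β, hα, hβ, h⟩ := exists_split (s := {q | q ∈ l}) (c := t) (g := f)
      (by convert hf using 1; ext q; simp) hl.1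
    have := (ih hl.2 α hα).mul (hasCircuit_muxRz t l hl.2 hl.1 β hβ)
    rw [phaseDiag_mul] at this
    have e : f = fun x => α x + sgn (x t) * β x := funext h
    rw [e]
    refine this.weaken ?_
    rw [List.length_cons, pow_succ]
    have : 0 < 2 ^ l.length := by positivity
    -- Splitting off one qubit adds a rotation multiplexed over the remaining `k`, and `(2^k - 2) +
    -- 2^k = 2^(k+1) - 2`. For `k = 0` the rotation is free and both truncated differences are `0`.
    unfold muxCost
    split_ifs with h0
    · simp [h0]
    · have : 2 ≤ 2 ^ l.length := by
        calc 2 = 2 ^ 1 := rfl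
          _ ≤ _ := Nat.pow_le_pow_right (by norm_num) (by omega)
      omega

end Diagonal

/-! ### Relative-phase multi-controlled gates -/

section Toffoli

variable {Q : Type} [Fintype Q] [DecidableEq Q]

/-- `cos (π / 8)`. -/
def cosEighth : ℝ := Real.cos (Real.pi / 8)

/-- `sin (π / 8)`. -/
def sinEighth : ℝ := Real.sin (Real.pi / 8)

lemma eighth_sq_add : (cosEighth : ℂ) ^ 2 + (sinEighth : ℂ) ^ 2 = 1 := by
  exact_mod_cast Real.cos_sq_add_sin_sq (Real.pi / 8)

/-- Both sides are double-angle values at `π / 4`, where cosine and sine agree. Hence all entries of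
`ry * ry` have the same modulus. -/
lemma eighth_sq_sub :
    (cosEighth : ℂ) ^ 2 - (sinEighth : ℂ) ^ 2 = 2 * (sinEighth : ℂ) * (cosEighth : ℂ) := by
  have h1 := Real.cos_two_mul' (Real.pi / 8)
  have h2 := Real.sin_two_mul (Real.pi / 8)
  rw [show 2 * (Real.pi / 8) = Real.pi / 4 by ring] at h1 h2
  rw [Real.cos_pi_div_four] at h1
  rw [Real.sin_pi_div_four] at h2
  exact_mod_cast h1.symm.trans h2

/-- The rotation about the `y` axis by `π / 4`. -/
def ry : Matrix Bool Bool ℂ := Matrix.of fun i j =>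
  if i = j then (cosEighth : ℂ) else if i then (sinEighth : ℂ) else - (sinEighth : ℂ)

lemma ry_mem : ry ∈ Matrix.unitaryGroup Bool ℂ := by
  rw [Matrix.mem_unitaryGroup_iff, Matrix.star_eq_conjTranspose]
  have := eighth_sq_add
  ext i j
  cases i <;> cases j <;> simp [ry, Matrix.mul_apply] <;> first | ring1 | linear_combination this

/-- A gate that conjugates `X` to `Z` or to `X`, depending on the bit `c`. -/
def toggle (c : Bool) : Matrix Bool Bool ℂ := ry * xPow c * ry

/-- The relative phase of `toggle`. -/
def relPhase (d c b : Bool) : ℂ := if d && !c && b then -1 else 1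

/-- If `c` is set, then `ry * X * ry = X`, which fixes `X` under conjugation. If `c` is clear, `ry *
ry` conjugates `X` to the diagonal matrix `Z`. Conjugation by `toggle` thus adds the control `c` to
a NOT, at the price of a sign. -/
lemma toggle_conj (d c : Bool) : (toggle c)ᴴ * xPow d * toggle c =
    Matrix.of fun i j => if i = xor j (d && c) then relPhase d c j else 0 := by
  have hu : ryᴴ * ry = 1 := ry_mem.1
  have h1 := eighth_sq_add
  have h2 := eighth_sq_sub
  cases d with
  | false =>
    rw [xPow_false, Matrix.mul_one, toggle, Matrix.conjTranspose_mul, Matrix.conjTranspose_mul,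
      xPow_conjTranspose, show ∀ a b c d e f : Matrix Bool Bool ℂ, a * (b * c) * (d * e * f) =
        a * (b * (c * d) * e) * f from fun a b c d e f => by simp only [Matrix.mul_assoc], hu,
      Matrix.mul_one, xPow_mul, Bool.xor_self, xPow_false, Matrix.mul_one, hu]
    ext i j
    simp [relPhase, Matrix.one_apply]
  | true =>
    cases c with
    | true =>
      have h : toggle true = xPow true := by
        ext i j
        cases i <;> cases j <;>
          simp [toggle, ry, xPow, Matrix.mul_apply] <;> first | ring1 | linear_combination h1
      rw [h, xPow_conjTranspose, xPow_mul, xPow_mul]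
      ext i j
      cases i <;> cases j <;> simp [xPow, relPhase]
    | false =>
      obtain ⟨r, hr⟩ : ∃ r : ℝ, r = 2 * sinEighth * cosEighth := ⟨_, rfl⟩
      have hr' : (r : ℂ) = 2 * (sinEighth : ℂ) * (cosEighth : ℂ) := by rw [hr]; push_cast; ring
      rw [← hr'] at h2
      -- With `C` and `S` the cosine and sine of `π / 8`, this is `(C² - S²)² + (2 S C)² = (C² +
      -- S²)² = 1`, where both squares on the left equal `r²`.
      have hr2 : 2 * (r : ℂ) ^ 2 = 1 := by
        linear_combination ((cosEighth : ℂ) ^ 2 + (sinEighth : ℂ) ^ 2 + 1) * h1 -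
          ((cosEighth : ℂ) ^ 2 - (sinEighth : ℂ) ^ 2 + r) * h2 +
          (r + 2 * (sinEighth : ℂ) * (cosEighth : ℂ)) * hr'
      have h : toggle false = Matrix.of fun i j => if !i && j then -(r : ℂ) else r := by
        rw [toggle, xPow_false, Matrix.mul_one]
        ext i j
        cases i <;> cases j <;> simp [ry, Matrix.mul_apply] <;> first
          | linear_combination h2 | linear_combination hr' | linear_combination -hr'
      rw [h]
      ext i j
      cases i <;> cases j <;>
        simp [Matrix.mul_apply, xPow, relPhase] <;> first | ring1 | linear_combination hr2 |
          linear_combination -hr2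

lemma hasCircuit_toggle {c t : Q} (h : c ≠ t) : HasCircuit 1 (mux t fun x => toggle (x c)) := by
  have := ((HasCircuit.single t ry_mem).mul (HasCircuit.cnot h)).mul (HasCircuit.single t ry_mem)
  rw [cx_eq_mux, mux_mul_mux (indep_const t _), mux_mul_mux] at this
  · exact this
  · exact (indep_bit h).comp fun b => ry * xPow b

/-- Conjugating a gate that acts as `X` on `t` up to phases if `p x` is set. -/
lemma toggle_mux {c t : Q} (h : c ≠ t) {p : (Q → Bool) → Bool} {κ : (Q → Bool) → ℂ}
    (hp : Indep t p) (hκ : Indep t κ) :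
    (mux t fun x => toggle (x c))ᴴ * (mux t fun x => κ x • xPow (p x)) *
      (mux t fun x => toggle (x c)) =
    mono (fun x => Function.update x t (xor (x t) (p x && x c)))
      (fun x => κ x * relPhase (p x) (x c) (x t)) := by
  have ht := (indep_bit h).comp toggle
  have ht' := (indep_bit h).comp fun b => (toggle b)ᴴ
  rw [mux_conjTranspose ht, mux_mul_mux ht', mux_mul_mux
    (ht'.comp₂ (hκ.comp₂ hp fun a b => a • xPow b) (· * ·))]
  have : ∀ x : Q → Bool, (toggle (x c))ᴴ * κ x • xPow (p x) * toggle (x c) =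
      κ x • Matrix.of fun i j => if i = xor j (p x && x c) then relPhase (p x) (x c) j else 0 := by
    intro x
    rw [← toggle_conj]
    simp
  simp only [this]
  rw [mux_eq_mono (p := fun x => p x && x c)]
  · congr 1
    funext x; simp
  · intro x b hb
    by_contra h'
    apply hb
    simp [h']

/-- The action of the multi-controlled NOT gate on bit strings. -/
def mcxFun (l : List Q) (t : Q) (x : Q → Bool) : Q → Bool :=
  Function.update x t (xor (x t) (l.all x))

lemma all_update {l : List Q} {t : Q} (h : t ∉ l) (x : Q → Bool) (b : Bool) :
    l.all (Function.update x t b) = l.all x := by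
  rw [Bool.eq_iff_iff, List.all_eq_true, List.all_eq_true]
  refine forall₂_congr fun q hq => ?_
  rw [Function.update_of_ne]
  rintro rfl
  exact h hq

lemma indep_all {l : List Q} {t : Q} (h : t ∉ l) : Indep t (fun x => l.all x) :=
  fun x b => all_update h x b

lemma all_eq_dependsOn {α : Type} (l : List Q) (g : Bool → α) :
    DependsOn (fun x : Q → Bool => g (l.all x)) {q | q ∈ l} := by
  intro x y h
  have : l.all x = l.all y := by
    rw [Bool.eq_iff_iff, List.all_eq_true, List.all_eq_true]
    exact forall₂_congr fun q hq => by rw [h q hq]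
  simp only [this]

/-- A CNOT from `c'`, conjugated by the toggle of `c`, which costs one CNOT on each side. -/
lemma hasCircuit_relToffoli {c c' t : Q} (h : c ≠ t) (h' : c' ≠ t) :
    HasCircuit 3 (mono (mcxFun [c, c'] t) (fun x => relPhase (x c') (x c) (x t))) := by
  have := ((hasCircuit_toggle h).conjTranspose.mul (HasCircuit.cnot h')).mul (hasCircuit_toggle h)
  have e := toggle_mux h (indep_bit h') (indep_const t (1 : ℂ))
  simp only [one_smul, one_mul] at e
  rw [cx_eq_mux, e] at this
  convert this using 2
  funext x
  simp [mcxFun, Bool.and_comm]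

/-- The Hadamard gate. -/
def hadamard : Matrix Bool Bool ℂ := Matrix.of fun i j =>
  if i && j then -((√2 : ℝ) : ℂ)⁻¹ else ((√2 : ℝ) : ℂ)⁻¹

lemma inv_sqrt_two_mul : ((√2 : ℝ) : ℂ)⁻¹ * ((√2 : ℝ) : ℂ)⁻¹ = 1 / 2 := by
  rw [← mul_inv, ← Complex.ofReal_mul, Real.mul_self_sqrt (by norm_num)]
  norm_num

lemma hadamard_conjTranspose : hadamardᴴ = hadamard := by
  ext i j
  cases i <;> cases j <;> simp [hadamard]

lemma hadamard_mul_hadamard : hadamard * hadamard = 1 := by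
  have := inv_sqrt_two_mul
  ext i j
  cases i <;> cases j <;> simp [hadamard, Matrix.mul_apply] <;> linear_combination 2 * this

lemma hadamard_mem : hadamard ∈ Matrix.unitaryGroup Bool ℂ := by
  rw [Matrix.mem_unitaryGroup_iff, Matrix.star_eq_conjTranspose, hadamard_conjTranspose,
    hadamard_mul_hadamard]

lemma hadamard_diagonal (a b : ℂ) : hadamard * Matrix.diagonal (fun i => if i then b else a) *
    hadamard = Matrix.of fun i j => if i = j then (a + b) / 2 else (a - b) / 2 := by
  have := inv_sqrt_two_mul
  ext i j
  cases i <;> cases j <;> simp [hadamard, Matrix.mul_apply, Matrix.diagonal_apply]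
  · linear_combination (a + b) * this
  · linear_combination (a - b) * this
  · linear_combination (a - b) * this
  · linear_combination (a + b) * this

/-- Conjugation by Hadamard turns `diag (i, -i)` into `i X`, so multiplexed `z` rotations yield
controlled NOTs up to the phase `i`, without the full diagonal gate of an exact Toffoli. -/
lemma hadamard_rz (b : Bool) :
    hadamard * rz (if b then Real.pi / 2 else 0) * hadamard =
      (if b then Complex.I else 1) • xPow b := by
  have : rz (if b then Real.pi / 2 else 0) = Matrix.diagonal fun i =>
      if i then (if b then -Complex.I else 1) else (if b then Complex.I else 1) := by
    rw [rz]
    congr 1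
    funext i
    have e1 := Complex.exp_pi_div_two_mul_I
    have e2 : Complex.exp (-((Real.pi : ℂ) / 2 * Complex.I)) = -Complex.I := by
      rw [Complex.exp_neg, e1, Complex.inv_I]
    cases b <;> cases i <;> simp [sgn, e1, e2]
  rw [this, hadamard_diagonal]
  ext i j
  cases b <;> cases i <;> cases j <;> simp [xPow]

/-- The relative-phase NOT gate with three controls. -/
lemma hasCircuit_relToffoli₃ {c c₁ c₂ t : Q} (h : c ≠ t) (h₁ : c₁ ≠ t) (h₂ : c₂ ≠ t)
    (h₁₂ : c₁ ≠ c₂) :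
    ∃ φ, HasCircuit 6 (mono (mcxFun [c, c₁, c₂] t) φ) ∧ ∀ q ∉ [c, c₁, c₂, t], Indep q φ := by
  have ht : t ∉ [c₁, c₂] := by simp [h₁.symm, h₂.symm]
  -- A NOT controlled by `c₁` and `c₂` up to a phase, with 4 CNOTs; the two toggles below add the
  -- control `c` for 2 more.
  have hc := hasCircuit_muxRz t [c₁, c₂] (by simpa using h₁₂) ht _
    (all_eq_dependsOn [c₁, c₂] fun b => if b then Real.pi / 2 else 0)
  rw [phaseDiag_eq_mux] at hc
  have hc := ((HasCircuit.single t hadamard_mem).mul hc).mul (HasCircuit.single t hadamard_mem)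
  have hall := indep_all ht
  rw [mux_mul_mux (indep_const t _), mux_mul_mux
    (hall.comp fun b => hadamard * rz (if b then Real.pi / 2 else 0))] at hc
  simp only [hadamard_rz] at hc
  have := ((hasCircuit_toggle h).conjTranspose.mul hc).mul (hasCircuit_toggle h)
  rw [toggle_mux h hall (hall.comp fun b => if b then Complex.I else 1)] at this
  refine ⟨fun x => (if [c₁, c₂].all x then Complex.I else 1) *
    relPhase ([c₁, c₂].all x) (x c) (x t), ?_, fun q hq x b => ?_⟩
  swap
  · simp only [List.mem_cons, not_or] at hq
    have h : ∀ r, q ≠ r → Function.update x q b r = x r := fun r hr => by simp [hr.symm]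
    simp [h _ hq.1, h _ hq.2.1, h _ hq.2.2.1, h _ hq.2.2.2.1]
  refine cast ?_ (this.weaken (show _ ≤ 6 by simp [muxCost]))
  congr 2
  funext x
  simp [mcxFun, Bool.and_comm]

/-- The Toffoli gate. -/
lemma hasCircuit_toffoli {c c' t : Q} (h : c ≠ t) (h' : c' ≠ t) (hc : c ≠ c') :
    HasCircuit 6 (mono (mcxFun [c, c'] t) 1) := by
  -- Up to Hadamards on the target, a Toffoli gate is the diagonal sign gate on three qubits, which
  -- costs `2^3 - 2 = 6`.
  have h1 := hasCircuit_phaseDiag t [c, c', t] (by simp [h, h', hc]) _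
    (all_eq_dependsOn [c, c', t] fun b => if b then Real.pi else 0)
  have e : phaseDiag (fun x : Q → Bool => if [c, c', t].all x then Real.pi else 0) =
      mux t fun x => Matrix.diagonal fun i => if i then (if [c, c'].all x then -1 else 1) else 1 := by
    rw [mux_eq_mono (p := fun _ => false), phaseDiag]
    · congr 1
      · funext x; simp
      · funext x
        cases hx : x c <;> cases hx' : x c' <;> cases hxt : x t <;> simp [hx, hx', hxt]
    · intro x b h
      by_contra h'
      apply h
      rw [Matrix.diagonal_apply_ne]
      simpa using h'
  have ht : t ∉ [c, c'] := by simp [h.symm, h'.symm]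
  have h2 := ((HasCircuit.single t hadamard_mem).mul h1).mul (HasCircuit.single t hadamard_mem)
  rw [e, mux_mul_mux (indep_const t _), mux_mul_mux ((indep_all ht).comp fun b => hadamard *
    Matrix.diagonal fun i : Bool => if i then (if b then (-1 : ℂ) else 1) else 1)] at h2
  simp only [hadamard_diagonal] at h2
  rw [mux_eq_mono (p := fun x => [c, c'].all x)] at h2
  · refine cast ?_ (h2.weaken (show _ ≤ 6 by simp))
    congr 2
    funext x
    cases hx : x c <;> cases hx' : x c' <;> cases hxt : x t <;> simp [hx, hx', hxt]
  · intro x b hb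
    by_contra h'
    apply hb
    cases hx : x c <;> cases hx' : x c' <;> cases hxt : x t <;> cases b <;> simp_all

end Toffoli

/-! ### Multi-controlled NOT gates with ancillas -/

section MultiControlled

variable {Q : Type} [Fintype Q] [DecidableEq Q]

/-- `U` maps the basis state `x` to `φ` times the basis state `z`. -/
def MapsBasis (U : Matrix (Q → Bool) (Q → Bool) ℂ) (x : Q → Bool) (φ : ℂ) (z : Q → Bool) : Prop :=
  ∀ y, U y x = if y = z then φ else 0

lemma mapsBasis_mono (S : (Q → Bool) → Q → Bool) (φ : (Q → Bool) → ℂ) (x : Q → Bool) :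
    MapsBasis (mono S φ) x (φ x) (S x) := fun _ => rfl

lemma MapsBasis.mul {U V : Matrix (Q → Bool) (Q → Bool) ℂ} {x z w : Q → Bool} {φ ψ : ℂ}
    (hU : MapsBasis U z ψ w) (hV : MapsBasis V x φ z) : MapsBasis (U * V) x (ψ * φ) w := by
  intro y
  rw [Matrix.mul_apply, Finset.sum_eq_single z]
  · rw [hU, hV, if_pos rfl, ite_mul, zero_mul]
  · intro v _ hv
    rw [hV, if_neg hv, mul_zero]
  · simp

lemma MapsBasis.star_mul_self {U : Matrix (Q → Bool) (Q → Bool) ℂ} {x z : Q → Bool} {φ : ℂ}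
    (hU : Uᴴ * U = 1) (h : MapsBasis U x φ z) : star φ * φ = 1 := by
  have := congrFun (congrFun hU x) x
  rw [Matrix.mul_apply, Finset.sum_eq_single z] at this
  · rw [Matrix.conjTranspose_apply, h, if_pos rfl, Matrix.one_apply_eq] at this
    exact this
  · intro v _ hv
    rw [h, if_neg hv, mul_zero]
  · simp

/-- Column `x` of `U` is concentrated at `z`, so `(Uᴴ U) y x` is `Uᴴ y z * φ`; unitarity makes this
the Kronecker delta, and `φ` has modulus one. -/
lemma MapsBasis.conjTranspose {U : Matrix (Q → Bool) (Q → Bool) ℂ} {x z : Q → Bool} {φ : ℂ}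
    (hU : Uᴴ * U = 1) (h : MapsBasis U x φ z) : MapsBasis Uᴴ z (star φ) x := by
  intro y
  have h1 := h.star_mul_self hU
  have := congrFun (congrFun hU y) x
  rw [Matrix.mul_apply, Finset.sum_eq_single z] at this
  · rw [h, if_pos rfl, Matrix.one_apply] at this
    calc Uᴴ y z = Uᴴ y z * φ * star φ := by rw [mul_assoc, mul_comm φ, h1, mul_one]
      _ = _ := by rw [this]; split_ifs <;> simp
  · intro v _ hv
    rw [h, if_neg hv, mul_zero]
  · simp

lemma eq_mono {U : Matrix (Q → Bool) (Q → Bool) ℂ} {S : (Q → Bool) → Q → Bool}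
    {φ : (Q → Bool) → ℂ} (h : ∀ x, MapsBasis U x (φ x) (S x)) : U = mono S φ := by
  ext y x
  exact h x y

/-- The number of CNOTs of a NOT gate with `k` controls, given about `k / 2` clean ancillas. -/
def cleanCost (k : ℕ) : ℕ := if k = 1 then 1 else 6 * k - 6

lemma hasCircuit_mcx_le_two {l : List Q} {t : Q} (hl : (t :: l).Nodup) (h : l.length ≤ 2) :
    HasCircuit (cleanCost l.length) (mono (mcxFun l t) 1) := by
  match l, h with
  | [], _ =>
    refine cast ?_ (HasCircuit.single t (xPow_mem true))
    congr 1
    rw [mux_eq_mono (p := fun _ => true)]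
    · congr 1
      funext x; simp [xPow]
    · intro x b h
      by_contra h'
      exact h (by simp [xPow]; simpa using h')
  | [c], _ =>
    have hc : c ≠ t := by rintro rfl; simp at hl
    refine cast ?_ (HasCircuit.cnot hc)
    congr 2
    funext x
    simp [mcxFun, cx]
  | [c, c'], _ =>
    simp only [List.nodup_cons, List.mem_cons, not_or] at hl
    exact hasCircuit_toffoli (Ne.symm hl.1.1) (Ne.symm hl.1.2.1) hl.2.1.1

/-- Computing a relative-phase product of controls into a clean ancilla. -/
lemma exists_compute {k k' : ℕ} {l l' anc : List Q} {a t : Q} {φ : (Q → Bool) → ℂ}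
    {U : Matrix (Q → Bool) (Q → Bool) ℂ}
    (hat : a ≠ t) (hal : a ∉ l) (hal' : a ∉ l') (haa : a ∉ anc) (htl : t ∉ l)
    (hR : HasCircuit k (mono (mcxFun l a) φ)) (hφ : Indep t φ)
    (hU : HasCircuit k' U)
    (h : ∀ x, (∀ b ∈ anc, x b = false) → MapsBasis U x 1 (mcxFun (a :: l') t x)) :
    ∃ U, HasCircuit (k + k' + k) U ∧
      ∀ x, (∀ b ∈ a :: anc, x b = false) → MapsBasis U x 1 (mcxFun (l ++ l') t x) := by
  refine ⟨_, (hR.conjTranspose.mul hU).mul hR, fun x hx => ?_⟩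
  have h1 := mapsBasis_mono (mcxFun l a) φ x
  have h2 := h (mcxFun l a x) (fun b hb => by
    have : b ≠ a := fun e => haa (e ▸ hb)
    rw [mcxFun, Function.update_of_ne this]
    exact hx b (List.mem_cons_of_mem _ hb))
  have h3 := mapsBasis_mono (mcxFun l a) φ (mcxFun (l ++ l') t x)
  -- The gate between computing and uncomputing changes only `t`, which the relative phase ignores.
  -- The phase of the first gate is therefore cancelled by that of its adjoint.
  have hφ' : φ (mcxFun (l ++ l') t x) = φ x := hφ _ _
  have hxa : x a = false := hx a (by simp)
  have e : mcxFun l a (mcxFun (l ++ l') t x) = mcxFun (a :: l') t (mcxFun l a x) := by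
    funext r
    by_cases hra : r = a
    · subst hra
      simp [mcxFun, hat, all_update htl]
    · by_cases hrt : r = t
      · subst hrt
        simp only [mcxFun, Function.update_of_ne hra, Function.update_self, List.all_cons,
          all_update hal', List.all_append, hxa, Bool.false_xor]
      · simp [mcxFun, hra, hrt]
  rw [e, hφ'] at h3
  have := ((h3.conjTranspose hR.unitary).mul h2).mul h1
  rwa [mul_one, h1.star_mul_self hR.unitary] at this

/-- NOT gate with `k ≤ 2 p + 2` controls and `p` clean ancillas. -/
lemma exists_mcx_clean (anc : List Q) : ∀ (l : List Q) (t : Q) (_ : (t :: (l ++ anc)).Nodup)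
    (_ : l.length ≤ 2 * anc.length + 2), ∃ U, HasCircuit (cleanCost l.length) U ∧
      ∀ x, (∀ b ∈ anc, x b = false) → MapsBasis U x 1 (mcxFun l t x) := by
  induction anc with
  | nil =>
    intro l t hnd hl
    exact ⟨_, hasCircuit_mcx_le_two (by simpa using hnd) (by simpa using hl),
      fun x _ => mapsBasis_mono _ _ x⟩
  | cons a anc ih =>
    intro l t hnd hl
    match l, hl with
    | [], _ => exact ⟨_, hasCircuit_mcx_le_two (by simp) (by simp),
        fun x _ => mapsBasis_mono _ _ x⟩
    | [c], _ => exact ⟨_, hasCircuit_mcx_le_two (by simp at hnd ⊢; tauto) (by simp),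
        fun x _ => mapsBasis_mono _ _ x⟩
    | [c, c'], _ => exact ⟨_, hasCircuit_mcx_le_two (by simp at hnd ⊢; tauto) (by simp),
        fun x _ => mapsBasis_mono _ _ x⟩
    -- Two relative-phase Toffolis around an exact one: `3 + 6 + 3 = 12`. Merging all three controls
    -- into the ancilla would leave a CNOT and cost `6 + 1 + 6 = 13`.
    | [c₁, c₂, c₃], _ =>
      simp only [List.nodup_cons, List.mem_cons, List.cons_append, not_or, List.nil_append] at hnd
      obtain ⟨⟨ht1, ht2, ht3, hta, htn⟩, ⟨h12, h13, h1a, h1n⟩, ⟨h23, h2a, h2n⟩, ⟨h3a, h3n⟩,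
        han, hn⟩ := hnd
      obtain ⟨U, hU, h⟩ := ih [a, c₃] t (by
        simp only [List.nodup_cons, List.mem_cons, List.cons_append, not_or, List.nil_append]
        tauto) (by simp)
      exact exists_compute (l := [c₁, c₂]) (Ne.symm hta) (by simp [Ne.symm h1a, Ne.symm h2a])
        (by simp [Ne.symm h3a]) han (by simp [ht1, ht2]) (hasCircuit_relToffoli h1a h2a) (by
          intro x b
          simp [Ne.symm ht1, Ne.symm ht2, Ne.symm hta]) hU h
    -- One ancilla replaces three controls, so the number of controls drops by two. Computing and
    -- uncomputing cost `6 + 6`, i.e. 6 per control removed.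
    | c₁ :: c₂ :: c₃ :: c₄ :: l, hl =>
      simp only [List.nodup_cons, List.mem_cons, List.mem_append, List.cons_append, not_or,
        List.nodup_append] at hnd
      obtain ⟨⟨ht1, ht2, ht3, ht4, htl, hta, htn⟩, ⟨h12, h13, h14, h1l, h1a, h1n⟩,
        ⟨h23, h24, h2l, h2a, h2n⟩, ⟨h34, h3l, h3a, h3n⟩, ⟨h4l, h4a, h4n⟩, hl', ⟨han, hn⟩, hla⟩ := hnd
      have hal : a ∉ l := fun h => hla a h a (by simp) rfl
      obtain ⟨U, hU, h⟩ := ih (a :: c₄ :: l) t (by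
        simp only [List.nodup_cons, List.mem_cons, List.mem_append, List.cons_append, not_or,
          List.nodup_append]
        refine ⟨⟨hta, ht4, htl, htn⟩, ⟨Ne.symm h4a, hal, han⟩, ⟨h4l, h4n⟩, hl', hn, ?_⟩
        exact fun q hq r hr => hla q hq r (by simp [hr])) (by simp at hl ⊢; omega)
      obtain ⟨φ, hφ, hR⟩ := hasCircuit_relToffoli₃ (t := a) h1a h2a h3a h23
      have := exists_compute (l := [c₁, c₂, c₃]) (Ne.symm hta)
        (by simp [Ne.symm h1a, Ne.symm h2a, Ne.symm h3a]) (by simp [Ne.symm h4a, hal]) han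
        (by simp [ht1, ht2, ht3]) hφ (hR t (by
          simp [ht1, ht2, ht3, hta])) hU h
      obtain ⟨V, hV, h'⟩ := this
      refine ⟨V, hV.weaken ?_, h'⟩
      simp [cleanCost]
      omega

end MultiControlled

/-! ### Multi-controlled NOT gates with dirty ancillas -/

section Dirty

variable {Q : Type} [Fintype Q] [DecidableEq Q]

/-- Every `d` in a list of pairs `(c, d)` is flipped if `c₀`, `c` and the later controls in the
list are all set. -/
def chainFun (c₀ : Q) : List (Q × Q) → (Q → Bool) → Q → Bool
  | [], x => x
  | (c, d) :: L, x => Function.update (chainFun c₀ L x) d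
      (xor (x d) (x c && (L.map Prod.fst ++ [c₀]).all x))

lemma chainFun_update (c₀ : Q) (L : List (Q × Q)) {q : Q} (hq : q ≠ c₀)
    (hqc : q ∉ L.map Prod.fst) (hqd : q ∉ L.map Prod.snd) (x : Q → Bool) (b : Bool) :
    chainFun c₀ L (Function.update x q b) = Function.update (chainFun c₀ L x) q b := by
  induction L with
  | nil => rfl
  | cons p L ih =>
    obtain ⟨c, d⟩ := p
    simp only [List.map_cons, List.mem_cons, not_or] at hqc hqd
    have hq' : q ∉ L.map Prod.fst ++ [c₀] := by
      rw [List.mem_append, not_or]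
      exact ⟨hqc.2, by simpa using hq⟩
    simp only [chainFun, ih hqc.2 hqd.2, all_update hq', Function.update_of_ne (Ne.symm hqd.1),
      Function.update_of_ne (Ne.symm hqc.1)]
    rw [Function.update_comm (Ne.symm hqd.1)]

lemma chainFun_apply_of_notMem (c₀ : Q) (L : List (Q × Q)) {q : Q} (hqd : q ∉ L.map Prod.snd)
    (x : Q → Bool) : chainFun c₀ L x q = x q := by
  induction L with
  | nil => rfl
  | cons p L ih =>
    obtain ⟨c, d⟩ := p
    simp only [List.map_cons, List.mem_cons, not_or] at hqd
    simp only [chainFun, Function.update_of_ne hqd.1, ih hqd.2]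

lemma chainFun_cons_apply (c₀ c d : Q) (L : List (Q × Q)) (x : Q → Bool) :
    chainFun c₀ ((c, d) :: L) x d = xor (x d) ((((c, d) :: L).map Prod.fst ++ [c₀]).all x) := by
  simp [chainFun]

/-- The chain of relative-phase Toffoli gates that implements `chainFun`. -/
lemma exists_chain (c₀ : Q) (L : List (Q × Q)) : ∀ (c d : Q)
    (_ : (((c, d) :: L).map Prod.snd).Nodup)
    (_ : ∀ q ∈ ((c, d) :: L).map Prod.snd, q ≠ c₀ ∧ q ∉ ((c, d) :: L).map Prod.fst),
    ∃ φ, HasCircuit (4 * L.length + 3) (mono (chainFun c₀ ((c, d) :: L)) φ) ∧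
      ∀ q, q ≠ c₀ → q ∉ ((c, d) :: L).map Prod.fst → q ∉ ((c, d) :: L).map Prod.snd →
        Indep q φ := by
  induction L with
  | nil =>
    intro c d _ h
    have h1 := h d (by simp)
    simp only [List.map_cons, List.map_nil, List.mem_singleton] at h1
    refine ⟨fun x => relPhase (x c₀) (x c) (x d), ?_, fun q hq hqc hqd x b => ?_⟩
    · refine cast ?_ (hasCircuit_relToffoli (Ne.symm h1.2) (Ne.symm h1.1))
      congr 2
    · simp only [List.map_cons, List.map_nil, List.mem_singleton] at hqc hqd
      simp [Ne.symm hq, Ne.symm hqc, Ne.symm hqd]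
  | cons p L ih =>
    obtain ⟨c', d'⟩ := p
    intro c d hnd h
    obtain ⟨φ, hφ, hi⟩ := ih c' d' (by simp at hnd ⊢; tauto) (fun q hq => by
      have := h q (List.mem_cons_of_mem _ hq)
      simp only [List.map_cons, List.mem_cons, not_or] at this ⊢
      tauto)
    obtain ⟨hd0, hdc⟩ := h d (by simp)
    have hdd : d ∉ ((c', d') :: L).map Prod.snd := (List.nodup_cons.1 hnd).1
    rw [List.map_cons, List.mem_cons, not_or] at hdc
    obtain ⟨hdc, hdc'⟩ := hdc
    have hcd : c ≠ d := Ne.symm hdc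
    have hd'd : d' ≠ d := by rintro rfl; simp at hdd
    have hcm : c ∉ ((c', d') :: L).map Prod.snd := fun hm => by
      have := (h c (List.mem_cons_of_mem _ hm)).2
      simp at this
    have hdall : d ∉ ((c', d') :: L).map Prod.fst ++ [c₀] := by
      rw [List.mem_append, not_or]
      exact ⟨hdc', by simpa using hd0⟩
    have hS := fun x b => chainFun_update c₀ ((c', d') :: L) hd0 hdc' hdd x b
    -- The chain flips `d'` by the product of the later controls. The two CNOTs from `d'` to `d`
    -- surround it, so the old value of `d'` drops out and `d` is flipped by that product alone.
    have hcomm : mono (cx d' d) 1 * mono (chainFun c₀ ((c', d') :: L)) φ * mono (cx d' d) 1 =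
        mono (chainFun c₀ ((c', d') :: L)) φ *
          mux d (fun x => (1 : ℂ) • xPow ((((c', d') :: L).map Prod.fst ++ [c₀]).all x)) := by
      rw [cx_eq_mux, mux_mul_mono (hi d hd0 hdc' hdd) hS, Matrix.mul_assoc, mux_mul_mux]
      · congr 2
        funext x
        rw [xPow_mul, one_smul, chainFun_cons_apply]
        congr 1
        cases x d' <;> simp
      · intro x b
        simp only [hS, Function.update_of_ne hd'd]
    -- The shorter chain leaves `c` unchanged and does not involve `d`, so the toggle passes through
    -- it and conjugates only the NOT on `d`, adding the control `c`. A link costs two CNOTs and two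
    -- toggles, hence the factor 4.
    have hq : (mux d fun x => toggle (x c))ᴴ * mono (chainFun c₀ ((c', d') :: L)) φ =
        mono (chainFun c₀ ((c', d') :: L)) φ * (mux d fun x => toggle (x c))ᴴ := by
      rw [mux_conjTranspose ((indep_bit hcd).comp toggle), mux_mul_mono (hi d hd0 hdc' hdd) hS]
      congr 2
      funext x
      rw [chainFun_apply_of_notMem _ _ hcm]
    have hc := ((hasCircuit_toggle hcd).conjTranspose.mul
      (((HasCircuit.cnot hd'd).mul hφ).mul (HasCircuit.cnot hd'd))).mul (hasCircuit_toggle hcd)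
    rw [hcomm, ← Matrix.mul_assoc, hq, Matrix.mul_assoc, Matrix.mul_assoc,
      ← Matrix.mul_assoc _ (mux d _), toggle_mux hcd (indep_all hdall) (indep_const d (1 : ℂ)),
      mono_mul_mono] at hc
    refine ⟨fun x => 1 * relPhase ((((c', d') :: L).map Prod.fst ++ [c₀]).all x) (x c) (x d) *
        φ (Function.update x d (xor (x d) ((((c', d') :: L).map Prod.fst ++ [c₀]).all x && x c))),
      ?_, fun q hq0 hqc hqd x b => ?_⟩
    · refine cast ?_ (hc.weaken (show _ ≤ 4 * ((c', d') :: L).length + 3 by simp; omega))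
      congr 2
      funext x
      simp only [Function.comp, hS]
      rw [chainFun.eq_2 c₀ x c d, Bool.and_comm (x c)]
    · rw [List.map_cons, List.mem_cons, not_or] at hqc hqd
      have hall : q ∉ ((c', d') :: L).map Prod.fst ++ [c₀] := by
        rw [List.mem_append, not_or]
        exact ⟨hqc.2, by simpa using hq0⟩
      simp only [all_update hall, Function.update_of_ne (Ne.symm hqc.1),
        Function.update_of_ne (Ne.symm hqd.1), Function.update_comm hqd.1]
      rw [hi q hq0 hqc.2 hqd.2]

lemma map_snd_zip_sublist (l l' : List Q) : ((l.zip l').map Prod.snd).Sublist l' := by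
  induction l generalizing l' with
  | nil => simp
  | cons a l ih =>
    cases l' with
    | nil => simp
    | cons b l' => exact (ih l').cons_cons b

/-- NOT gate with `k ≤ p + 2` controls and `p` dirty ancillas. -/
lemma hasCircuit_mcx_dirty {l dirt : List Q} {t : Q} (hnd : (t :: (l ++ dirt)).Nodup)
    (h0 : l ≠ []) (hl : l.length ≤ dirt.length + 2) :
    HasCircuit (8 * l.length - 6) (mono (mcxFun l t) 1) := by
  rw [List.nodup_cons, List.nodup_append, List.mem_append, not_or] at hnd
  obtain ⟨⟨htl, htd⟩, hnl, hndirt, hdisj⟩ := hnd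
  by_cases h2 : l.length ≤ 2
  · refine (hasCircuit_mcx_le_two (List.nodup_cons.2 ⟨htl, hnl⟩) h2).weaken ?_
    have := List.length_pos_iff.2 h0
    unfold cleanCost
    split_ifs <;> omega
  obtain ⟨c₁, l, rfl⟩ := List.exists_cons_of_ne_nil h0
  obtain ⟨l, c₀, rfl⟩ : ∃ l' c₀, l = l' ++ [c₀] :=
    ⟨_, _, (List.dropLast_append_getLast (by rintro rfl; simp at h2)).symm⟩
  match l, dirt, h2, hl with
  | [], _, h2, _ => simp at h2
  | c :: l, [], _, hl => simp at hl
  | c :: l, d :: dirt, _, hl =>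
    have hlen : l.length ≤ dirt.length := by simp at hl; omega
    have hfst : ((c, d) :: l.zip dirt).map Prod.fst = c :: l := by
      simp [List.map_fst_zip hlen]
    have hsnd : ∀ q ∈ ((c, d) :: l.zip dirt).map Prod.snd, q ∈ d :: dirt := by
      intro q hq
      simp only [List.map_cons, List.mem_cons, List.mem_map, Prod.exists, exists_eq_right] at hq ⊢
      exact hq.imp_right fun ⟨a, h⟩ => (List.of_mem_zip h).2
    obtain ⟨φ, hφ, hi⟩ := exists_chain c₀ (l.zip dirt) c d (by
        rw [List.map_cons]
        exact hndirt.sublist ((map_snd_zip_sublist _ _).cons_cons d)) (fun q hq => by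
        have h1 := hsnd q hq
        rw [hfst]
        refine ⟨fun e => ?_, fun hm => ?_⟩
        · exact hdisj q (by simp [e]) q h1 rfl
        · exact hdisj q (by simp at hm ⊢; tauto) q h1 rfl)
    have hd1 : d ≠ c₁ := fun e => hdisj c₁ (by simp) d (by simp) e.symm
    have hdt : d ≠ t := by rintro rfl; simp at htd
    have hct : c₁ ≠ t := by rintro rfl; simp at htl
    -- The controls are `c₁`, those of the chain and `c₀`. Two Toffolis from `c₁` and `d` act before
    -- and after the chain is undone, between which `d` differs by the product of all controls but
    -- `c₁`; the net effect on `t` is the full product. For `k` controls the count is `2 · 6 + 2 (4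
    -- (k - 3) + 3) = 8 k - 6`.
    have hT := hasCircuit_toffoli hct hdt (Ne.symm hd1)
    have := ((hT.mul hφ.conjTranspose).mul hT).mul hφ
    have htS : t ∉ ((c, d) :: l.zip dirt).map Prod.snd := fun h => htd (hsnd t h)
    have htc : t ≠ c₀ := by rintro rfl; simp at htl
    have htf : t ∉ ((c, d) :: l.zip dirt).map Prod.fst := by
      rw [hfst]; simp at htl ⊢; tauto
    have hc1 : c₁ ∉ ((c, d) :: l.zip dirt).map Prod.snd := fun h =>
      hdisj c₁ (by simp) c₁ (hsnd _ h) rfl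
    have hmaps : ∀ x, MapsBasis (mono (mcxFun [c₁, d] t) 1 *
        (mono (chainFun c₀ ((c, d) :: l.zip dirt)) φ)ᴴ * mono (mcxFun [c₁, d] t) 1 *
        mono (chainFun c₀ ((c, d) :: l.zip dirt)) φ) x 1 (mcxFun (c₁ :: c :: (l ++ [c₀])) t x) := by
      intro x
      set S := chainFun c₀ ((c, d) :: l.zip dirt) with hS
      have m1 := mapsBasis_mono S φ x
      have m2 := mapsBasis_mono (mcxFun [c₁, d] t) 1 (S x)
      set b := xor (x t) ([c₁, d].all (S x)) with hb
      -- The chain and its phase ignore `t`. Although `t` may have been flipped, the adjoint chain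
      -- still cancels the phase `φ x` and restores the dirty bits.
      have m3 := mapsBasis_mono S φ (Function.update x t b)
      rw [hS, chainFun_update _ _ htc htf htS, ← hS, hi t htc htf htS] at m3
      have e : mcxFun [c₁, d] t (S x) = Function.update (S x) t b := by
        rw [mcxFun, hb]
        congr 2
        rw [hS, chainFun_apply_of_notMem _ _ htS]
      rw [e] at m2
      have m4 := mapsBasis_mono (mcxFun [c₁, d] t) 1 (Function.update x t b)
      have m := ((m4.mul (m3.conjTranspose hφ.unitary)).mul m2).mul m1
      have e2 : mcxFun [c₁, d] t (Function.update x t b) = mcxFun (c₁ :: c :: (l ++ [c₀])) t x := by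
        have h1 : S x c₁ = x c₁ := chainFun_apply_of_notMem _ _ hc1 x
        have h2 : S x d = xor (x d) ((c :: l ++ [c₀]).all x) := by
          rw [hS, chainFun_cons_apply, hfst]
        rw [mcxFun, all_update (by simp [hct.symm, hdt.symm]), Function.update_self,
          Function.update_idem, mcxFun, hb]
        congr 1
        rw [List.all_cons, List.all_cons, List.all_nil, h1, h2, List.all_cons, List.all_cons,
          List.all_nil, List.all_cons, List.cons_append, List.all_cons]
        cases x t <;> cases x c₁ <;> cases x d <;> simp
      rw [e2] at m
      convert m using 1
      simp only [Pi.one_apply, one_mul, mul_one]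
      exact (m1.star_mul_self hφ.unitary).symm
    rw [eq_mono hmaps] at this
    refine this.weaken ?_
    simp [hlen]
    omega

/-- NOT gate with one dirty ancilla `d`. -/
lemma hasCircuit_mcx_one_dirty {l : List Q} {t d : Q} (hnd : (t :: d :: l).Nodup) :
    HasCircuit (16 * l.length) (mono (mcxFun l t) 1) := by
  by_cases h0 : l = []
  · subst h0
    exact hasCircuit_mcx_le_two (l := []) (by simp) (by simp)
  have hpos := List.length_pos_iff.2 h0
  obtain ⟨l₁, l₂, rfl, h1, h2⟩ : ∃ l₁ l₂, l = l₁ ++ l₂ ∧ l₂.length ≤ l₁.length ∧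
      l₁.length ≤ l₂.length + 1 := by
    refine ⟨l.take ((l.length + 1) / 2), l.drop ((l.length + 1) / 2),
      (List.take_append_drop _ _).symm, ?_, ?_⟩ <;> simp <;> omega
  simp only [List.nodup_cons, List.mem_cons, not_or, List.mem_append, List.nodup_append] at hnd
  obtain ⟨⟨htd, ht1, ht2⟩, ⟨hd1, hd2⟩, hn1, hn2, hdisj⟩ := hnd
  have hl1 : 0 < l₁.length := by simp at hpos; omega
  -- Let `A` flip `d` by the product over `l₁` and `B` flip `t` by the product over `d :: l₂`. Each
  -- gate borrows qubits that it does not use as dirty ancillas, which suffice because the two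
  -- halves are balanced.
  have hA := hasCircuit_mcx_dirty (l := l₁) (dirt := t :: l₂) (t := d) (by
      simp only [List.nodup_cons, List.mem_cons, not_or, List.mem_append, List.nodup_append]
      refine ⟨⟨hd1, Ne.symm htd, hd2⟩, hn1, ⟨ht2, hn2⟩, ?_⟩
      rintro a ha b (rfl | hb)
      · rintro rfl; exact ht1 ha
      · exact hdisj a ha b hb) (List.length_pos_iff.1 hl1) (by simp; omega)
  have hB := hasCircuit_mcx_dirty (l := d :: l₂) (dirt := l₁) (t := t) (by
      simp only [List.nodup_cons, List.mem_cons, not_or, List.mem_append, List.cons_append,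
        List.nodup_append]
      refine ⟨⟨htd, ht2, ht1⟩, ⟨hd2, hd1⟩, hn2, hn1, ?_⟩
      exact fun a ha b hb e => hdisj b hb a ha e.symm) (by simp) (by simp; omega)
  -- In `B A B A` the bit `d` is restored, and `t` is flipped by `(d ⊕ ∏ l₁) ∏ l₂ ⊕ d ∏ l₂`, which
  -- is the product of all controls.
  have := (hB.mul hA).mul (hB.mul hA)
  rw [mono_mul_mono, mono_mul_mono] at this
  refine cast ?_ (this.weaken (show _ ≤ 16 * (l₁ ++ l₂).length by simp; omega))
  congr 2
  · funext x
    funext r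
    simp only [Function.comp]
    by_cases hr : r = t
    · subst hr
      simp only [mcxFun, Function.update_self, List.all_cons, List.all_append,
        Function.update_of_ne htd, Function.update_of_ne (Ne.symm htd), all_update ht1,
        all_update ht2, all_update hd1, all_update hd2]
      cases x r <;> cases x d <;> cases l₁.all x <;> cases l₂.all x <;> rfl
    · by_cases hrd : r = d
      · subst hrd
        simp only [mcxFun, Function.update_self, Function.update_of_ne hr, all_update ht1,
          all_update hd1]
        simp
      · simp [mcxFun, hr, hrd]
  · funext x
    simp

end Dirty

/-! ### Circuits with clean and dirty ancillas -/

section Register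

variable {n a b : ℕ}

lemma regState_inj {y y' : Fin n → Bool} {e e' : Fin a → Bool} {f f' : Fin b → Bool} :
    regState y e f = regState y' e' f' ↔ y = y' ∧ e = e' ∧ f = f' := by
  simp [regState, Sum.elim_eq_iff]

lemma exists_regState (z : Fin n ⊕ Fin a ⊕ Fin b → Bool) :
    ∃ y e f, z = regState y e f :=
  ⟨fun q => z (.inl q), fun q => z (.inr (.inl q)), fun q => z (.inr (.inr q)), by
    funext q; rcases q with q | q | q <;> rfl⟩

/-- The embedding of data states into the states of all qubits: the clean ancillas are in the
state `0` and the dirty ancillas in the state `f`. -/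
def regEmb (a : ℕ) {ι : Type} (g : ι → Fin n → Bool) (f : Fin b → Bool) :
    Matrix (Fin n ⊕ Fin a ⊕ Fin b → Bool) ι ℂ :=
  Matrix.of fun z x => if z = regState (g x) (fun _ => false) f then 1 else 0

lemma mul_regEmb_apply {ι κ : Type} (U : Matrix κ (Fin n ⊕ Fin a ⊕ Fin b → Bool) ℂ)
    (g : ι → Fin n → Bool) (f : Fin b → Bool) (z : κ) (x : ι) :
    (U * regEmb a g f) z x = U z (regState (g x) (fun _ => false) f) := by
  simp [Matrix.mul_apply, regEmb]

lemma regEmb_mul_apply {ι κ : Type} [Fintype ι] {g : ι → Fin n → Bool}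
    (hg : Function.Injective g) (V : Matrix ι κ ℂ) (i : ι) (e : Fin a → Bool) (f f' : Fin b → Bool)
    (x : κ) :
    (regEmb a g f' * V) (regState (g i) e f) x =
      if e = (fun _ => false) ∧ f = f' then V i x else 0 := by
  rw [Matrix.mul_apply, Finset.sum_eq_single i]
  · simp [regEmb, regState_inj]
  · intro j _ hj
    simp [regEmb, regState_inj, hg.ne hj.symm]
  · simp

/-- The embedding of the states of the data qubits. -/
abbrev dataEmb (n a : ℕ) (f : Fin b → Bool) :
    Matrix (Fin n ⊕ Fin a ⊕ Fin b → Bool) (Fin n → Bool) ℂ :=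
  regEmb a id f

/-- `U` acts as `V` on the data qubits and leaves the ancillas unchanged. -/
def ActsAs (U : Matrix (Fin n ⊕ Fin a ⊕ Fin b → Bool) (Fin n ⊕ Fin a ⊕ Fin b → Bool) ℂ)
    (V : Matrix (Fin n → Bool) (Fin n → Bool) ℂ) : Prop :=
  ∀ f : Fin b → Bool, U * dataEmb n a f = dataEmb n a f * V

/-- There is a circuit with at most `k` CNOTs that acts as `V` on the data qubits. -/
def Realizes (a b k : ℕ) (V : Matrix (Fin n → Bool) (Fin n → Bool) ℂ) : Prop :=
  ∃ C : Circuit n a b, cnotCount C ≤ k ∧ ActsAs (circuitMatrix C) V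

lemma ActsAs.mul {U U' : Matrix (Fin n ⊕ Fin a ⊕ Fin b → Bool) (Fin n ⊕ Fin a ⊕ Fin b → Bool) ℂ}
    {V V' : Matrix (Fin n → Bool) (Fin n → Bool) ℂ} (h : ActsAs U V) (h' : ActsAs U' V') :
    ActsAs (U * U') (V * V') := by
  intro f
  rw [Matrix.mul_assoc, h' f, ← Matrix.mul_assoc, h f, Matrix.mul_assoc]

lemma ext_regState {ι : Type} {A B : Matrix (Fin n ⊕ Fin a ⊕ Fin b → Bool) ι ℂ}
    (h : ∀ y e f x, A (regState y e f) x = B (regState y e f) x) : A = B := by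
  ext z x
  obtain ⟨y, e, f, rfl⟩ := exists_regState z
  exact h y e f x

namespace Realizes

variable {k l : ℕ} {U V : Matrix (Fin n → Bool) (Fin n → Bool) ℂ}

lemma weaken (h : Realizes a b k U) (hkl : k ≤ l) : Realizes a b l U := by
  obtain ⟨C, hC, h⟩ := h
  exact ⟨C, hC.trans hkl, h⟩

lemma mul (hU : Realizes a b k U) (hV : Realizes a b l V) : Realizes a b (k + l) (U * V) := by
  obtain ⟨C, hC, h⟩ := hU
  obtain ⟨C', hC', h'⟩ := hV
  refine ⟨C' ++ C, by rw [cnotCount_append]; omega, ?_⟩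
  rw [circuitMatrix_append]
  exact h.mul h'

end Realizes

/-- A gate on the data qubits as a gate on all qubits. -/
def Gate.lift : Gate (Fin n) → Gate (Fin n ⊕ Fin a ⊕ Fin b)
  | .single q U => .single (.inl q) U
  | .cnot c t h => .cnot (.inl c) (.inl t) (fun e => h (Sum.inl_injective e))

lemma regState_update (x : Fin n → Bool) (e : Fin a → Bool) (f : Fin b → Bool) (t : Fin n)
    (v : Bool) : Function.update (regState x e f) (.inl t) v =
      regState (Function.update x t v) e f := by
  funext r
  rcases r with r | r
  · by_cases hr : r = t
    · subst hr; simp [regState]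
    · rw [Function.update_of_ne (by simpa using hr)]
      simp [regState, hr]
  · rfl

lemma Gate.lift_toMatrix (g : Gate (Fin n)) :
    ActsAs (g.lift (a := a) (b := b)).toMatrix g.toMatrix := by
  intro f
  apply ext_regState
  intro y e f' x
  rw [mul_regEmb_apply]
  refine Eq.trans ?_ (regEmb_mul_apply Function.injective_id _ y e f' f x).symm
  cases g with
  | single q U =>
    simp only [Gate.lift, single_toMatrix, mux, Matrix.of_apply, agree_iff, regState_update]
    simp only [regState_inj, id]
    by_cases h : e = (fun _ => false) ∧ f' = f
    · rw [if_pos h]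
      refine if_congr ?_ rfl rfl
      exact and_iff_left h
    · rw [if_neg h, if_neg fun h' => h h'.2]
  | cnot c t h =>
    simp only [Gate.lift, cnot_toMatrix, mono, Matrix.of_apply, cx, regState_update]
    simp only [regState_inj, id]
    by_cases h : e = (fun _ => false) ∧ f' = f
    · rw [if_pos h]
      refine if_congr ?_ rfl rfl
      exact and_iff_left h
    · rw [if_neg h, if_neg fun h' => h h'.2]

lemma HasCircuit.realizes {k : ℕ} {U : Matrix (Fin n → Bool) (Fin n → Bool) ℂ}
    (hU : HasCircuit k U) : Realizes a b k U := by
  obtain ⟨C, hC, rfl⟩ := hU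
  refine ⟨C.map Gate.lift, le_of_eq_of_le ?_ hC, ?_⟩
  · simp only [cnotCount, List.map_map]
    congr 1
    apply List.map_congr_left
    intro g _
    cases g <;> rfl
  · clear hC
    induction C with
    | nil => intro f; simp [circuitMatrix]
    | cons g C ih => exact ih.mul g.lift_toMatrix

/-- All qubits but `t`. -/
def others (t : Fin n) : List (Fin n) := (Finset.univ.erase t).toList

lemma mem_others {t q : Fin n} : q ∈ others t ↔ q ≠ t := by simp [others]

lemma length_others (t : Fin n) : (others t).length = n - 1 := by simp [others]

lemma permGate_eq_mono (π : Equiv.Perm (Fin n → Bool)) : permGate π = mono π 1 := by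
  ext y x; simp [permGate, mono]

/-- The transposition of the all-ones string and its neighbour in direction `t`. -/
def onesSwap (t : Fin n) : Equiv.Perm (Fin n → Bool) :=
  Equiv.swap (Function.update (fun _ => true) t false) (fun _ => true)

/-- The controls are all set in exactly two strings, which differ in bit `t`. -/
lemma mcxFun_others (t : Fin n) (x : Fin n → Bool) : mcxFun (others t) t x = onesSwap t x := by
  have hall : (others t).all x = true ↔ ∀ q, q ≠ t → x q = true := by
    simp [List.all_eq_true, mem_others]
  rw [mcxFun, onesSwap, Equiv.swap_apply_def]
  split_ifs with h1 h2
  · have : (others t).all x = true := hall.2 fun q hq => by rw [h1]; simp [hq]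
    rw [this, h1]
    simp
  · have : (others t).all x = true := hall.2 fun q hq => by rw [h2]
    rw [this, h2]
    simp
  · have : (others t).all x = false := by
      by_contra h
      rw [Bool.not_eq_false, hall] at h
      cases hx : x t
      · apply h1
        funext q
        by_cases hq : q = t
        · subst hq; simp [hx]
        · simp [hq, h q hq]
      · apply h2
        funext q
        by_cases hq : q = t
        · subst hq; simp [hx]
        · simp [h q hq]
    rw [this]
    simp

/-- `Realizes` constrains only inputs whose clean ancillas are `0`, with arbitrary dirty ones; on
these the NOT gate changes data bits only. -/
lemma realizes_of_mapsBasis {k : ℕ} {U : Matrix (Fin n ⊕ Fin a ⊕ Fin b → Bool) _ ℂ} {t : Fin n}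
    (hU : HasCircuit k U)
    (h : ∀ x, (∀ q, x (.inr (.inl q)) = false) →
      MapsBasis U x 1 (mcxFun ((others t).map .inl) (.inl t) x)) :
    Realizes a b k (permGate (onesSwap t)) := by
  obtain ⟨C, hC, rfl⟩ := hU
  refine ⟨C, hC, fun f => ?_⟩
  apply ext_regState
  intro y e f' x
  rw [mul_regEmb_apply]
  refine Eq.trans ?_ (regEmb_mul_apply Function.injective_id _ y e f' f x).symm
  rw [h _ (fun q => rfl)]
  have : mcxFun ((others t).map .inl) (.inl t) (regState (id x) (fun _ : Fin a => false) f) =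
      regState (onesSwap t x) (fun _ => false) f := by
    rw [← mcxFun_others, mcxFun, mcxFun, regState_update]
    congr 2
    simp [regState, List.all_map, Function.comp_def]
  rw [this]
  simp only [regState_inj, permGate, Matrix.of_apply]
  by_cases h : e = (fun _ => false) ∧ f' = f
  · rw [if_pos h]
    refine if_congr ?_ rfl rfl
    exact and_iff_left h
  · rw [if_neg h, if_neg fun h' => h h'.2]

lemma nodup_others (t : Fin n) : (t :: others t).Nodup :=
  List.nodup_cons.2 ⟨by simp [mem_others], Finset.nodup_toList _⟩

/-- The `n - 1` controls are admissible for `a` clean ancillas if `n - 1 ≤ 2 a + 2`. -/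
lemma realizes_onesSwap_clean (t : Fin n) (h : n ≤ 2 * a + 3) :
    Realizes a b (cleanCost (n - 1)) (permGate (onesSwap t)) := by
  have hnd : ((.inl t : Fin n ⊕ Fin a ⊕ Fin b) :: ((others t).map .inl ++
      (List.finRange a).map fun q => .inr (.inl q))).Nodup := by
    rw [← List.cons_append, ← List.map_cons, List.nodup_append]
    refine ⟨(nodup_others t).map Sum.inl_injective, (List.nodup_finRange a).map ?_, ?_⟩
    · exact Sum.inr_injective.comp Sum.inl_injective
    · simp
  obtain ⟨U, hU, h'⟩ := exists_mcx_clean _ _ _ hnd (by simp [length_others]; omega)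
  rw [List.length_map, length_others] at hU
  exact realizes_of_mapsBasis hU fun x hx => h' x (by simpa using hx)

lemma realizes_onesSwap_dirty (t : Fin n) :
    Realizes a 1 (16 * (n - 1)) (permGate (onesSwap t)) := by
  have hnd : ((.inl t : Fin n ⊕ Fin a ⊕ Fin 1) :: .inr (.inr 0) :: (others t).map .inl).Nodup := by
    rw [(List.Perm.swap _ _ _).nodup_iff, ← List.map_cons, List.nodup_cons]
    exact ⟨by simp, (nodup_others t).map Sum.inl_injective⟩
  have := hasCircuit_mcx_one_dirty hnd
  rw [List.length_map, length_others] at this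
  exact realizes_of_mapsBasis this fun x _ => mapsBasis_mono _ _ x

end Register

/-! ### Permutation gates -/

section PermGate

variable {ι : Type} [Fintype ι] [DecidableEq ι]

lemma permGate_one : permGate (1 : Equiv.Perm ι) = 1 := by
  ext y x
  simp only [permGate, Matrix.one_apply, Matrix.of_apply, Equiv.Perm.one_apply]
  rfl

lemma mul_permGate_apply {κ : Type} (A : Matrix κ ι ℂ) (π : Equiv.Perm ι) (y : κ) (x : ι) :
    (A * permGate π) y x = A y (π x) := by
  simp [Matrix.mul_apply, permGate]

lemma permGate_mul (π σ : Equiv.Perm ι) : permGate (π * σ) = permGate π * permGate σ := by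
  ext y x
  rw [mul_permGate_apply]
  rfl

lemma permGate_conjTranspose (π : Equiv.Perm ι) : (permGate π)ᴴ = permGate π⁻¹ := by
  ext y x
  have h : x = π y ↔ y = π⁻¹ x := by rw [Equiv.Perm.eq_inv_iff_eq, eq_comm]
  simp only [permGate, Matrix.conjTranspose_apply, Matrix.of_apply, h]
  split_ifs <;> simp

end PermGate

/-! ### Permutations of basis states built from exchanges of neighbours -/

section Permutations

variable {n : ℕ}

/-- Flipping the bits in a mask. -/
def xorMask (m : Fin n → Bool) : Equiv.Perm (Fin n → Bool) :=
  Function.Involutive.toPerm (fun x q => xor (x q) (m q)) fun x => by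
    funext q; simp

lemma xorMask_apply (m x : Fin n → Bool) (q : Fin n) : xorMask m x q = xor (x q) (m q) := rfl

lemma xorMask_mul_self (m : Fin n → Bool) : xorMask m * xorMask m = 1 := by
  ext x q
  simp [xorMask_apply]

lemma hasCircuit_xorMask (m : Fin n → Bool) : HasCircuit 0 (permGate (xorMask m)) := by
  have key : ∀ S : Finset (Fin n), HasCircuit 0 (permGate (xorMask fun q => decide (q ∈ S))) := by
    intro S
    induction S using Finset.induction_on with
    | empty =>
      have : xorMask (fun q => decide (q ∈ (∅ : Finset (Fin n)))) = 1 := by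
        ext x q; simp [xorMask_apply]
      rw [this, permGate_one]
      exact HasCircuit.one
    | insert t S ht ih =>
      have h := (HasCircuit.single t (xPow_mem true)).mul ih
      rw [mux_eq_mono (p := fun _ => true), permGate_eq_mono, mono_mul_mono] at h
      · rw [permGate_eq_mono]
        refine cast ?_ h
        congr 2
        · funext x q
          by_cases hq : q = t
          · subst hq; simp [xorMask_apply, ht]
          · simp [xorMask_apply, hq]
        · funext x; simp [xPow]
      · intro x b h
        by_contra h'
        exact h (by simp [xPow]; simpa using h')
  have := key (Finset.univ.filter fun q => m q = true)
  simpa using this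

/-- Flipping the bits in `T` if bit `q` is set. -/
def fanout (q : Fin n) (T : Finset (Fin n)) (hq : q ∉ T) : Equiv.Perm (Fin n → Bool) :=
  Function.Involutive.toPerm (fun x r => xor (x r) (x q && decide (r ∈ T))) fun x => by
    funext r; simp [hq]

lemma fanout_apply (q : Fin n) (T : Finset (Fin n)) (hq : q ∉ T) (x : Fin n → Bool) (r : Fin n) :
    fanout q T hq x r = xor (x r) (x q && decide (r ∈ T)) := rfl

lemma fanout_mul_self (q : Fin n) (T : Finset (Fin n)) (hq : q ∉ T) :
    fanout q T hq * fanout q T hq = 1 := by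
  ext x r
  simp [fanout_apply, hq]

lemma hasCircuit_fanout (q : Fin n) (T : Finset (Fin n)) : ∀ hq : q ∉ T,
    HasCircuit T.card (permGate (fanout q T hq)) := by
  induction T using Finset.induction_on with
  | empty =>
    intro hq
    have : fanout q ∅ hq = 1 := by ext x r; simp [fanout_apply]
    rw [this, permGate_one]
    exact HasCircuit.one
  | insert t T ht ih =>
    intro hq
    rw [Finset.mem_insert, not_or] at hq
    have h := (HasCircuit.cnot hq.1).mul (ih hq.2)
    rw [permGate_eq_mono, mono_mul_mono] at h
    rw [Finset.card_insert_of_notMem ht, Nat.add_comm, permGate_eq_mono]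
    refine cast ?_ h
    congr 2
    · funext x r
      by_cases hr : r = t
      · subst hr; simp [cx, fanout_apply, ht, hq.2]
      · simp [cx, fanout_apply, hr]
    · funext x; simp

/-- The neighbour of `y` in direction `q`. -/
def flipBit (y : Fin n → Bool) (q : Fin n) : Fin n → Bool := Function.update y q (!y q)

variable {a b τ : ℕ}

/-- Conjugation with `X` gates, which are free, carries the pair at the all-ones string to any other
pair of neighbours in the same direction. -/
lemma realizes_swap_flipBit (h : ∀ t : Fin n, Realizes a b τ (permGate (onesSwap t)))
    (y : Fin n → Bool) (q : Fin n) : Realizes a b τ (permGate (Equiv.swap y (flipBit y q))) := by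
  have e : Equiv.swap y (flipBit y q) =
      xorMask (fun r => !y r) * onesSwap q * xorMask (fun r => !y r) := by
    have h1 : xorMask (fun r => !y r) (fun _ => true) = y := by
      funext r; simp [xorMask_apply]
    have h2 : xorMask (fun r => !y r) (Function.update (fun _ => true) q false) = flipBit y q := by
      funext r
      by_cases hr : r = q
      · subst hr; simp [xorMask_apply, flipBit]
      · simp [xorMask_apply, flipBit, hr]
    rw [onesSwap, Equiv.mul_swap_eq_swap_mul, h1, h2, mul_assoc, Equiv.swap_comm,
      xorMask_mul_self, mul_one]
  have hx := (hasCircuit_xorMask fun r => !y r).realizes (a := a) (b := b)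
  have := (hx.mul (h q)).mul hx
  rw [← permGate_mul, ← permGate_mul, ← e] at this
  exact this.weaken (by omega)

/-- The bits other than `q` in which `x` and `y` differ. -/
def diffBits (q : Fin n) (x y : Fin n → Bool) : Finset (Fin n) :=
  Finset.univ.filter fun r => r ≠ q ∧ x r ≠ y r

lemma notMem_diffBits (q : Fin n) (x y : Fin n → Bool) : q ∉ diffBits q x y := by simp [diffBits]

lemma card_diffBits_le (q : Fin n) (x y : Fin n → Bool) : (diffBits q x y).card ≤ n - 1 := by
  calc (diffBits q x y).card ≤ (Finset.univ.erase q).card :=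
        Finset.card_le_card fun r hr => by simp [diffBits] at hr; simp [hr.1]
    _ = n - 1 := by simp

lemma fanout_diffBits (q : Fin n) {x y : Fin n → Bool} (hx : x q = true) (hy : y q = false) :
    fanout q (diffBits q x y) (notMem_diffBits q x y) x = flipBit y q := by
  funext r
  by_cases hr : r = q
  · subst hr; simp [fanout_apply, flipBit, hx, hy, diffBits]
  · rw [fanout_apply, flipBit, Function.update_of_ne hr, hx]
    cases h1 : x r <;> cases h2 : y r <;> simp [diffBits, hr, h1, h2]

lemma fanout_eq_self {q : Fin n} {T : Finset (Fin n)} (hq : q ∉ T) {x : Fin n → Bool}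
    (hx : x q = false) : fanout q T hq x = x := by
  funext r; simp [fanout_apply, hx]

/-- Any transposition of two computational basis states. -/
lemma realizes_swap (h : ∀ t : Fin n, Realizes a b τ (permGate (onesSwap t)))
    (x y : Fin n → Bool) : Realizes a b (2 * (n - 1) + τ) (permGate (Equiv.swap x y)) := by
  by_cases hxy : x = y
  · rw [hxy, Equiv.swap_self]
    have := (HasCircuit.one (Q := Fin n)).realizes (a := a) (b := b)
    rw [← permGate_one] at this
    exact this.weaken (by omega)
  obtain ⟨q, hq⟩ := Function.ne_iff.1 hxy
  wlog hx : x q = true generalizing x y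
  · rw [Equiv.swap_comm]
    refine this y x (Ne.symm hxy) (Ne.symm hq) ?_
    cases h1 : x q <;> cases h2 : y q <;> simp_all
  have hy : y q = false := by simpa [hx] using hq
  set F := fanout q (diffBits q x y) (notMem_diffBits q x y) with hF
  have hFF : F * F = 1 := fanout_mul_self q _ _
  -- The fan-out from `q` fixes `y`, where bit `q` is clear, and sends `x` to the neighbour of `y`
  -- in direction `q`. Conjugation with it costs at most `2 (n - 1)`.
  have e : Equiv.swap x y = F * Equiv.swap y (flipBit y q) * F := by
    have h1 : F (flipBit y q) = x := by
      rw [← fanout_diffBits q hx hy, ← hF, ← Equiv.Perm.mul_apply, hFF, Equiv.Perm.one_apply]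
    have h2 : F y = y := fanout_eq_self _ hy
    rw [Equiv.mul_swap_eq_swap_mul, h1, h2, mul_assoc, hFF, mul_one, Equiv.swap_comm]
  have hc := ((hasCircuit_fanout q _ (notMem_diffBits q x y)).weaken
    (card_diffBits_le q x y)).realizes (a := a) (b := b)
  have := (hc.mul (realizes_swap_flipBit h y q)).mul hc
  rw [← hF, ← permGate_mul, ← permGate_mul, ← e] at this
  exact this.weaken (by omega)

/-- The strings whose bits from `s` on are `0`. -/
def lowBlock (n s : ℕ) : Finset (Fin n → Bool) :=
  Finset.univ.filter fun x => ∀ q : Fin n, s ≤ q → x q = false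

lemma mem_lowBlock {s : ℕ} {x : Fin n → Bool} :
    x ∈ lowBlock n s ↔ ∀ q : Fin n, s ≤ q → x q = false := by simp [lowBlock]

lemma le_card_lowBlock {s : ℕ} (hs : s ≤ n) : 2 ^ s ≤ (lowBlock n s).card := by
  have : (Finset.univ : Finset (Fin s → Bool)).card = 2 ^ s := by simp
  rw [← this]
  refine Finset.card_le_card_of_injOn
    (fun w q => if h : (q : ℕ) < s then w ⟨q, h⟩ else false) ?_ ?_
  · intro w _
    simp only [Finset.mem_coe, mem_lowBlock]
    intro q hq
    simp [Nat.not_lt.2 hq]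
  · intro w _ w' _ h
    funext i
    have := congrFun h ⟨i, i.2.trans_le hs⟩
    simpa using this

/-- Each step moves one string `x` of `A` from outside the lower block to a free place `y` inside.
Some bit `q ≥ s` of `x` is set, while it is clear throughout the block. A fan-out from `q` hence
brings `x` next to `y` without disturbing strings already placed and need not be undone. Other
strings of `A` may move, but the number outside the block drops. -/
lemma exists_pivot (h : ∀ t : Fin n, Realizes a b τ (permGate (onesSwap t))) {s : ℕ} (hs : s ≤ n)
    (k : ℕ) : ∀ (A : Finset (Fin n → Bool)) (_ : A.card ≤ 2 ^ s)
      (_ : (A \ lowBlock n s).card ≤ k),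
      ∃ π : Equiv.Perm (Fin n → Bool), Realizes a b (k * (n - 1 + τ)) (permGate π) ∧
        ∀ x ∈ A, π x ∈ lowBlock n s := by
  induction k with
  | zero =>
    intro A _ hk
    refine ⟨1, ?_, fun x hx => ?_⟩
    · rw [permGate_one, Nat.zero_mul]
      exact HasCircuit.one.realizes
    · by_contra hxB
      have : x ∈ A \ lowBlock n s := Finset.mem_sdiff.2 ⟨hx, hxB⟩
      rw [Finset.card_eq_zero.1 (Nat.le_zero.1 hk)] at this
      simp at this
  | succ k ih =>
    intro A hA hk
    by_cases hAB : (A \ lowBlock n s).Nonempty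
    swap
    · obtain ⟨π, hπ, h'⟩ := ih A hA (by rw [Finset.not_nonempty_iff_eq_empty.1 hAB]; simp)
      exact ⟨π, hπ.weaken (Nat.mul_le_mul_right _ (Nat.le_succ k)), h'⟩
    obtain ⟨x, hx⟩ := hAB
    have hx' := Finset.mem_sdiff.1 hx
    -- The block has at least `2^s ≥ |A|` strings, and `A` contains `x` outside it, so `A` cannot
    -- fill the block.
    obtain ⟨y, hyB, hyA⟩ : ∃ y ∈ lowBlock n s, y ∉ A := by
      by_contra! hsub
      have h1 : lowBlock n s = A :=
        Finset.eq_of_subset_of_card_le hsub (hA.trans (le_card_lowBlock hs))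
      exact hx'.2 (h1 ▸ hx'.1)
    obtain ⟨q, hsq, hxq⟩ : ∃ q : Fin n, s ≤ q ∧ x q = true := by
      by_contra! hcon
      exact hx'.2 (mem_lowBlock.2 fun q hq => by simpa using hcon q hq)
    have hyq : y q = false := mem_lowBlock.1 hyB q hsq
    set F := fanout q (diffBits q x y) (notMem_diffBits q x y) with hF
    set π := Equiv.swap y (flipBit y q) * F with hπ
    have hπx : π x = y := by
      rw [hπ, Equiv.Perm.mul_apply, hF, fanout_diffBits q hxq hyq, Equiv.swap_apply_right]
    have hπz : ∀ z ∈ A, z ∈ lowBlock n s → π z = z := by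
      intro z hzA hzB
      have hzq := mem_lowBlock.1 hzB q hsq
      rw [hπ, Equiv.Perm.mul_apply, hF, fanout_eq_self _ hzq, Equiv.swap_apply_of_ne_of_ne]
      · rintro rfl; exact hyA hzA
      · rintro rfl; simp [flipBit, hyq] at hzq
    have hsub : A.image π \ lowBlock n s ⊆ ((A \ lowBlock n s).erase x).image π := by
      intro w hw
      rw [Finset.mem_sdiff, Finset.mem_image] at hw
      obtain ⟨⟨z, hzA, rfl⟩, hwB⟩ := hw
      refine Finset.mem_image_of_mem _ ?_
      rw [Finset.mem_erase, Finset.mem_sdiff]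
      refine ⟨?_, hzA, fun hzB => hwB (by rwa [hπz z hzA hzB])⟩
      rintro rfl
      exact hwB (hπx ▸ hyB)
    obtain ⟨σ, hσ, h'⟩ := ih (A.image π) (Finset.card_image_le.trans hA) (by
      refine (Finset.card_le_card hsub).trans (Finset.card_image_le.trans ?_)
      rw [Finset.card_erase_of_mem hx]
      omega)
    refine ⟨σ * π, ?_, fun z hz => h' _ (Finset.mem_image_of_mem _ hz)⟩
    have hc := ((hasCircuit_fanout q _ (notMem_diffBits q x y)).weaken
      (card_diffBits_le q x y)).realizes (a := a) (b := b)
    have := hσ.mul ((realizes_swap_flipBit h y q).mul hc)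
    rw [← permGate_mul, ← permGate_mul] at this
    refine this.weaken (le_of_eq ?_)
    ring

/-- Moving a set of at most `2 ^ s` strings into the lower block. -/
lemma exists_perm_lowBlock (h : ∀ t : Fin n, Realizes a b τ (permGate (onesSwap t))) {s k : ℕ}
    (hs : s ≤ n) (A : Finset (Fin n → Bool)) (hA : A.card ≤ 2 ^ s) (hk : A.card ≤ k + 1) :
    ∃ π : Equiv.Perm (Fin n → Bool), Realizes a b (k * (n - 1 + τ)) (permGate π) ∧
      ∀ x ∈ A, π x ∈ lowBlock n s := by
  rcases A.eq_empty_or_nonempty with rfl | ⟨x, hx⟩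
  · exact exists_pivot h hs k ∅ (by simp) (by simp)
  -- Flipping the bits of one element `x` of `A` sends it to the zero string, which lies in the
  -- block. Thus one element is placed for free.
  have hcard : (A.image (xorMask x)).card = A.card :=
    Finset.card_image_of_injective _ (xorMask x).injective
  have h0 : xorMask x x ∈ lowBlock n s := mem_lowBlock.2 fun q _ => by simp [xorMask_apply]
  obtain ⟨π, hπ, h'⟩ := exists_pivot h hs k (A.image (xorMask x)) (hcard.trans_le hA) (by
    have h1 : A.image (xorMask x) \ lowBlock n s ⊆ (A.image (xorMask x)).erase (xorMask x x) := by
      intro z hz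
      rw [Finset.mem_sdiff] at hz
      rw [Finset.mem_erase]
      refine ⟨?_, hz.1⟩
      rintro rfl
      exact hz.2 h0
    refine (Finset.card_le_card h1).trans ?_
    rw [Finset.card_erase_of_mem (Finset.mem_image_of_mem _ hx), hcard]
    omega)
  refine ⟨π * xorMask x, ?_, fun z hz => h' _ (Finset.mem_image_of_mem _ hz)⟩
  rw [permGate_mul]
  exact hπ.mul (hasCircuit_xorMask x).realizes

end Permutations

/-! ### Householder reflections of dense vectors -/

section Reflection

variable {ι : Type} [Fintype ι] [DecidableEq ι]

/-- The reflection `I - 2 |u⟩⟨u|`. -/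
def reflection (u : ι → ℂ) : Matrix ι ι ℂ := 1 - (2 : ℂ) • Matrix.vecMulVec u (star u)

lemma mul_reflection {κ : Type} [Fintype κ] [DecidableEq κ] {U : Matrix κ ι ℂ} (h : Uᴴ * U = 1)
    (u : ι → ℂ) : U * reflection u = reflection (U *ᵥ u) * U := by
  rw [reflection, reflection, Matrix.mul_sub, Matrix.sub_mul, Matrix.mul_one, Matrix.one_mul,
    Matrix.mul_smul, Matrix.smul_mul, Matrix.mul_vecMulVec, Matrix.vecMulVec_mul,
    Matrix.star_mulVec, Matrix.vecMul_vecMul, h, Matrix.vecMul_one]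

lemma star_dotProduct_mulVec {κ : Type} [Fintype κ] {U : Matrix κ ι ℂ} (h : Uᴴ * U = 1)
    (u : ι → ℂ) : star (U *ᵥ u) ⬝ᵥ (U *ᵥ u) = star u ⬝ᵥ u := by
  rw [Matrix.star_mulVec, Matrix.dotProduct_mulVec, Matrix.vecMul_vecMul, h, Matrix.vecMul_one]

end Reflection

/-! ### Angles that rotate a pair of amplitudes to a basis state -/

section Angles

lemma exp_mul_eq_polar (c z : ℂ) :
    Complex.exp c * z = Complex.exp (c + Complex.arg z * Complex.I) * (‖z‖ : ℂ) := by
  nth_rewrite 1 [← Complex.norm_mul_exp_arg_mul_I z]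
  rw [Complex.exp_add]
  ring

lemma exists_angle_of_norm_eq {z w : ℂ} (h : ‖z‖ = ‖w‖) :
    ∃ β : ℝ, Complex.exp (β * Complex.I) * z = Complex.exp (-(β * Complex.I)) * w := by
  refine ⟨(Complex.arg w - Complex.arg z) / 2, ?_⟩
  rw [exp_mul_eq_polar _ z, exp_mul_eq_polar _ w, h]
  congr 2
  push_cast
  ring

/-- Choose `α` so that the two rotated amplitudes have the same phase. After removing it they are
real, and `x - i y` and `x + i y` have equal modulus. -/
lemma exists_angle_norm_eq (z w : ℂ) :
    ∃ α : ℝ, ‖Complex.exp (α * Complex.I) * z - Complex.I * (Complex.exp (-(α * Complex.I)) * w)‖ =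
      ‖Complex.exp (α * Complex.I) * z + Complex.I * (Complex.exp (-(α * Complex.I)) * w)‖ := by
  have hx : ∀ x y : ℝ, ‖(x : ℂ) - Complex.I * y‖ = ‖(x : ℂ) + Complex.I * y‖ := by
    intro x y
    rw [← Complex.norm_conj]
    congr 1
    simp
  refine ⟨(Complex.arg w - Complex.arg z) / 2, ?_⟩
  set γ : ℂ := (Complex.arg w + Complex.arg z) / 2 with hγ
  have h1 : Complex.exp (((Complex.arg w - Complex.arg z) / 2 : ℝ) * Complex.I) * z =
      Complex.exp (γ * Complex.I) * (‖z‖ : ℂ) := by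
    rw [exp_mul_eq_polar]
    congr 2
    rw [hγ]; push_cast; ring
  have h2 : Complex.exp (-(((Complex.arg w - Complex.arg z) / 2 : ℝ) * Complex.I)) * w =
      Complex.exp (γ * Complex.I) * (‖w‖ : ℂ) := by
    rw [exp_mul_eq_polar]
    congr 2
    rw [hγ]; push_cast; ring
  rw [h1, h2, mul_left_comm, ← mul_sub, ← mul_add, norm_mul, norm_mul, hx]

/-- A gate that maps the eigenbasis of Pauli `Y` to the computational basis. -/
def yBasis : Matrix Bool Bool ℂ := Matrix.of fun i j =>
  ((√2 : ℝ) : ℂ)⁻¹ * if j then (if i then Complex.I else -Complex.I) else 1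

lemma yBasis_mem : yBasis ∈ Matrix.unitaryGroup Bool ℂ := by
  rw [Matrix.mem_unitaryGroup_iff, Matrix.star_eq_conjTranspose]
  have := inv_sqrt_two_mul
  have hI := Complex.I_mul_I
  ext i j
  cases i <;> cases j <;> simp [yBasis, Matrix.mul_apply] <;> first
    | linear_combination 2 * this
    | linear_combination 2 * this - (((√2 : ℝ) : ℂ)⁻¹ * ((√2 : ℝ) : ℂ)⁻¹) * hI
    | linear_combination (((√2 : ℝ) : ℂ)⁻¹ * ((√2 : ℝ) : ℂ)⁻¹) * hI

/-- The rotation by `α` makes both amplitudes equal in modulus after `yBasis`, the rotation by `β`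
makes them equal, and the Hadamard gate then cancels the second one. Only the `z` rotations depend
on the amplitudes, so only they have to be multiplexed. -/
lemma exists_disentangle (z w : ℂ) : ∃ α β : ℝ,
    (hadamard * (rz β * (yBasis * rz α))) true false * z +
      (hadamard * (rz β * (yBasis * rz α))) true true * w = 0 := by
  obtain ⟨α, hα⟩ := exists_angle_norm_eq z w
  obtain ⟨β, hβ⟩ := exists_angle_of_norm_eq hα
  refine ⟨α, β, ?_⟩
  have e1 : rz β true true = Complex.exp (-(β * Complex.I)) := by simp [rz, sgn]
  have e2 : rz β false false = Complex.exp (β * Complex.I) := by simp [rz, sgn]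
  have e3 : rz α true true = Complex.exp (-(α * Complex.I)) := by simp [rz, sgn]
  have e4 : rz α false false = Complex.exp (α * Complex.I) := by simp [rz, sgn]
  have e5 : ∀ γ, rz γ true false = 0 := fun γ => by simp [rz]
  have e6 : ∀ γ, rz γ false true = 0 := fun γ => by simp [rz]
  simp only [Matrix.mul_apply, Fintype.sum_bool, e1, e2, e3, e4, e5, e6, hadamard, yBasis,
    Matrix.of_apply]
  simp only [Bool.and_self, Bool.and_false, if_true, Bool.false_eq_true, if_false]
  linear_combination (((√2 : ℝ) : ℂ)⁻¹ * ((√2 : ℝ) : ℂ)⁻¹) * hβ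

end Angles

/-! ### Rotating vectors to the zero state, and the resulting reflections -/

section Dense

variable {n : ℕ}

lemma mux_mulVec {Q : Type} [Fintype Q] [DecidableEq Q] {t : Q}
    {F : (Q → Bool) → Matrix Bool Bool ℂ} (hF : Indep t F) (ψ : (Q → Bool) → ℂ) (y : Q → Bool) :
    (mux t F *ᵥ ψ) y = ∑ b, F y (y t) b * ψ (Function.update y t b) := by
  have := sum_agree t y (fun x => F x (y t) (x t) * ψ x)
  simp only [Function.update_self, hF y] at this
  rw [← this, Matrix.mulVec, dotProduct]
  refine Finset.sum_congr rfl fun x _ => ?_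
  simp only [mux, Matrix.of_apply, ite_mul, zero_mul]
  refine if_congr ?_ rfl rfl
  exact ⟨fun h r hr => (h r hr).symm, fun h r hr => (h r hr).symm⟩

/-- `ψ` vanishes unless all bits from `s` on are `0`. -/
def SupportedBelow (s : ℕ) (ψ : (Fin n → Bool) → ℂ) : Prop := ∀ x ∉ lowBlock n s, ψ x = 0

/-- For each value of the lower `s` bits, qubit `s` carries a pair of amplitudes that is sent to its
`false` component. The angles depend on `s` bits only, so two multiplexed rotations suffice. -/
lemma exists_clear_bit {s : ℕ} (hs : s < n) {ψ : (Fin n → Bool) → ℂ}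
    (hψ : SupportedBelow (s + 1) ψ) :
    ∃ U, HasCircuit (2 * muxCost s) U ∧ SupportedBelow s (U *ᵥ ψ) := by
  set t : Fin n := ⟨s, hs⟩ with ht
  choose α β hαβ using exists_disentangle
  -- Clearing all bits from `s` on makes the angles depend on the lower bits alone. On the support
  -- of `ψ` this alters nothing but bit `t`, and elsewhere the amplitudes vanish anyway.
  set trunc : (Fin n → Bool) → Fin n → Bool := fun y q => if (q : ℕ) < s then y q else false
  set l : List (Fin n) := (List.finRange s).map (Fin.castLE hs.le) with hl
  have hmem : ∀ q : Fin n, q ∈ l ↔ (q : ℕ) < s := by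
    intro q
    simp only [hl, List.mem_map, List.mem_finRange, true_and]
    exact ⟨fun ⟨i, hi⟩ => by rw [← hi]; simp, fun h => ⟨⟨q, h⟩, rfl⟩⟩
  have hlen : l.length = s := by simp [hl]
  have hnd : l.Nodup := (List.nodup_finRange s).map (Fin.castLE_injective _)
  have htl : t ∉ l := by simp [hmem, ht]
  have htrunc : ∀ g : (Fin n → Bool) → ℝ, DependsOn (fun x => g (trunc x)) {q | q ∈ l} := by
    intro g x y h
    simp only
    congr 1
    funext q
    by_cases hq : (q : ℕ) < s
    · simp [trunc, hq, h q ((hmem q).2 hq)]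
    · simp [trunc, hq]
  set A : (Fin n → Bool) → ℝ := fun x =>
    α (ψ (Function.update (trunc x) t false)) (ψ (Function.update (trunc x) t true)) with hA
  set B : (Fin n → Bool) → ℝ := fun x =>
    β (ψ (Function.update (trunc x) t false)) (ψ (Function.update (trunc x) t true)) with hB
  have htr : ∀ x b, trunc (Function.update x t b) = trunc x := by
    intro x b
    funext q
    by_cases hq : (q : ℕ) < s
    · have : q ≠ t := by rintro rfl; simp [ht] at hq
      simp [trunc, hq, this]
    · simp [trunc, hq]
  have hAi : Indep t A := fun x b => by simp only [hA, htr]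
  have hBi : Indep t B := fun x b => by simp only [hB, htr]
  have h1 := hasCircuit_muxRz t l hnd htl A (htrunc fun x =>
    α (ψ (Function.update x t false)) (ψ (Function.update x t true)))
  have h2 := hasCircuit_muxRz t l hnd htl B (htrunc fun x =>
    β (ψ (Function.update x t false)) (ψ (Function.update x t true)))
  rw [phaseDiag_eq_mux, hlen] at h1 h2
  have hc := (HasCircuit.single t hadamard_mem).mul (h2.mul ((HasCircuit.single t yBasis_mem).mul h1))
  rw [mux_mul_mux (indep_const t _), mux_mul_mux (hBi.comp rz), mux_mul_mux (indep_const t _)] at hc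
  refine ⟨_, hc.weaken (by omega), fun y hy => ?_⟩
  rw [mux_mulVec ((hAi.comp₂ hBi) fun a b => hadamard * (rz b * (yBasis * rz a)))]
  by_cases hhigh : ∃ q : Fin n, s + 1 ≤ q ∧ y q = true
  · obtain ⟨q, hq, hyq⟩ := hhigh
    refine Finset.sum_eq_zero fun b _ => ?_
    rw [hψ, mul_zero]
    rw [mem_lowBlock]
    intro hcon
    have := hcon q hq
    have hqt : q ≠ t := by rintro rfl; simp [ht] at hq
    rw [Function.update_of_ne hqt, hyq] at this
    cases this
  · push Not at hhigh
    have hyt : y t = true := by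
      by_contra hyt
      apply hy
      rw [mem_lowBlock]
      intro q hq
      rcases hq.eq_or_lt with h | h
      · have : q = t := Fin.ext h.symm
        rw [this]; simpa using hyt
      · simpa using hhigh q h
    have hup : ∀ b, Function.update y t b = Function.update (trunc y) t b := by
      intro b
      funext q
      by_cases hqt : q = t
      · subst hqt; simp
      · rw [Function.update_of_ne hqt, Function.update_of_ne hqt]
        by_cases hq : (q : ℕ) < s
        · simp [trunc, hq]
        · simp only [trunc, hq, if_false]
          have : s ≠ q := fun h => hqt (Fin.ext h.symm)
          simpa using hhigh q (by omega)
    rw [Fintype.sum_bool, hyt, hup, hup, add_comm]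
    exact hαβ _ _

/-- Bits are cleared from the top. The total is twice the sum of `muxCost j` over `j < s`, that is
`0 + 2 + 4 + ⋯ + 2^(s-1) = 2^s - 2` for `s ≥ 1`. -/
lemma exists_disentangle_all (s : ℕ) : ∀ (_ : s ≤ n) (ψ : (Fin n → Bool) → ℂ)
    (_ : SupportedBelow s ψ), ∃ U, HasCircuit (2 * (2 ^ s - 2)) U ∧ SupportedBelow 0 (U *ᵥ ψ) := by
  induction s with
  | zero => intro _ ψ hψ; exact ⟨1, HasCircuit.one.weaken (by simp), by simpa using hψ⟩
  | succ s ih =>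
    intro hs ψ hψ
    obtain ⟨U, hU, h⟩ := exists_clear_bit hs hψ
    obtain ⟨V, hV, h'⟩ := ih (by omega) _ h
    refine ⟨V * U, (hV.mul hU).weaken ?_, by rwa [← Matrix.mulVec_mulVec]⟩
    unfold muxCost
    split_ifs with h0
    · simp [h0]
    · have : 2 ≤ 2 ^ s := by
        calc 2 = 2 ^ 1 := rfl
          _ ≤ _ := Nat.pow_le_pow_right (by norm_num) (by omega)
      rw [pow_succ]
      omega

variable {a b τ : ℕ}

lemma permGate_onesSwap_eq_mux (t : Fin n) :
    permGate (onesSwap t) = mux t fun x => xPow ((others t).all x) := by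
  rw [permGate_eq_mono, mux_eq_mono (p := fun x => (others t).all x)]
  · congr 1
    · funext x; rw [← mcxFun_others]; rfl
    · funext x; simp [xPow]
  · intro x b h
    by_contra h'
    simp [xPow, h'] at h

/-- The reflection about the hyperplane orthogonal to the zero state. -/
lemma realizes_zeroReflection (h : ∀ t : Fin n, Realizes a b τ (permGate (onesSwap t)))
    (hn : 1 ≤ n) : Realizes a b τ
      (Matrix.diagonal fun x : Fin n → Bool => if x = (fun _ => false) then (-1 : ℂ) else 1) := by
  set t : Fin n := ⟨0, hn⟩
  have hall : Indep t (fun x : Fin n → Bool => (others t).all x) :=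
    indep_all (by simp [mem_others])
  have hH : Realizes a b 0 (mux t fun _ => hadamard) :=
    (HasCircuit.single t hadamard_mem).realizes
  have hX := (hasCircuit_xorMask (n := n) fun _ => true).realizes (a := a) (b := b)
  have := (hX.mul ((hH.mul (h t)).mul hH)).mul hX
  refine cast ?_ (this.weaken (show _ ≤ τ by omega))
  congr 1
  rw [permGate_onesSwap_eq_mux, mux_mul_mux (indep_const t _),
    mux_mul_mux (hall.comp fun b => hadamard * xPow b)]
  -- Between Hadamards the fully controlled NOT becomes a sign on the all-ones string; flipping all
  -- bits moves the sign to the zero string.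
  have hx : ∀ b, hadamard * xPow b * hadamard =
      Matrix.diagonal fun i => if i && b then (-1 : ℂ) else 1 := by
    intro b
    have := inv_sqrt_two_mul
    ext i j
    cases i <;> cases j <;> cases b <;> simp [hadamard, xPow, Matrix.mul_apply] <;>
      first | linear_combination 2 * this | linear_combination -2 * this
  simp only [hx]
  rw [mux_eq_mono (p := fun _ => false), permGate_eq_mono, mono_mul_mono, mono_mul_mono]
  · ext y x
    have e1 : ∀ x : Fin n → Bool, xorMask (fun _ => true) (xorMask (fun _ => true) x) = x := by
      intro x
      rw [← Equiv.Perm.mul_apply, xorMask_mul_self, Equiv.Perm.one_apply]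
    have e2 : (xorMask (fun _ => true) x t && (others t).all (xorMask (fun _ => true) x)) = true ↔
        x = fun _ => false := by
      rw [Bool.and_eq_true, List.all_eq_true]
      simp only [mem_others, xorMask_apply]
      constructor
      · rintro ⟨h1, h2⟩
        funext q
        by_cases hq : q = t
        · rw [hq]; simpa using h1
        · simpa using h2 q hq
      · rintro rfl
        simp
    simp only [mono, Matrix.of_apply, Function.comp, Bool.xor_false, Function.update_eq_self, e1,
      Matrix.diagonal_apply, if_true, Pi.one_apply, one_mul, mul_one]
    by_cases hyx : y = x
    · rw [if_pos hyx, if_pos hyx, hyx]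
      exact if_congr e2 rfl rfl
    · rw [if_neg hyx, if_neg hyx]
  · intro x b hb
    by_contra h'
    apply hb
    rw [Matrix.diagonal_apply_ne]
    simpa using h'

/-- Reflections of vectors that are supported on the lowest `s` qubits. -/
lemma realizes_reflection_of_supportedBelow
    (h : ∀ t : Fin n, Realizes a b τ (permGate (onesSwap t)))
    (hn : 1 ≤ n) {s : ℕ} (hs : s ≤ n) {ψ : (Fin n → Bool) → ℂ} (hψ : SupportedBelow s ψ)
    (h1 : star ψ ⬝ᵥ ψ = 1) : Realizes a b (4 * (2 ^ s - 2) + τ) (reflection ψ) := by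
  obtain ⟨U, hU, h0⟩ := exists_disentangle_all s hs ψ hψ
  set φ := U *ᵥ ψ with hφ
  have h0' : ∀ x, x ≠ (fun _ => false) → φ x = 0 := fun x hx => h0 x (by
    rw [mem_lowBlock]
    exact fun hcon => hx (funext fun q => hcon q (Nat.zero_le _)))
  have hφ1 : star φ ⬝ᵥ φ = 1 := by rw [hφ, star_dotProduct_mulVec hU.unitary, h1]
  have hφ2 : star (φ fun _ => false) * φ (fun _ => false) = 1 := by
    rw [← hφ1, dotProduct, Finset.sum_eq_single (fun _ => false)]
    · rfl
    · intro x _ hx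
      rw [h0' x hx, mul_zero]
    · simp
  -- `φ` is the zero state up to a phase of modulus one, and a reflection does not see the phase of
  -- its vector.
  have e : reflection φ =
      Matrix.diagonal fun x : Fin n → Bool => if x = (fun _ => false) then (-1 : ℂ) else 1 := by
    ext y x
    rw [reflection, Matrix.sub_apply, Matrix.smul_apply, Matrix.vecMulVec_apply, Pi.star_apply,
      smul_eq_mul, Matrix.one_apply, Matrix.diagonal_apply]
    by_cases hy : y = fun _ => false
    · by_cases hx : x = fun _ => false
      · rw [hx, hy, mul_comm (φ _), hφ2]; norm_num
      · have hyx : y ≠ x := fun e => hx (e ▸ hy)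
        simp only [h0' x hx, star_zero, mul_zero, sub_zero, if_neg hyx]
    · rw [h0' y hy, zero_mul, mul_zero, sub_zero, if_neg hy]
  have hr : reflection ψ = Uᴴ * reflection φ * U := by
    rw [Matrix.mul_assoc, ← mul_reflection hU.unitary, ← Matrix.mul_assoc, hU.unitary,
      Matrix.one_mul]
  rw [hr, e]
  refine ((hU.conjTranspose.realizes.mul (realizes_zeroReflection h hn)).mul hU.realizes).weaken ?_
  omega

/-- Reflections of sparse vectors, up to a permutation. -/
lemma exists_realizes_reflection (h : ∀ t : Fin n, Realizes a b τ (permGate (onesSwap t)))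
    (hn : 1 ≤ n) {k : ℕ} (hk : 1 ≤ k) {ψ : (Fin n → Bool) → ℂ} (h1 : star ψ ⬝ᵥ ψ = 1)
    (hψ : (Function.support ψ).ncard ≤ k + 1) :
    ∃ π : Equiv.Perm (Fin n → Bool),
      Realizes a b (k * (n - 1 + τ) + τ + (8 * k - 8)) (permGate π * reflection ψ) := by
  classical
  set A : Finset (Fin n → Bool) := Finset.univ.filter fun x => ψ x ≠ 0 with hA
  have hcard : A.card = (Function.support ψ).ncard := by
    rw [← Set.ncard_coe_finset]
    congr 1
    ext x; simp [hA]
  set s := min n (Nat.clog 2 (k + 1)) with hs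
  have hsn : s ≤ n := min_le_left _ _
  have hAs : A.card ≤ 2 ^ s := by
    rcases min_choice n (Nat.clog 2 (k + 1)) with h' | h'
    · rw [hs, h']
      refine (Finset.card_le_univ A).trans ?_
      simp
    · rw [hs, h', hcard]
      exact hψ.trans (Nat.le_pow_clog (by norm_num) _)
  -- The exponent is the least one whose power reaches `k + 1`, so half of `2^s` is at most `k`.
  -- This turns `4 (2^s - 2)` into at most `8 k - 8`.
  have hsk : 2 ^ s ≤ 2 * k := by
    have h2 : 2 ^ s ≤ 2 ^ Nat.clog 2 (k + 1) :=
      Nat.pow_le_pow_right (by norm_num) (min_le_right _ _)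
    have h3 := Nat.pow_pred_clog_lt_self (b := 2) (by norm_num) (x := k + 1) (by omega)
    have h4 : 0 < Nat.clog 2 (k + 1) := Nat.clog_pos (by norm_num) (by omega)
    obtain ⟨r, hr⟩ := Nat.exists_eq_succ_of_ne_zero h4.ne'
    rw [hr] at h2 h3
    rw [Nat.pred_succ] at h3
    rw [Nat.succ_eq_add_one, pow_succ] at h2
    omega
  obtain ⟨π, hπ, hB⟩ := exists_perm_lowBlock h hsn A hAs (hcard.trans_le hψ)
  have hu : (permGate π)ᴴ * permGate π = 1 := by
    rw [permGate_conjTranspose, ← permGate_mul, inv_mul_cancel, permGate_one]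
  have hsupp : SupportedBelow s (permGate π *ᵥ ψ) := by
    intro y hy
    rw [Matrix.mulVec, dotProduct]
    refine Finset.sum_eq_zero fun x _ => ?_
    simp only [permGate, Matrix.of_apply, ite_mul, one_mul, zero_mul]
    split_ifs with hyx
    · by_contra hx
      exact hy (hyx ▸ hB x (by simpa [hA] using hx))
    · rfl
  refine ⟨π, ?_⟩
  -- `Π H_ψ = H_{Πψ} Π`: the reflection is wanted only up to a permutation, so `Π` is applied once
  -- and not undone.
  rw [mul_reflection hu]
  refine ((realizes_reflection_of_supportedBelow h hn hsn hsupp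
    (by rw [star_dotProduct_mulVec hu, h1])).mul hπ).weaken ?_
  omega

end Dense

/-! ### Implementing matrices with integer indices -/

section Transfer

variable {m n a b : ℕ}

lemma bits_injective (n : ℕ) : Function.Injective fun k : Fin (2 ^ n) => bits n k := by
  intro k l h
  apply Fin.ext
  apply Nat.eq_of_testBit_eq
  intro i
  by_cases hi : i < n
  · exact congrFun h ⟨i, hi⟩
  · have hpow : 2 ^ n ≤ 2 ^ i := Nat.pow_le_pow_right (by norm_num) (by omega)
    rw [Nat.testBit_eq_false_of_lt (k.2.trans_le hpow), Nat.testBit_eq_false_of_lt (l.2.trans_le hpow)]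

/-- Binary expansion as an equivalence. -/
def bitsEquiv (n : ℕ) : Fin (2 ^ n) ≃ (Fin n → Bool) :=
  Equiv.ofBijective (fun k => bits n k)
    ((Fintype.bijective_iff_injective_and_card _).2 ⟨bits_injective n, by simp⟩)

lemma bitsEquiv_apply (k : Fin (2 ^ n)) : bitsEquiv n k = bits n k := rfl

/-- There is a circuit with at most `k` CNOTs that implements `V`. -/
def Implementable (a b k : ℕ) (V : Matrix (Fin (2 ^ n)) (Fin (2 ^ m)) ℂ) : Prop :=
  ∃ C : Circuit n a b, cnotCount C ≤ k ∧ Implements C V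

/-- The embedding of `m`-bit integers as data states. -/
abbrev intEmb (m n a : ℕ) {b : ℕ} (f : Fin b → Bool) :
    Matrix (Fin n ⊕ Fin a ⊕ Fin b → Bool) (Fin (2 ^ m)) ℂ :=
  regEmb a (fun x : Fin (2 ^ m) => bits n x) f

/-- In this intertwining form, products and adjoints of circuits are handled by matrix algebra. -/
lemma implements_iff (C : Circuit n a b) (V : Matrix (Fin (2 ^ n)) (Fin (2 ^ m)) ℂ) :
    Implements C V ↔ ∀ f : Fin b → Bool,
      (circuitMatrix C : Matrix (Fin n ⊕ Fin a ⊕ Fin b → Bool) _ ℂ) * intEmb m n a f =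
        intEmb n n a f * V := by
  constructor
  · intro h f
    apply ext_regState
    intro y e f' x
    rw [mul_regEmb_apply]
    obtain ⟨y, rfl⟩ := (bitsEquiv n).surjective y
    rw [bitsEquiv_apply, h]
    exact (regEmb_mul_apply (bits_injective n) V y e f' f x).symm
  · intro h y x e f f'
    have := congrFun (congrFun (h f') (regState (bits n y) e f)) x
    rw [mul_regEmb_apply] at this
    rw [this]
    exact regEmb_mul_apply (bits_injective n) V y e f f' x

namespace Implementable

variable {k l : ℕ}

lemma weaken {V : Matrix (Fin (2 ^ n)) (Fin (2 ^ m)) ℂ} (h : Implementable a b k V)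
    (hkl : k ≤ l) : Implementable a b l V := by
  obtain ⟨C, hC, h⟩ := h
  exact ⟨C, hC.trans hkl, h⟩

lemma mul {U : Matrix (Fin (2 ^ n)) (Fin (2 ^ n)) ℂ} {V : Matrix (Fin (2 ^ n)) (Fin (2 ^ m)) ℂ}
    (hU : Implementable a b k U) (hV : Implementable a b l V) :
    Implementable a b (k + l) (U * V) := by
  obtain ⟨C, hC, h⟩ := hU
  obtain ⟨C', hC', h'⟩ := hV
  rw [implements_iff] at h h'
  refine ⟨C' ++ C, by rw [cnotCount_append]; omega, ?_⟩
  rw [implements_iff]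
  intro f
  rw [circuitMatrix_append, Matrix.mul_assoc, h', ← Matrix.mul_assoc, h, Matrix.mul_assoc]

lemma conjTranspose {U : Matrix (Fin (2 ^ n)) (Fin (2 ^ n)) ℂ}
    (hU : Implementable a b k U) (h1 : U * Uᴴ = 1) : Implementable a b k Uᴴ := by
  obtain ⟨C, hC, h⟩ := hU
  rw [implements_iff] at h
  refine ⟨invCircuit C, by rwa [cnotCount_invCircuit], ?_⟩
  rw [implements_iff]
  intro f
  rw [circuitMatrix_invCircuit]
  calc (circuitMatrix C)ᴴ * intEmb n n a f
      = (circuitMatrix C)ᴴ * (intEmb n n a f * (U * Uᴴ)) := by rw [h1, Matrix.mul_one]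
    _ = (circuitMatrix C)ᴴ * ((circuitMatrix C : Matrix (Fin n ⊕ Fin a ⊕ Fin b → Bool) _ ℂ) *
          intEmb n n a f) * Uᴴ := by
        rw [h f]; simp only [Matrix.mul_assoc]
    _ = intEmb n n a f * Uᴴ := by rw [← Matrix.mul_assoc, circuitMatrix_unitary, Matrix.one_mul]

lemma one : Implementable a b 0 (1 : Matrix (Fin (2 ^ n)) (Fin (2 ^ n)) ℂ) := by
  refine ⟨[], le_rfl, ?_⟩
  rw [implements_iff]
  intro f
  rw [Matrix.mul_one]
  exact Matrix.one_mul _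

end Implementable

lemma Realizes.implementable {k : ℕ} {V : Matrix (Fin n → Bool) (Fin n → Bool) ℂ}
    (h : Realizes a b k V) (m : ℕ) : Implementable a b k
      (V.submatrix (bitsEquiv n) (fun x : Fin (2 ^ m) => bits n x)) := by
  obtain ⟨C, hC, h⟩ := h
  refine ⟨C, hC, fun y x e f f' => ?_⟩
  have := congrFun (congrFun (h f') (regState (bits n y) e f)) (bits n x)
  rw [mul_regEmb_apply] at this
  refine Eq.trans this ?_
  exact regEmb_mul_apply Function.injective_id V (bits n y) e f f' (bits n x)

variable {τ : ℕ}

/-- Householder reflections up to a permutation gate. -/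
lemma exists_implementable_householder
    (h : ∀ t : Fin n, Realizes a b τ (permGate (onesSwap t)))
    (hn : 1 ≤ n) {k : ℕ} (hk : 1 ≤ k) {v : EuclideanSpace ℂ (Fin (2 ^ n))} (h1 : ‖v‖ = 1)
    (hv : nnz v.ofLp ≤ k + 1) :
    ∃ π : Equiv.Perm (Fin (2 ^ n)),
      Implementable a b (k * (n - 1 + τ) + τ + (8 * k - 8)) (permGate π * householder v) := by
  set ψ : (Fin n → Bool) → ℂ := v.ofLp ∘ (bitsEquiv n).symm with hψ
  have hψ1 : star ψ ⬝ᵥ ψ = 1 := by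
    have : star ψ ⬝ᵥ ψ = ∑ i, star (v.ofLp i) * v.ofLp i := by
      rw [dotProduct]
      exact Equiv.sum_comp (bitsEquiv n).symm (fun i => star (v.ofLp i) * v.ofLp i)
    rw [this]
    have h2 := EuclideanSpace.norm_sq_eq v
    rw [h1] at h2
    have h3 : ∀ i, star (v.ofLp i) * v.ofLp i = ((‖v.ofLp i‖ ^ 2 : ℝ) : ℂ) := fun i => by
      rw [Complex.star_def, mul_comm, Complex.mul_conj, Complex.normSq_eq_norm_sq]
    simp only [h3]
    rw [← Complex.ofReal_sum, ← h2]
    simp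
  have hsupp : (Function.support ψ).ncard ≤ k + 1 := by
    have : Function.support ψ = bitsEquiv n '' Function.support v.ofLp := by
      ext x
      rw [(bitsEquiv n).image_eq_preimage_symm]
      rfl
    rw [this, Set.ncard_image_of_injective _ (bitsEquiv n).injective]
    exact hv
  obtain ⟨π, hπ⟩ := exists_realizes_reflection h hn hk hψ1 hsupp
  refine ⟨(bitsEquiv n).permCongr.symm π, ?_⟩
  have := hπ.implementable n
  convert this using 1
  rw [show (fun x : Fin (2 ^ n) => bits n x) = bitsEquiv n from rfl,
    ← Matrix.submatrix_mul_equiv _ _ _ (bitsEquiv n)]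
  congr 1
  · ext y x
    simp only [permGate, Matrix.submatrix_apply, Matrix.of_apply, Equiv.permCongr_symm_apply,
      Equiv.eq_symm_apply]
  · ext y x
    simp [householder, reflection, hψ, Matrix.one_apply, Matrix.vecMulVec_apply]

/-- The values are corrected one at a time by a transposition that does not disturb the earlier
ones. The predicate `P` carries a cost bound `c` per transposition; a trivial `P` gives the bare
extension of a partial injection to a permutation. -/
lemma exists_perm_of_injective {α : Type} [DecidableEq α] [Fintype α] {c : ℕ}
    {P : ℕ → Equiv.Perm α → Prop} (h1 : P 0 1)
    (hP : ∀ k σ x y, P k σ → P (k + c) (Equiv.swap x y * σ)) {N : ℕ} {g g' : Fin N → α}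
    (hg : Function.Injective g) (hg' : Function.Injective g') :
    ∃ σ, P (N * c) σ ∧ ∀ i, σ (g i) = g' i := by
  have key : ∀ k, k ≤ N → ∃ σ, P (k * c) σ ∧ ∀ i : Fin N, (i : ℕ) < k → σ (g i) = g' i := by
    intro k
    induction k with
    | zero => exact fun _ => ⟨1, by simpa using h1, fun i hi => absurd hi (Nat.not_lt_zero _)⟩
    | succ k ih =>
      intro hk
      obtain ⟨σ, hσ, h⟩ := ih (by omega)
      refine ⟨Equiv.swap (σ (g ⟨k, hk⟩)) (g' ⟨k, hk⟩) * σ, ?_, fun i hi => ?_⟩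
      · rw [Nat.add_mul, Nat.one_mul]
        exact hP _ _ _ _ hσ
      · rw [Equiv.Perm.mul_apply]
        rcases Nat.lt_succ_iff_lt_or_eq.1 hi with h' | h'
        · have hne : i ≠ ⟨k, hk⟩ := fun e => by rw [e] at h'; simp at h'
          rw [Equiv.swap_apply_of_ne_of_ne, h i h']
          · exact σ.injective.ne (hg.ne hne)
          · rw [h i h']; exact hg'.ne hne
        · have : i = ⟨k, hk⟩ := Fin.ext h'
          rw [this, Equiv.swap_apply_left]
  obtain ⟨σ, hσ, h⟩ := key N le_rfl
  exact ⟨σ, hσ, fun i => h i i.2⟩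

lemma permGate_mul_idIso_mul_diagGate_apply (hmn : 2 ^ m ≤ 2 ^ n) (π : Equiv.Perm (Fin (2 ^ n)))
    (d : Fin (2 ^ m) → Circle) (y : Fin (2 ^ n)) (x : Fin (2 ^ m)) :
    (permGate π * idIso n m * diagGate d) y x =
      if y = π (Fin.castLE hmn x) then (d x : ℂ) else 0 := by
  rw [diagGate, Matrix.mul_diagonal, Matrix.mul_apply, Finset.sum_eq_single (Fin.castLE hmn x)]
  · simp [permGate, idIso]
  · intro z _ hz
    have : (z : ℕ) ≠ x := fun e => hz (Fin.ext e)
    simp [idIso, this]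
  · simp

lemma bits_eq_false_of_le {x : Fin (2 ^ m)} {q : Fin n} (h : m ≤ q) : bits n x q = false :=
  Nat.testBit_eq_false_of_lt (x.2.trans_le (Nat.pow_le_pow_right (by norm_num) h))

/-- Isometries that permute basis states up to phases. -/
lemma implementable_permDiag (h : ∀ t : Fin n, Realizes a b τ (permGate (onesSwap t)))
    (hn : 1 ≤ n) (hmn : m ≤ n) (π : Equiv.Perm (Fin (2 ^ n))) (d : Fin (2 ^ m) → Circle) :
    Implementable a b (if m = 0 then 0 else 2 ^ m * (2 * (n - 1) + τ) + 2 ^ m)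
      (permGate π * idIso n m * diagGate d) := by
  have hpow : 2 ^ m ≤ 2 ^ n := Nat.pow_le_pow_right (by norm_num) hmn
  set g : Fin (2 ^ m) → Fin n → Bool := fun x => bits n x with hg
  set g' : Fin (2 ^ m) → Fin n → Bool := fun x => bitsEquiv n (π (Fin.castLE hpow x)) with hg'
  have hginj : Function.Injective g := fun x y hxy => by
    have := bits_injective n (a₁ := Fin.castLE hpow x) (a₂ := Fin.castLE hpow y) hxy
    exact Fin.castLE_injective _ this
  have hg'inj : Function.Injective g' :=
    (bitsEquiv n).injective.comp (π.injective.comp (Fin.castLE_injective hpow))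
  obtain ⟨σ, hσ, hσg⟩ : ∃ σ : Equiv.Perm (Fin n → Bool),
      Realizes a b (if m = 0 then 0 else 2 ^ m * (2 * (n - 1) + τ)) (permGate σ) ∧
        ∀ x, σ (g x) = g' x := by
    -- For `m = 0` only one basis state has to be moved, and `X` gates do this for free.
    split_ifs with hm
    · subst hm
      refine ⟨xorMask (g' 0), (hasCircuit_xorMask _).realizes, fun x => ?_⟩
      have hx : x = 0 := Subsingleton.elim (α := Fin 1) x 0
      subst hx
      funext q
      rw [xorMask_apply, hg]
      simp only
      rw [bits_eq_false_of_le (Nat.zero_le _), Bool.false_xor]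
    · exact exists_perm_of_injective (P := fun k σ => Realizes a b k (permGate σ))
        (by rw [permGate_one]; exact HasCircuit.one.realizes)
        (fun k σ x y hσ => by
          rw [permGate_mul, Nat.add_comm]
          exact (realizes_swap h x y).mul hσ) hginj hg'inj
  set l : List (Fin n) := (List.finRange m).map (Fin.castLE hmn) with hl
  -- The phases are applied before the permutation, on the `m` input qubits only, at a cost of `2^m
  -- - 2`.
  set f : (Fin n → Bool) → ℝ := fun w =>
    Complex.arg (d ((bitsEquiv m).symm fun q => w (Fin.castLE hmn q))) with hf
  have hfdep : DependsOn f {q | q ∈ l} := by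
    intro w w' hw
    simp only [hf]
    congr 5
    funext q
    exact hw _ (by simp [hl])
  have hD := (hasCircuit_phaseDiag ⟨0, hn⟩ l
    ((List.nodup_finRange m).map (Fin.castLE_injective _)) f hfdep).realizes (a := a) (b := b)
  have hlen : l.length = m := by simp [hl]
  rw [hlen] at hD
  have := (hσ.mul hD).implementable m
  refine cast ?_ (this.weaken (l := if m = 0 then 0 else 2 ^ m * (2 * (n - 1) + τ) + 2 ^ m) ?_)
  · congr 1
    ext y x
    rw [Matrix.submatrix_apply, permGate_mul_idIso_mul_diagGate_apply hpow, phaseDiag,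
      mul_mono_apply]
    have e1 : (bitsEquiv m).symm (fun q => bits n x (Fin.castLE hmn q)) = x := by
      rw [Equiv.symm_apply_eq]; rfl
    have e2 : Complex.exp (f (bits n x) * Complex.I) = d x := by
      simp only [hf, e1]
      have := Complex.norm_mul_exp_arg_mul_I (d x : ℂ)
      rwa [Circle.norm_coe, Complex.ofReal_one, one_mul] at this
    rw [e2, permGate, Matrix.of_apply, id, show σ (bits n x) = g' x from hσg x, hg']
    simp only [(bitsEquiv n).apply_eq_iff_eq, ite_mul, one_mul, zero_mul]
  · split_ifs with hm
    · simp [hm]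
    · exact Nat.add_le_add_left (Nat.sub_le _ _) _

end Transfer

/-! ### Monomial gates and Householder reflections -/

section Monomial

variable {ι : Type} [Fintype ι] [DecidableEq ι]

/-- A permutation gate followed by a diagonal gate. -/
def IsMonomial (G : Matrix ι ι ℂ) : Prop :=
  ∃ (d : ι → Circle) (π : Equiv.Perm ι), G = diagGate d * permGate π

lemma diagGate_mul (d d' : ι → Circle) : diagGate (d * d') = diagGate d * diagGate d' := by
  rw [diagGate, diagGate, diagGate, Matrix.diagonal_mul_diagonal]
  congr 1

lemma diagGate_one : diagGate (1 : ι → Circle) = 1 := by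
  rw [diagGate, ← Matrix.diagonal_one]
  congr 1

lemma diagGate_conjTranspose (d : ι → Circle) : (diagGate d)ᴴ = diagGate d⁻¹ := by
  rw [diagGate, Matrix.diagonal_conjTranspose, diagGate]
  congr 1
  funext x
  exact (Circle.coe_inv_eq_conj (d x)).symm

lemma permGate_mul_diagGate (π : Equiv.Perm ι) (d : ι → Circle) :
    permGate π * diagGate d = diagGate (d ∘ π.symm) * permGate π := by
  ext y x
  rw [diagGate, diagGate, Matrix.mul_diagonal, Matrix.diagonal_mul]
  simp only [permGate, Matrix.of_apply, Function.comp]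
  split_ifs with h
  · rw [h, Equiv.symm_apply_apply, mul_comm]
  · simp

lemma IsMonomial.one : IsMonomial (1 : Matrix ι ι ℂ) :=
  ⟨1, 1, by rw [diagGate_one, permGate_one, Matrix.one_mul]⟩

lemma IsMonomial.mul {G G' : Matrix ι ι ℂ} (h : IsMonomial G) (h' : IsMonomial G') :
    IsMonomial (G * G') := by
  obtain ⟨d, π, rfl⟩ := h
  obtain ⟨d', π', rfl⟩ := h'
  refine ⟨d * (d' ∘ π.symm), π * π', ?_⟩
  rw [diagGate_mul, permGate_mul, Matrix.mul_assoc, ← Matrix.mul_assoc (permGate π),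
    permGate_mul_diagGate]
  simp only [Matrix.mul_assoc]

lemma IsMonomial.conjTranspose {G : Matrix ι ι ℂ} (h : IsMonomial G) : IsMonomial Gᴴ := by
  obtain ⟨d, π, rfl⟩ := h
  rw [Matrix.conjTranspose_mul, permGate_conjTranspose, diagGate_conjTranspose,
    permGate_mul_diagGate]
  exact ⟨_, _, rfl⟩

lemma IsMonomial.conjTranspose_mul_self {G : Matrix ι ι ℂ} (h : IsMonomial G) : Gᴴ * G = 1 := by
  obtain ⟨d, π, rfl⟩ := h
  rw [Matrix.conjTranspose_mul, Matrix.mul_assoc, ← Matrix.mul_assoc _ (diagGate d),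
    diagGate_conjTranspose, ← diagGate_mul, inv_mul_cancel, diagGate_one, Matrix.one_mul,
    permGate_conjTranspose, ← permGate_mul, inv_mul_cancel, permGate_one]

lemma diagGate_mul_permGate_mulVec (d : ι → Circle) (π : Equiv.Perm ι) (x : ι → ℂ) (y : ι) :
    ((diagGate d * permGate π) *ᵥ x) y = d y * x (π.symm y) := by
  rw [← Matrix.mulVec_mulVec, diagGate, Matrix.mulVec_diagonal, Matrix.mulVec, dotProduct,
    Finset.sum_eq_single (π.symm y)]
  · simp [permGate]
  · intro z _ hz
    rw [permGate, Matrix.of_apply, if_neg, zero_mul]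
    rintro rfl
    simp at hz
  · simp

lemma IsMonomial.nnz_mulVec_le {G : Matrix ι ι ℂ} (h : IsMonomial G) (x : ι → ℂ) :
    nnz (G *ᵥ x) ≤ nnz x := by
  obtain ⟨d, π, rfl⟩ := h
  have : Function.support ((diagGate d * permGate π) *ᵥ x) ⊆ π '' Function.support x := by
    intro y hy
    rw [Function.mem_support, diagGate_mul_permGate_mulVec] at hy
    exact ⟨π.symm y, right_ne_zero_of_mul hy, by simp⟩
  exact (Set.ncard_le_ncard this (Set.toFinite _)).trans (Set.ncard_image_le (Set.toFinite _))

lemma reflection_mulVec (u x : ι → ℂ) :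
    reflection u *ᵥ x = x - (2 * (star u ⬝ᵥ x)) • u := by
  ext i
  rw [reflection, Matrix.sub_mulVec, Matrix.one_mulVec, Matrix.smul_mulVec]
  simp only [Pi.sub_apply, Pi.smul_apply, smul_eq_mul, Matrix.mulVec, Matrix.vecMulVec_apply,
    dotProduct, mul_assoc, ← Finset.mul_sum]
  ring

lemma star_dotProduct_self (v : EuclideanSpace ℂ ι) :
    star v.ofLp ⬝ᵥ v.ofLp = ((‖v‖ ^ 2 : ℝ) : ℂ) := by
  rw [EuclideanSpace.norm_sq_eq, dotProduct, Complex.ofReal_sum]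
  refine Finset.sum_congr rfl fun i _ => ?_
  rw [Pi.star_apply, Complex.star_def, mul_comm, Complex.mul_conj, Complex.normSq_eq_norm_sq]

lemma reflection_mul_self {u : ι → ℂ} (h : star u ⬝ᵥ u = 1) :
    (reflection u)ᴴ * reflection u = 1 := by
  have e : (reflection u)ᴴ = reflection u := by
    rw [reflection, Matrix.conjTranspose_sub, Matrix.conjTranspose_one, Matrix.conjTranspose_smul,
      Matrix.conjTranspose_vecMulVec, star_star]
    simp
  have h2 : reflection u *ᵥ u = -u := by
    rw [reflection_mulVec, h]
    module
  rw [e]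
  nth_rewrite 2 [reflection]
  rw [Matrix.mul_sub, Matrix.mul_one, Matrix.mul_smul, Matrix.mul_vecMulVec, h2, reflection,
    Matrix.neg_vecMulVec]
  module

variable (v : EuclideanSpace ℂ ι) (r : ι)

/-- The phase of the image of `v` under its Householder reflection. -/
def householderPhase : ℂ :=
  Complex.exp (householderAngle v (EuclideanSpace.single r 1) * Complex.I)

lemma norm_householderPhase : ‖householderPhase v r‖ = 1 := Complex.norm_exp_ofReal_mul_I _

lemma inner_single_one : inner ℂ v (EuclideanSpace.single r 1) = star (v.ofLp r) := by
  rw [EuclideanSpace.inner_single_right]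
  simp

/-- The angle `π - arg ⟨v|w⟩` makes the rotated inner product real and non-positive. Hence `v -
exp(iθ) w` suffers no cancellation: its squared norm is `2 (1 + |v r|)`, so normalizing is harmless
and the reflection sends `v` to `exp(iθ) w`. -/
lemma householderPhase_mul_star :
    householderPhase v r * star (v.ofLp r) = -(‖v.ofLp r‖ : ℂ) := by
  rw [householderPhase, householderAngle, inner_single_one]
  split_ifs with h
  · have : v.ofLp r = 0 := by simpa using h
    rw [this]; simp
  · set z := star (v.ofLp r) with hz
    have hn : ‖v.ofLp r‖ = ‖z‖ := by rw [hz, norm_star]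
    rw [hn]
    nth_rewrite 2 [← Complex.norm_mul_exp_arg_mul_I z]
    rw [mul_left_comm, ← Complex.exp_add]
    have : ((Real.pi - Complex.arg z : ℝ) : ℂ) * Complex.I + Complex.arg z * Complex.I =
        Real.pi * Complex.I := by push_cast; ring
    rw [this, Complex.exp_pi_mul_I]
    ring

/-- The direction of the Householder reflection, not normalized. -/
def householderDir : EuclideanSpace ℂ ι :=
  v - householderPhase v r • EuclideanSpace.single r 1

variable {v}

lemma star_householderDir_dotProduct (x : ι → ℂ) :
    star (householderDir v r).ofLp ⬝ᵥ x =
      star v.ofLp ⬝ᵥ x - star (householderPhase v r) * x r := by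
  have : (householderDir v r).ofLp = v.ofLp - householderPhase v r • Pi.single r 1 := by
    ext i
    simp [householderDir, Pi.single_apply]
  rw [this, star_sub, sub_dotProduct, star_smul, smul_dotProduct, smul_eq_mul]
  congr 2
  rw [dotProduct, Finset.sum_eq_single r]
  · simp
  · intro i _ hi; simp [hi]
  · simp

lemma star_householderDir_dotProduct_self (hv : ‖v‖ = 1) :
    star (householderDir v r).ofLp ⬝ᵥ v.ofLp = ((1 + ‖v.ofLp r‖ : ℝ) : ℂ) := by
  rw [star_householderDir_dotProduct, star_dotProduct_self, hv]
  have := congrArg star (householderPhase_mul_star v r)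
  rw [star_mul', star_star, star_neg, Complex.star_def, Complex.conj_ofReal] at this
  rw [Complex.star_def, this]
  push_cast
  ring

lemma norm_householderDir_sq (hv : ‖v‖ = 1) :
    ‖householderDir v r‖ ^ 2 = 2 * (1 + ‖v.ofLp r‖) := by
  have h1 := star_dotProduct_self (householderDir v r)
  have h2 : star (householderPhase v r) * householderPhase v r = 1 := by
    rw [Complex.star_def, mul_comm, Complex.mul_conj, Complex.normSq_eq_norm_sq,
      norm_householderPhase]
    simp
  have h3 : (householderDir v r).ofLp = v.ofLp - householderPhase v r • Pi.single r 1 := by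
    ext i
    simp [householderDir, Pi.single_apply]
  have h4 := star_householderDir_dotProduct_self r hv
  have h5 : star (householderDir v r).ofLp ⬝ᵥ (householderPhase v r • Pi.single r 1) =
      householderPhase v r * star (v.ofLp r) - 1 := by
    rw [star_householderDir_dotProduct, dotProduct_smul, dotProduct_single]
    simp only [Pi.star_apply, Pi.smul_apply, Pi.single_eq_same, smul_eq_mul, mul_one]
    rw [h2]
  nth_rewrite 2 [h3] at h1
  rw [dotProduct_sub, h4, h5, householderPhase_mul_star] at h1
  have : ((2 * (1 + ‖v.ofLp r‖) : ℝ) : ℂ) = ((‖householderDir v r‖ ^ 2 : ℝ) : ℂ) := by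
    rw [← h1]; push_cast; ring
  exact_mod_cast this.symm

lemma householderDir_norm_pos (hv : ‖v‖ = 1) : 0 < ‖householderDir v r‖ := by
  have h := norm_householderDir_sq r hv
  have h0 := norm_nonneg (v.ofLp r)
  by_contra hcon
  have : ‖householderDir v r‖ = 0 := le_antisymm (not_lt.1 hcon) (norm_nonneg _)
  rw [this] at h
  nlinarith

lemma householderVector_eq :
    householderVector v (EuclideanSpace.single r 1) =
      ((‖householderDir v r‖⁻¹ : ℝ) : ℂ) • householderDir v r := rfl

lemma norm_householderVector (hv : ‖v‖ = 1) :
    ‖householderVector v (EuclideanSpace.single r 1)‖ = 1 := by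
  have := householderDir_norm_pos r hv
  rw [householderVector_eq, norm_smul, Complex.norm_real, norm_inv, norm_norm,
    inv_mul_cancel₀ this.ne']

lemma householderMap_mulVec (x : ι → ℂ) :
    householderMap v (EuclideanSpace.single r 1) *ᵥ x =
      x - (2 * (((‖householderDir v r‖ ^ 2)⁻¹ : ℝ) : ℂ) *
        (star (householderDir v r).ofLp ⬝ᵥ x)) • (householderDir v r).ofLp := by
  have : householderMap v (EuclideanSpace.single r 1) =
      reflection (((‖householderDir v r‖⁻¹ : ℝ) : ℂ) • (householderDir v r).ofLp) := rfl
  rw [this, reflection_mulVec, star_smul, smul_dotProduct, smul_smul, smul_eq_mul,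
    Complex.star_def, Complex.conj_ofReal]
  congr 2
  push_cast
  ring

lemma householderMap_mulVec_self (hv : ‖v‖ = 1) :
    householderMap v (EuclideanSpace.single r 1) *ᵥ v.ofLp =
      householderPhase v r • Pi.single r 1 := by
  rw [householderMap_mulVec, star_householderDir_dotProduct_self r hv, norm_householderDir_sq r hv]
  have h0 := norm_nonneg (v.ofLp r)
  have h1 : (1 + (‖v.ofLp r‖ : ℂ)) ≠ 0 := by
    have : (1 + ‖v.ofLp r‖ : ℝ) ≠ 0 := by positivity
    exact_mod_cast this
  have h2 : 2 * (((2 * (1 + ‖v.ofLp r‖))⁻¹ : ℝ) : ℂ) * ((1 + ‖v.ofLp r‖ : ℝ) : ℂ) = 1 := by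
    push_cast
    field_simp
  rw [h2, one_smul]
  ext i
  simp [householderDir, Pi.single_apply]

/-- The Householder vector lies in the span of `v` and the basis state `r`. This is what keeps
finished columns intact. -/
lemma householderMap_mulVec_of_orthogonal {x : ι → ℂ} (hx : star v.ofLp ⬝ᵥ x = 0) (hr : x r = 0) :
    householderMap v (EuclideanSpace.single r 1) *ᵥ x = x := by
  rw [householderMap_mulVec, star_householderDir_dotProduct, hx, hr]
  simp

lemma householderMap_unitary (hv : ‖v‖ = 1) :
    (householderMap v (EuclideanSpace.single r 1))ᴴ *
      householderMap v (EuclideanSpace.single r 1) = 1 := by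
  refine reflection_mul_self ?_
  rw [star_dotProduct_self, norm_householderVector r hv]
  simp

/-- Subtracting the basis state can create one new entry, at `r`; this is the `1 +` in `s(i)`. -/
lemma nnz_householderVector_le :
    nnz (householderVector v (EuclideanSpace.single r 1)).ofLp ≤ nnz v.ofLp + 1 := by
  have : Function.support (householderVector v (EuclideanSpace.single r 1)).ofLp ⊆
      insert r (Function.support v.ofLp) := by
    intro i hi
    rw [Set.mem_insert_iff, or_iff_not_imp_left]
    intro hir
    rw [Function.mem_support] at hi ⊢
    contrapose! hi
    rw [householderVector_eq]
    simp [householderDir, hi, hir]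
  exact (Set.ncard_le_ncard this (Set.toFinite _)).trans (Set.ncard_insert_le _ _)

end Monomial

/-! ### The sparse Householder decomposition -/

section Decomposition

variable {m n a b : ℕ}

lemma IsIsometry.le {V : Matrix (Fin (2 ^ n)) (Fin (2 ^ m)) ℂ} (h : IsIsometry V) : m ≤ n := by
  have h1 := Matrix.rank_mul_le_right Vᴴ V
  rw [show Vᴴ * V = 1 from h, Matrix.rank_one, Fintype.card_fin] at h1
  have h2 := Matrix.rank_le_card_height V
  rw [Fintype.card_fin] at h2
  exact (Nat.pow_le_pow_iff_right (by norm_num)).1 (h1.trans h2)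

lemma IsIsometry.mul {U : Matrix (Fin (2 ^ n)) (Fin (2 ^ n)) ℂ}
    {V : Matrix (Fin (2 ^ n)) (Fin (2 ^ m)) ℂ} (hU : IsIsometry U) (hV : IsIsometry V) :
    IsIsometry (U * V : Matrix (Fin (2 ^ n)) (Fin (2 ^ m)) ℂ) := by
  rw [IsIsometry] at *
  rw [Matrix.conjTranspose_mul, Matrix.mul_assoc, ← Matrix.mul_assoc Uᴴ, hU, Matrix.one_mul, hV]

lemma IsMonomial.isIsometry {G : Matrix (Fin (2 ^ n)) (Fin (2 ^ n)) ℂ} (h : IsMonomial G) :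
    IsIsometry G :=
  h.conjTranspose_mul_self

lemma IsIsometry.star_column_dotProduct {V : Matrix (Fin (2 ^ n)) (Fin (2 ^ m)) ℂ}
    (h : IsIsometry V) (x x' : Fin (2 ^ m)) :
    star (column V x).ofLp ⬝ᵥ (column V x').ofLp = if x = x' then 1 else 0 := by
  have : (Vᴴ * V) x x' = (1 : Matrix (Fin (2 ^ m)) (Fin (2 ^ m)) ℂ) x x' :=
    congrFun (congrFun h x) x'
  rw [Matrix.one_apply] at this
  exact this

lemma IsIsometry.norm_column {V : Matrix (Fin (2 ^ n)) (Fin (2 ^ m)) ℂ}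
    (h : IsIsometry V) (x : Fin (2 ^ m)) : ‖column V x‖ = 1 := by
  have h1 := h.star_column_dotProduct x x
  rw [star_dotProduct_self, if_pos rfl] at h1
  have h2 : ‖column V x‖ ^ 2 = 1 := by exact_mod_cast h1
  exact (pow_eq_one_iff_of_nonneg (norm_nonneg _) two_ne_zero).1 h2

lemma column_mul (U : Matrix (Fin (2 ^ n)) (Fin (2 ^ n)) ℂ)
    (V : Matrix (Fin (2 ^ n)) (Fin (2 ^ m)) ℂ) (x : Fin (2 ^ m)) :
    (column (U * V : Matrix (Fin (2 ^ n)) (Fin (2 ^ m)) ℂ) x).ofLp =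
      U *ᵥ (column V x).ofLp := rfl

lemma diagGate_mul_permGate_mulVec_single {ι : Type} [Fintype ι] [DecidableEq ι] (d : ι → Circle)
    (π : Equiv.Perm ι) (c : ℂ) (r : ι) :
    (diagGate d * permGate π) *ᵥ (c • Pi.single r 1) = (d (π r) * c) • Pi.single (π r) 1 := by
  ext y
  rw [diagGate_mul_permGate_mulVec]
  by_cases h : y = π r
  · subst h; simp
  · have : π.symm y ≠ r := fun h' => h (by rw [← h', Equiv.apply_symm_apply])
    simp [h, this]

lemma IsMonomial.exists_mulVec_single {ι : Type} [Fintype ι] [DecidableEq ι]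
    {G : Matrix ι ι ℂ} (h : IsMonomial G) {c : ℂ} (hc : ‖c‖ = 1) (r : ι) :
    ∃ (c' : ℂ) (r' : ι), ‖c'‖ = 1 ∧ G *ᵥ (c • Pi.single r 1) = c' • Pi.single r' 1 := by
  obtain ⟨d, π, rfl⟩ := h
  exact ⟨_, _, by rw [norm_mul, Circle.norm_coe, hc, one_mul],
    diagGate_mul_permGate_mulVec_single d π c r⟩

/-- An isometry whose columns are basis states up to phases. -/
lemma IsIsometry.exists_eq_permDiag {V : Matrix (Fin (2 ^ n)) (Fin (2 ^ m)) ℂ} (h : IsIsometry V)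
    (hV : ∀ x, ∃ (c : ℂ) (r : Fin (2 ^ n)), ‖c‖ = 1 ∧ (column V x).ofLp = c • Pi.single r 1) :
    ∃ (π : Equiv.Perm (Fin (2 ^ n))) (d : Fin (2 ^ m) → Circle),
      V = permGate π * idIso n m * diagGate d := by
  have hpow : 2 ^ m ≤ 2 ^ n := Nat.pow_le_pow_right (by norm_num) h.le
  choose c r hc hr using hV
  have hinj : Function.Injective r := by
    intro x x' hx
    by_contra hne
    have h1 := h.star_column_dotProduct x x'
    rw [if_neg hne, hr, hr, hx, star_smul, smul_dotProduct, dotProduct_smul,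
      dotProduct_single, Pi.star_apply, Pi.single_eq_same] at h1
    have h2 : star (c x) * c x' = 0 := by simpa using h1
    have h3 := congrArg norm h2
    rw [norm_mul, norm_star, hc, hc, norm_zero] at h3
    norm_num at h3
  -- Orthogonality of the columns makes their rows distinct; the injection is extended to a
  -- permutation of all rows.
  obtain ⟨π, -, hπ⟩ := exists_perm_of_injective (P := fun _ _ => True) (c := 0) trivial
    (fun _ _ _ _ _ => trivial) (Fin.castLE_injective hpow) hinj
  refine ⟨π, fun x => ⟨c x, mem_sphere_zero_iff_norm.2 (hc x)⟩, ?_⟩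
  ext y x
  refine Eq.trans ?_ (permGate_mul_idIso_mul_diagGate_apply hpow π _ y x).symm
  rw [hπ]
  have := congrFun (hr x) y
  rw [Pi.smul_apply, Pi.single_apply, smul_eq_mul, mul_ite, mul_one, mul_zero] at this
  exact this

variable {W : Matrix (Fin (2 ^ n)) (Fin (2 ^ m)) ℂ} (ρ : Equiv.Perm (Fin (2 ^ n)))
  (σ : Equiv.Perm (Fin (2 ^ m))) (D : ℕ → Fin (2 ^ n) → Circle)
  (P : ℕ → Equiv.Perm (Fin (2 ^ n)))

lemma isIsometry_reduced (hW : IsIsometry W) (i : ℕ) : IsIsometry (reduced W ρ σ D P i) := by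
  induction i with
  | zero => exact hW
  | succ i ih =>
    rw [reduced, Matrix.mul_assoc]
    exact (IsMonomial.isIsometry ⟨_, _, rfl⟩).mul
      (IsIsometry.mul (householderMap_unitary _ (ih.norm_column _)) ih)

lemma ofNat_ne_ofNat {N i j : ℕ} [NeZero N] (hi : i < N) (hji : j < i) :
    Fin.ofNat N j ≠ Fin.ofNat N i := by
  intro h
  have h1 : j % N = i % N := congrArg Fin.val h
  rw [Nat.mod_eq_of_lt hi, Nat.mod_eq_of_lt (hji.trans hi)] at h1
  omega

/-- After `i` steps, the first `i` columns are reduced to basis states up to phases. -/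
lemma exists_column_reduced_eq (hW : IsIsometry W) {i : ℕ} (hi : i ≤ 2 ^ m) {j : ℕ} (hj : j < i) :
    ∃ c : ℂ, ‖c‖ = 1 ∧ (column (reduced W ρ σ D P i) (σ (Fin.ofNat (2 ^ m) j))).ofLp =
      c • Pi.single (cumPerm P i (ρ (Fin.ofNat (2 ^ n) j))) 1 := by
  have hpow : 2 ^ m ≤ 2 ^ n := Nat.pow_le_pow_right (by norm_num) hW.le
  induction i with
  | zero => omega
  | succ i ih =>
    have hR := isIsometry_reduced ρ σ D P hW i
    have hv := hR.norm_column (σ (Fin.ofNat (2 ^ m) i))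
    rw [reduced, Matrix.mul_assoc, column_mul, column_mul, cumPerm, Equiv.Perm.mul_apply]
    rcases Nat.lt_succ_iff_lt_or_eq.1 hj with hj | rfl
    · obtain ⟨c, hc, e⟩ := ih (Nat.le_of_succ_le hi) hj
      have hσ : σ (Fin.ofNat (2 ^ m) i) ≠ σ (Fin.ofNat (2 ^ m) j) :=
        fun h' => ofNat_ne_ofNat hi hj (σ.injective h').symm
      have hρ : cumPerm P i (ρ (Fin.ofNat (2 ^ n) i)) ≠ cumPerm P i (ρ (Fin.ofNat (2 ^ n) j)) :=
        fun h' => ofNat_ne_ofNat (lt_of_lt_of_le hi hpow) hj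
          (ρ.injective ((cumPerm P i).injective h')).symm
      -- A finished column is orthogonal to `w_i` because the matrix is an isometry, and it vanishes
      -- in the pivot row because its own row is different. The reflection fixes it, and the
      -- monomial gate only relabels it.
      have ho := hR.star_column_dotProduct (σ (Fin.ofNat (2 ^ m) i)) (σ (Fin.ofNat (2 ^ m) j))
      rw [if_neg hσ] at ho
      rw [householderMap_mulVec_of_orthogonal _ ho (by rw [e, Pi.smul_apply, Pi.single_eq_of_ne hρ, smul_zero]), e,
        diagGate_mul_permGate_mulVec_single]
      exact ⟨_, by rw [norm_mul, Circle.norm_coe, hc, one_mul], rfl⟩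
    · rw [householderMap_mulVec_self _ hv, diagGate_mul_permGate_mulVec_single]
      exact ⟨_, by rw [norm_mul, Circle.norm_coe, norm_householderPhase, one_mul], rfl⟩

lemma exists_column_reduced_last_eq (hW : IsIsometry W) (x : Fin (2 ^ m)) :
    ∃ (c : ℂ) (r : Fin (2 ^ n)), ‖c‖ = 1 ∧
      (column (reduced W ρ σ D P (2 ^ m)) x).ofLp = c • Pi.single r 1 := by
  obtain ⟨c, hc, e⟩ := exists_column_reduced_eq ρ σ D P hW le_rfl (σ.symm x).2
  have hx : Fin.ofNat (2 ^ m) (σ.symm x : ℕ) = σ.symm x := Fin.ext (Nat.mod_eq_of_lt (σ.symm x).2)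
  rw [hx, Equiv.apply_symm_apply] at e
  exact ⟨c, _, hc, e⟩

/-- Reflections that are implemented up to monomial gates reduce `W` up to a monomial gate. -/
lemma exists_implementable_reducing (hW : IsIsometry W) {c : ℕ → ℕ} {N : ℕ}
    (hstep : ∀ i < N, ∀ v : EuclideanSpace ℂ (Fin (2 ^ n)), ‖v‖ = 1 →
      nnz v.ofLp ≤ stepNnz W ρ σ D P i + 1 → ∃ (d : Fin (2 ^ n) → Circle)
        (π : Equiv.Perm (Fin (2 ^ n))),
        Implementable a b (c i) (diagGate d * permGate π * householder v)) :
    ∃ T G : Matrix (Fin (2 ^ n)) (Fin (2 ^ n)) ℂ,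
      Implementable a b (∑ i ∈ Finset.range N, c i) T ∧ Tᴴ * T = 1 ∧ IsMonomial G ∧
        (T * W : Matrix (Fin (2 ^ n)) (Fin (2 ^ m)) ℂ) = G * reduced W ρ σ D P N := by
  induction N with
  | zero =>
    exact ⟨1, 1, by simpa using Implementable.one, by simp, IsMonomial.one, rfl⟩
  | succ i ih =>
    obtain ⟨T, G, hT, hTu, hG, hTG⟩ := ih fun j hj => hstep j (hj.trans (Nat.lt_succ_self i))
    have hR := isIsometry_reduced ρ σ D P hW i
    have hw := hR.norm_column (σ (Fin.ofNat (2 ^ m) i))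
    set w := column (reduced W ρ σ D P i) (σ (Fin.ofNat (2 ^ m) i)) with hwdef
    set r := cumPerm P i (ρ (Fin.ofNat (2 ^ n) i)) with hr
    set u := householderVector w (EuclideanSpace.single r 1) with hu
    -- The circuit has produced `G W_i` rather than `W_i`, so the reflection is taken about `G u`,
    -- for which `H_{Gu} G = G H_u`.
    set v : EuclideanSpace ℂ (Fin (2 ^ n)) := WithLp.toLp 2 (G *ᵥ u.ofLp) with hv
    have hGu := hG.conjTranspose_mul_self
    have hvv : star v.ofLp ⬝ᵥ v.ofLp = 1 := by
      have h1 : star v.ofLp ⬝ᵥ v.ofLp = star u.ofLp ⬝ᵥ u.ofLp := star_dotProduct_mulVec hGu u.ofLp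
      rw [h1, star_dotProduct_self, norm_householderVector r hw]
      norm_num
    have hv1 : ‖v‖ = 1 := by
      rw [star_dotProduct_self] at hvv
      exact (pow_eq_one_iff_of_nonneg (norm_nonneg _) two_ne_zero).1 (by exact_mod_cast hvv)
    have hvn : nnz v.ofLp ≤ stepNnz W ρ σ D P i + 1 :=
      (hG.nnz_mulVec_le _).trans (nnz_householderVector_le r)
    obtain ⟨d, π, hE⟩ := hstep i (Nat.lt_succ_self i) v hv1 hvn
    have hM : IsMonomial (diagGate d * permGate π) := ⟨d, π, rfl⟩
    have hM' : IsMonomial (diagGate (D i) * permGate (P i)) := ⟨_, _, rfl⟩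
    set M : Matrix (Fin (2 ^ n)) (Fin (2 ^ n)) ℂ := diagGate d * permGate π with hMdef
    set M' : Matrix (Fin (2 ^ n)) (Fin (2 ^ n)) ℂ := diagGate (D i) * permGate (P i) with hMdef'
    have hHv : (householder v)ᴴ * householder v = 1 := reflection_mul_self hvv
    have hGH : (householder v * G : Matrix (Fin (2 ^ n)) (Fin (2 ^ n)) ℂ) =
        G * householderMap w (EuclideanSpace.single r 1) := (mul_reflection hGu u.ofLp).symm
    -- Here `M` is the monomial gate that the circuit leaves over and `M'` the prescribed one. The
    -- new discrepancy is `M G M'ᴴ`, since `M H_v G W_i = M G H_u W_i = (M G M'ᴴ) W_{i+1}`.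
    refine ⟨M * householder v * T, M * G * M'ᴴ, ?_, ?_, (hM.mul hG).mul hM'.conjTranspose, ?_⟩
    · rw [Finset.sum_range_succ, Nat.add_comm]
      exact hE.mul hT
    · exact ((hM.isIsometry).mul hHv).mul hTu
    · rw [Matrix.mul_assoc, hTG, reduced, ← hwdef, ← hr, ← hMdef', Matrix.mul_assoc (M * G),
        Matrix.mul_assoc M', ← Matrix.mul_assoc M'ᴴ, hM'.conjTranspose_mul_self, Matrix.one_mul,
        Matrix.mul_assoc M, ← Matrix.mul_assoc (householder v), hGH]
      simp only [Matrix.mul_assoc]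

/-- The CNOT count of the sparse Householder decomposition. -/
lemma implementable_of_steps (hW : IsIsometry W) {c : ℕ → ℕ} {p : ℕ}
    (hstep : ∀ i < 2 ^ m, ∀ v : EuclideanSpace ℂ (Fin (2 ^ n)), ‖v‖ = 1 →
      nnz v.ofLp ≤ stepNnz W ρ σ D P i + 1 → ∃ (d : Fin (2 ^ n) → Circle)
        (π : Equiv.Perm (Fin (2 ^ n))),
        Implementable a b (c i) (diagGate d * permGate π * householder v))
    (hperm : ∀ (π : Equiv.Perm (Fin (2 ^ n))) (d : Fin (2 ^ m) → Circle),
      Implementable a b p (permGate π * idIso n m * diagGate d)) :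
    Implementable a b (∑ i ∈ Finset.range (2 ^ m), c i + p) W := by
  obtain ⟨T, G, hT, hTu, hG, hTG⟩ := exists_implementable_reducing ρ σ D P hW hstep
  have hX : IsIsometry (T * W : Matrix (Fin (2 ^ n)) (Fin (2 ^ m)) ℂ) := IsIsometry.mul hTu hW
  obtain ⟨π, d, e⟩ := hX.exists_eq_permDiag fun x => by
    obtain ⟨c, r, hc, hx⟩ := exists_column_reduced_last_eq ρ σ D P hW x
    rw [hTG, column_mul, hx]
    exact hG.exists_mulVec_single hc r
  have hWe : W = Tᴴ * (permGate π * idIso n m * diagGate d) := by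
    rw [← e, ← Matrix.mul_assoc, hTu, Matrix.one_mul]
  rw [hWe]
  exact (hT.conjTranspose (mul_eq_one_comm.1 hTu)).mul (hperm π d)

end Decomposition

/-! ### CNOT counts of isometries -/

section Counts

variable {m n a b : ℕ}

/-- A finite infimum of natural numbers is attained; this is extracted from the strict inequality
with `k + 1`. -/
lemma cnotCost_le_iff {T : Set (Matrix (Fin (2 ^ n)) (Fin (2 ^ m)) ℂ)} {k : ℕ} :
    cnotCost a b T ≤ k ↔ ∃ V ∈ T, Implementable a b k V := by
  constructor
  · intro h
    have h1 : cnotCost a b T < ((k + 1 : ℕ) : ℕ∞) :=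
      h.trans_lt (by exact_mod_cast Nat.lt_succ_self k)
    rw [cnotCost] at h1
    simp only [iInf_lt_iff] at h1
    obtain ⟨C, ⟨V, hV, hC⟩, hk⟩ := h1
    exact ⟨V, hV, C, Nat.lt_succ_iff.1 (by exact_mod_cast hk), hC⟩
  · rintro ⟨V, hV, C, hk, hC⟩
    exact (iInf₂_le C ⟨V, hV, hC⟩).trans (by exact_mod_cast hk)

lemma one_add_le_two_pow_ceil_logb (N : ℕ) : N + 1 ≤ 2 ^ ⌈Real.logb 2 (1 + (N : ℝ))⌉₊ := by
  have h0 : (0 : ℝ) < 1 + N := by positivity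
  have h1 : (1 + N : ℝ) ≤ 2 ^ ((⌈Real.logb 2 (1 + (N : ℝ))⌉₊ : ℕ) : ℝ) :=
    (Real.logb_le_iff_le_rpow (by norm_num) h0).1 (Nat.le_ceil _)
  rw [Real.rpow_natCast] at h1
  have h2 : ((N + 1 : ℕ) : ℝ) ≤ ((2 ^ ⌈Real.logb 2 (1 + (N : ℝ))⌉₊ : ℕ) : ℝ) := by
    push_cast
    linarith
  exact_mod_cast h2

variable {W : Matrix (Fin (2 ^ n)) (Fin (2 ^ m)) ℂ} (ρ : Equiv.Perm (Fin (2 ^ n)))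
  (σ : Equiv.Perm (Fin (2 ^ m))) (D : ℕ → Fin (2 ^ n) → Circle)
  (P : ℕ → Equiv.Perm (Fin (2 ^ n)))

/-- If a summand is infinite there is nothing to prove. Otherwise each supremum is a number that
bounds the cost of every reflection, respectively every `Π I Δ`, that the decomposition may require.
-/
lemma cnotCost_le_sum_householderCost (hW : IsIsometry W) :
    cnotCost a b {W} ≤
      ∑ i ∈ Finset.range (2 ^ m),
          householderCost a b n ⌈Real.logb 2 (1 + (stepNnz W ρ σ D P i : ℝ))⌉₊ +
        permDiagCost a b n m := by
  set s : ℕ → ℕ := fun i => ⌈Real.logb 2 (1 + (stepNnz W ρ σ D P i : ℝ))⌉₊ with hs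
  by_cases hp : permDiagCost a b n m = ⊤
  · rw [hp, add_top]
    exact le_top
  by_cases hc : ∃ i ∈ Finset.range (2 ^ m), householderCost a b n (s i) = ⊤
  · rw [(ENat.sum_eq_top (f := fun i => householderCost a b n (s i))).2 hc, top_add]
    exact le_top
  push Not at hc
  have hce : ∀ i ∈ Finset.range (2 ^ m),
      ((householderCost a b n (s i)).toNat : ℕ∞) = householderCost a b n (s i) :=
    fun i hi => ENat.natCast_toNat (hc i hi)
  rw [← Finset.sum_congr rfl hce, ← ENat.natCast_toNat hp, ← Nat.cast_sum, ← Nat.cast_add,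
    cnotCost_le_iff]
  refine ⟨W, rfl, implementable_of_steps ρ σ D P hW (fun i hi v h1 hv => ?_) fun π d => ?_⟩
  · have h2 : cnotCost a b {M | ∃ (d : Fin (2 ^ n) → Circle) (π : Equiv.Perm (Fin (2 ^ n))),
        M = diagGate d * permGate π * householder v} ≤ householderCost a b n (s i) :=
      le_iSup₂_of_le v h1 (le_iSup_of_le (hv.trans (one_add_le_two_pow_ceil_logb _)) le_rfl)
    rw [← hce i (Finset.mem_range.2 hi), cnotCost_le_iff] at h2
    obtain ⟨V, ⟨d, π, rfl⟩, hV⟩ := h2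
    exact ⟨d, π, hV⟩
  · have h2 : cnotCost a b {permGate π * idIso n m * diagGate d} ≤ permDiagCost a b n m :=
      le_iSup₂_of_le π d le_rfl
    rw [← ENat.natCast_toNat hp, cnotCost_le_iff] at h2
    obtain ⟨V, rfl, hV⟩ := h2
    exact hV

lemma one_le_stepNnz (hW : IsIsometry W) (i : ℕ) : 1 ≤ stepNnz W ρ σ D P i := by
  rw [Nat.one_le_iff_ne_zero]
  intro h
  have h1 := (isIsometry_reduced ρ σ D P hW i).norm_column (σ (Fin.ofNat (2 ^ m) i))
  have h2 := (Set.ncard_eq_zero (Set.toFinite _)).1 h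
  rw [Function.support_eq_empty_iff] at h2
  have h3 := star_dotProduct_self
    (column (reduced W ρ σ D P i) (σ (Fin.ofNat (2 ^ m) i)))
  rw [h2, h1] at h3
  norm_num at h3

/-- Implementing an isometry from gates that exchange a pair of basis states. -/
lemma exists_implements_of_realizes_onesSwap (hW : IsIsometry W) {τ : ℕ}
    (h : ∀ t : Fin n, Realizes a b τ (permGate (onesSwap t))) (hn : 1 ≤ n) {A B : ℤ}
    (hA : (n : ℤ) + 7 + τ ≤ A)
    (hB : (n : ℤ) - 1 + 2 * τ + (if m = 0 then 0 else 2 * n - 1 + τ : ℤ) ≤ B) :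
    ∃ C : Circuit n a b, Implements C W ∧
      (cnotCount C : ℤ) ≤ A * elim W ρ σ D P + B * 2 ^ m := by
  have hk := one_le_stepNnz ρ σ D P hW
  set k := stepNnz W ρ σ D P with hkdef
  obtain ⟨C, hC, hCW⟩ := implementable_of_steps (a := a) (b := b)
    (c := fun i => k i * (n - 1 + τ) + τ + (8 * k i - 8)) ρ σ D P hW
    (fun i _ v h1 hv => by
      obtain ⟨π, hπ⟩ := exists_implementable_householder h hn (hk i) h1 hv
      refine ⟨1, π, ?_⟩
      rw [diagGate_one, Matrix.one_mul]
      exact hπ)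
    (implementable_permDiag h hn hW.le)
  refine ⟨C, hCW, (Nat.cast_le.2 hC).trans ?_⟩
  -- With `k = nnz(w_i)`, the cost of a step is `(k - 1) (n + 7 + τ) + (n - 1 + 2 τ)`; the first
  -- terms add up to the multiple of `elim`.
  have hsum : ((∑ i ∈ Finset.range (2 ^ m), (k i * (n - 1 + τ) + τ + (8 * k i - 8)) : ℕ) : ℤ) =
      (n + 7 + τ) * elim W ρ σ D P + 2 ^ m * (n - 1 + 2 * τ) := by
    have e : ((2 : ℤ) ^ m) * (n - 1 + 2 * τ) =
        ∑ _i ∈ Finset.range (2 ^ m), ((n : ℤ) - 1 + 2 * τ) := by simp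
    rw [elim, e, Finset.mul_sum, ← Finset.sum_add_distrib, Nat.cast_sum]
    refine Finset.sum_congr rfl fun i _ => ?_
    have h8 : 8 ≤ 8 * k i := Nat.le_mul_of_pos_right 8 (hk i)
    push_cast [Nat.cast_sub hn, Nat.cast_sub h8]
    ring
  have helim : 0 ≤ elim W ρ σ D P := Finset.sum_nonneg fun i _ => by
    have : (1 : ℤ) ≤ k i := by exact_mod_cast hk i
    exact sub_nonneg.2 this
  have hp : (((if m = 0 then 0 else 2 ^ m * (2 * (n - 1) + τ) + 2 ^ m : ℕ)) : ℤ) =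
      (if m = 0 then 0 else 2 * n - 1 + τ : ℤ) * 2 ^ m := by
    split_ifs
    · simp
    · push_cast [Nat.cast_sub hn]
      ring
  rw [Nat.cast_add, hsum, hp]
  have h1 := mul_le_mul_of_nonneg_right hA helim
  have h2 := mul_le_mul_of_nonneg_right hB (pow_nonneg (zero_le_two (α := ℤ)) m)
  linarith

end Counts
end QCircuit

end

theorem mainTheorem3 (m n : ℕ) (W : Matrix (Fin (2 ^ n)) (Fin (2 ^ m)) ℂ)
    (hW : QCircuit.IsIsometry W)
    (ρ : Equiv.Perm (Fin (2 ^ n))) (σ : Equiv.Perm (Fin (2 ^ m)))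
    (D : ℕ → Fin (2 ^ n) → Circle) (P : ℕ → Equiv.Perm (Fin (2 ^ n))) :
    (∀ a b : ℕ,
      QCircuit.cnotCost a b {W} ≤
        ∑ i ∈ Finset.range (2 ^ m),
            QCircuit.householderCost a b n
              ⌈Real.logb 2 (1 + (QCircuit.stepNnz W ρ σ D P i : ℝ))⌉₊ +
          QCircuit.permDiagCost a b n m) ∧
    (2 ≤ n →
      ∃ C : QCircuit.Circuit n ⌈((n : ℚ) - 3) / 2⌉₊ 0,
        QCircuit.Implements C W ∧
        (QCircuit.cnotCount C : ℤ) ≤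
          (7 * (n : ℤ) - 3) * QCircuit.elim W ρ σ D P +
            (21 * (n : ℤ) + 24 * (m : ℤ) - 38) * 2 ^ m) ∧
    (1 ≤ n →
      ∃ C : QCircuit.Circuit n 0 1,
        QCircuit.Implements C W ∧
        (QCircuit.cnotCount C : ℤ) ≤
          (17 * (n : ℤ) - 5) * QCircuit.elim W ρ σ D P +
            (51 * (n : ℤ) + 34 * (m : ℤ) - 44) * 2 ^ m) := by
  refine ⟨fun a b => QCircuit.cnotCost_le_sum_householderCost ρ σ D P hW, fun hn => ?_,
    fun hn => ?_⟩
  · have ha : n ≤ 2 * ⌈((n : ℚ) - 3) / 2⌉₊ + 3 := by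
      have h := Nat.le_ceil (((n : ℚ) - 3) / 2)
      have h' : (n : ℚ) ≤ ((2 * ⌈((n : ℚ) - 3) / 2⌉₊ + 3 : ℕ) : ℚ) := by
        push_cast
        linarith
      exact_mod_cast h'
    -- Here `τ` is `6 n - 12` for `n ≥ 3` and `1` for `n = 2`. For `n = 2` and `m = 0` the estimate
    -- needs the free `Π I Δ` of the case `m = 0`: the bound `4` leaves room for `3` but not for `3
    -- + 4`.
    refine QCircuit.exists_implements_of_realizes_onesSwap ρ σ D P hW
      (fun t => QCircuit.realizes_onesSwap_clean t ha) (by omega) ?_ ?_ <;>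
    · rw [QCircuit.cleanCost]
      split_ifs <;> omega
  -- With `τ = 16 (n - 1)` the coefficients are `17 n - 9` and, for `m ≥ 1`, `51 n - 50`.
  · refine QCircuit.exists_implements_of_realizes_onesSwap ρ σ D P hW
      QCircuit.realizes_onesSwap_dirty hn ?_ ?_
    · omega
    · split_ifs <;> omega
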